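/- Let $S$ be a countable set, $P=(P_{ij})_{i,j\in S}$ a stochastic matrix with $P_{ii}=0$ for all $i$, which is irreducible, aperiodic and positive recurrent, with stationary distribution $\mu=\mu P$. For all $i,j$ with $P_{ij}>0$ let $F_{ij}$ be (the distribution function of) a probability law on $(0,\infty)$ that is absolutely continuous with respect to Lebesgue measure, with mean $m_{ij}=\int_0^\infty(1-F_{ij}(t))\,dt$, and assume $\sup_{i,j}m_{ij}<\infty$. Put $m_i=\sum_jP_{ij}m_{ij}$ and $\pi_j=\mu_jm_j/\sum_k\mu_km_k$, and let $\pi_j^*$ be the law on $(0,\infty)$ with $$\pi_j^*[x,\infty)=\frac{1}{m_j}\sum_{k\in S}P_{jk}\int_x^\infty(1-F_{jk}(y))\,dy,\qquad x>0.$$ Let $(J_n,T_n)_{n\ge0}$ be a Markov chain with values in $S\times\mathbb R_+$, with $T_0=0$, arbitrary law of $J_0$, and $$P[J_{n+1}=j,\,T_{n+1}\le t\mid (J_k,T_k)_{k\le n}]=P_{J_n j}F_{J_n j}(t).$$ Put $S_n=\sum_{k=0}^nT_k$, $N_t=\sup\{n:S_n\le t\}$, assume that $N_t<\infty$ almost surely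 for all $t\ge 0$ (no explosion), and let $Y_t=J_{N_t}$ be the associated semi-Markov process. For $j\in S$ let $\tau_0^j=S_{N^j_0}$ and $\tau_1^j=S_{N^j_1}$, where $N^j_0=\inf\{n\ge0:J_n=j\}$ and $N_1^j=\inf\{n>N_0^j:J_n=j\}$. For $a,b:S\to\mathbb R$ put $$\Phi_t=e^{-\int_0^ta(Y_r)dr},\qquad I_t=\int_0^tb(Y_s)e^{-\int_s^ta(Y_r)dr}ds,$$ $$(A_j,B_j)=\Big(e^{-\int_{\tau_0^j}^{\tau_1^j}a(Y_s)ds},\ \int_{\tau_0^j}^{\tau_1^j}b(Y_s)e^{-\int_s^{\tau_1^j}a(Y_r)dr}ds\Big).$$ Assume that $a$ is $\pi$-integrable with $E_\pi a=\sum_j\pi_ja(j)>0$ and that $E\log^+|B_j|<\infty$ for every $j\in S$. Then for every $j\in S$ there is exactly one probability law on $\mathbb R$, denoted $\mathcal L(V_j^*)$, that solves $X\overset{d}{=}A_jX+B_j$ with $X$ independent of $(A_j,B_j)$. Moreover, as $t\to\infty$, $$(\Phi_t,I_t,Y_t)\ \overset{d}{\longrightarrow}\ \Big(0,\ \sum_{j\in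 S}\delta_U(\{j\})Z_j,\ U\Big),$$ where $U\sim\pi$ is independent of the family $(Z_j)_{j\in S}$ and, for each $j$, $$Z_j\overset{d}{=}b(j)\int_0^{T^j}e^{-a(j)(T^j-s)}ds+e^{-a(j)T^j}V_j^*,$$ with $T^j\sim\pi_j^*$ independent of $V_j^*$. -/

import Mathlib

open MeasureTheory ProbabilityTheory Filter Set
open scoped ENNReal NNReal

noncomputable section

namespace SemiMarkov

/-! ### The embedded chain -/

section Chain

variable {S : Type*}

/-- The `n`-step transition probabilities of the chain with transition matrix `P`
(`P i` is the `i`-th row, so `P i j` is the probability of a jump from `i` to `j`). -/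
def nStep (P : S → PMF S) : ℕ → S → PMF S
  | 0, i => PMF.pure i
  | n + 1, i => (P i).bind (nStep P n)

/-- Every state can be reached from every state. -/
def IrreducibleChain (P : S → PMF S) : Prop :=
  ∀ i j, ∃ n, nStep P n i j ≠ 0

/-- Every state `i` has period one: the only common divisor of the times `n ≥ 1` at which a return
to `i` has positive probability is `1`. -/
def AperiodicChain (P : S → PMF S) : Prop :=
  ∀ i, ∀ d : ℕ, (∀ n, 0 < n → nStep P n i i ≠ 0 → d ∣ n) → d = 1

open Classical in
/-- `firstPassage P j n i` is the probability that the chain started at `i` visits `j` at time `n`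
and at none of the times `1, …, n - 1` (and `0` for `n = 0`). -/
def firstPassage (P : S → PMF S) (j : S) : ℕ → S → ℝ≥0∞
  | 0, _ => 0
  | 1, i => P i j
  | n + 2, i => ∑' k, if k = j then 0 else P i k * firstPassage P j (n + 1) k

/-- Every state is recurrent with finite mean return time. -/
def PositiveRecurrentChain (P : S → PMF S) : Prop :=
  ∀ j, ∑' n, firstPassage P j n j = 1 ∧ ∑' n : ℕ, (n : ℝ≥0∞) * firstPassage P j n j ≠ ∞

/-- `μ` is a stationary distribution: `μ = μ P`. -/
def StationaryDistribution (P : S → PMF S) (μ : PMF S) : Prop :=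
  μ.bind P = μ

end Chain

/-! ### Sojourn times -/

section Sojourn

variable {S : Type*}

/-- `m_{ij}`, the mean of the sojourn law `F i j`, as the integral of its tail. -/
def meanSojourn (F : S → S → Measure ℝ) (i j : S) : ℝ≥0∞ :=
  ∫⁻ t in Ioi (0 : ℝ), F i j (Ioi t)

/-- `m_i = ∑_j P_{ij} m_{ij}`, the mean sojourn time at `i`. -/
def meanHolding (P : S → PMF S) (F : S → S → Measure ℝ) (i : S) : ℝ≥0∞ :=
  ∑' j, P i j * meanSojourn F i j

/-- `π_j = μ_j m_j / ∑_k μ_k m_k`. -/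
def limitWeight (P : S → PMF S) (F : S → S → Measure ℝ) (μ : PMF S) (j : S) : ℝ≥0∞ :=
  μ j * meanHolding P F j / ∑' k, μ k * meanHolding P F k

/-- The measure `π = ∑_j π_j δ_j` on the state space. -/
def limitLaw [MeasurableSpace S] (P : S → PMF S) (F : S → S → Measure ℝ) (μ : PMF S) :
    Measure S :=
  Measure.sum fun j => limitWeight P F μ j • Measure.dirac j

/-- `π_j^*`, the law on `(0, ∞)` with density `y ↦ (∑_k P_{jk} (1 - F_{jk}(y))) / m_j`. -/
def sizeBiasedLaw (P : S → PMF S) (F : S → S → Measure ℝ) (j : S) : Measure ℝ :=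
  (volume.restrict (Ioi (0 : ℝ))).withDensity
    fun y => (∑' k, P j k * F j k (Ioi y)) / meanHolding P F j

/-- The tails of `π_j^*`. -/
theorem sizeBiasedLaw_Ici [Countable S] (P : S → PMF S) (F : S → S → Measure ℝ) (j : S)
    {x : ℝ} (hx : 0 ≤ x) :
    sizeBiasedLaw P F j (Ici x)
      = (∑' k, P j k * ∫⁻ y in Ioi x, F j k (Ioi y)) / meanHolding P F j := by
  have hm : ∀ k, Measurable fun y : ℝ => F j k (Ioi y) := fun k =>
    Antitone.measurable fun y z h => measure_mono (Ioi_subset_Ioi h)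
  have h1 : (volume.restrict (Ioi (0 : ℝ))).restrict (Ici x) = volume.restrict (Ioi x) := by
    rw [Measure.restrict_congr_set (Ioi_ae_eq_Ici (a := x)).symm,
      Measure.restrict_restrict measurableSet_Ioi, inter_eq_left.2 (Ioi_subset_Ioi hx)]
  rw [sizeBiasedLaw, withDensity_apply _ measurableSet_Ici, h1]
  simp only [div_eq_mul_inv]
  rw [lintegral_mul_const _ (Measurable.tsum fun k => (hm k).const_mul _),
    lintegral_tsum fun k => ((hm k).const_mul _).aemeasurable]
  simp_rw [lintegral_const_mul _ (hm _)]

/-- The standing assumptions on the transition matrix `P`, the sojourn laws `F` and the stationary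
distribution `μ`. Only the laws `F i j` of possible transitions (`P i j ≠ 0`) matter. -/
structure ErgodicEnvironment (P : S → PMF S) (F : S → S → Measure ℝ) (μ : PMF S) : Prop where
  diag_zero : ∀ i, P i i = 0
  irreducible : IrreducibleChain P
  aperiodic : AperiodicChain P
  positiveRecurrent : PositiveRecurrentChain P
  stationary : StationaryDistribution P μ
  isProbabilityMeasure : ∀ i j, P i j ≠ 0 → IsProbabilityMeasure (F i j)
  pos : ∀ i j, P i j ≠ 0 → F i j (Iic 0) = 0
  absolutelyContinuous : ∀ i j, P i j ≠ 0 → F i j ≪ volume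
  bounded_mean : ∃ C : ℝ≥0, ∀ i j, P i j ≠ 0 → meanSojourn F i j ≤ C

end Sojourn

/-! ### The semi-Markov process -/

section Paths

variable {S Ω : Type*}

/-- `(J, T)` is a Markov chain with `T_0 = 0`, `J_0 ∼ p` and, given the history up to time `n`,
`P[J_{n+1} = j, T_{n+1} ≤ t | history] = P_{ij} F_{ij}(t)` on the event `J_n = i`. -/
structure IsMarkovRenewal [MeasurableSpace S] [MeasurableSpace Ω] (P : S → PMF S)
    (F : S → S → Measure ℝ) (p : PMF S) (Pr : Measure Ω) (J : ℕ → Ω → S) (T : ℕ → Ω → ℝ) :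
    Prop where
  measurable_J : ∀ n, Measurable (J n)
  measurable_T : ∀ n, Measurable (T n)
  initial : ∀ i, Pr {ω | J 0 ω = i ∧ T 0 ω = 0} = p i
  transition : ∀ (n : ℕ) (i j : S) (t : ℝ) (B : Set (Fin (n + 1) → S × ℝ)), MeasurableSet B →
    Pr {ω | (fun k : Fin (n + 1) => (J k ω, T k ω)) ∈ B ∧ J n ω = i ∧
        J (n + 1) ω = j ∧ T (n + 1) ω ≤ t}
      = Pr {ω | (fun k : Fin (n + 1) => (J k ω, T k ω)) ∈ B ∧ J n ω = i} *
        (P i j * F i j (Iic t))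

/-- `S_n = T_0 + ⋯ + T_n`, the time of the `n`-th jump. -/
def jumpTime (T : ℕ → Ω → ℝ) (n : ℕ) (ω : Ω) : ℝ :=
  ∑ k ∈ Finset.range (n + 1), T k ω

/-- `N_t = sup {n : S_n ≤ t}`. -/
def jumpCount (T : ℕ → Ω → ℝ) (t : ℝ) (ω : Ω) : ℕ :=
  sSup {n | jumpTime T n ω ≤ t}

/-- No explosion: almost surely only finitely many jumps occur up to any time `t`. -/
def NonExplosive [MeasurableSpace Ω] (Pr : Measure Ω) (T : ℕ → Ω → ℝ) : Prop :=
  ∀ t : ℝ, 0 ≤ t → ∀ᵐ ω ∂Pr, {n | jumpTime T n ω ≤ t}.Finite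

/-- The semi-Markov process `Y_t = J_{N_t}`. -/
def semiMarkov (J : ℕ → Ω → S) (T : ℕ → Ω → ℝ) (t : ℝ) (ω : Ω) : S :=
  J (jumpCount T t ω) ω

/-- `N_k^j`, the index of the `k`-th visit (`k = 0, 1, …`) of the chain to `j`. -/
def visitIndex (J : ℕ → Ω → S) (j : S) : ℕ → Ω → ℕ
  | 0, ω => sInf {n | J n ω = j}
  | k + 1, ω => sInf {n | visitIndex J j k ω < n ∧ J n ω = j}

/-- `τ_k^j`, the time of the `k`-th entrance of `Y` to `j`. -/
def visitTime (J : ℕ → Ω → S) (T : ℕ → Ω → ℝ) (j : S) (k : ℕ) (ω : Ω) : ℝ :=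
  jumpTime T (visitIndex J j k ω) ω

/-- `exp (-∫_s^t a(y_r) dr)` along a path `y`. -/
def discount (a : S → ℝ) (y : ℝ → S) (s t : ℝ) : ℝ :=
  Real.exp (-∫ r in s..t, a (y r))

/-- `∫_u^t b(y_s) exp (-∫_s^t a(y_r) dr) ds` along a path `y`. -/
def perpetuity (a b : S → ℝ) (y : ℝ → S) (u t : ℝ) : ℝ :=
  ∫ s in u..t, b (y s) * discount a y s t

/-- The pair `(A, B)` built from the first cycle `[τ_0^j, τ_1^j)` of `Y` at `j`. -/
def cyclePair (a b : S → ℝ) (J : ℕ → Ω → S) (T : ℕ → Ω → ℝ) (j : S) (ω : Ω) : ℝ × ℝ :=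
  (discount a (fun t => semiMarkov J T t ω) (visitTime J T j 0 ω) (visitTime J T j 1 ω),
    perpetuity a b (fun t => semiMarkov J T t ω) (visitTime J T j 0 ω) (visitTime J T j 1 ω))

end Paths

/-! ### The limit -/

/-- The probability measure `ν` solves `X =ᵈ A X + B`, with `X ∼ ν` independent of
`(A, B) ∼ κ`. -/
def SolvesSRE (κ : Measure (ℝ × ℝ)) (ν : Measure ℝ) : Prop :=
  IsProbabilityMeasure ν ∧ (κ.prod ν).map (fun q => q.1.1 * q.2 + q.1.2) = ν

section Limit

variable {S : Type*}

/-- The law of `b(j) ∫_0^{T^j} exp (-a(j) (T^j - s)) ds + exp (-a(j) T^j) V`, with `T^j ∼ π_j^*`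
and `V ∼ ν` independent. -/
def componentLaw (P : S → PMF S) (F : S → S → Measure ℝ) (a b : S → ℝ) (ν : Measure ℝ) (j : S) :
    Measure ℝ :=
  ((sizeBiasedLaw P F j).prod ν).map fun q =>
    b j * (∫ s in (0 : ℝ)..q.1, Real.exp (-(a j) * (q.1 - s))) + Real.exp (-(a j) * q.1) * q.2

/-- `U ∼ π` is independent of the family `(Z_j)`, and every `Z_j` has the required law. -/
structure IsLimitModel [MeasurableSpace S] {Ω' : Type*} [MeasurableSpace Ω'] (P : S → PMF S)
    (F : S → S → Measure ℝ) (μ : PMF S) (a b : S → ℝ) (V : S → Measure ℝ)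
    (Pr' : Measure Ω') (U : Ω' → S) (Z : S → Ω' → ℝ) : Prop where
  law_U : HasLaw U (limitLaw P F μ) Pr'
  law_Z : ∀ j, HasLaw (Z j) (componentLaw P F a b (V j) j) Pr'
  indep : IndepFun U (fun ω j => Z j ω) Pr'

/-- `(0, ∑_j δ_U({j}) Z_j, U)`. -/
def limitVector {Ω' : Type*} (U : Ω' → S) (Z : S → Ω' → ℝ) (ω : Ω') : ℝ × ℝ × S :=
  (0, ∑' j, Set.indicator {j} (fun _ => Z j ω) (U ω), U ω)

end Limit

end SemiMarkov

end

open SemiMarkov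

universe u v w

open MeasureTheory ProbabilityTheory Filter Set
open scoped ENNReal NNReal Topology

set_option linter.unusedSectionVars false

noncomputable section

namespace SemiMarkov

/-! Fix a state `j`. A stretch of path transforms the perpetuity by an affine map `v ↦ i + exp (-l)
v` and takes a time `s`; joining two stretches is multiplication in the monoid `Aff`, the later
stretch on the left. The visits to `j` cut the path into independent cycles with common law
`cycleMeas`, so the walk in `Aff` observed at these visits is a delayed renewal process
(`IsMarkovRenewal.sum_visitMeas`). An expectation at time `t` on the event that the state is `j` is
a sum over all visits to `j` of the test function times the probability `holdTail` that the sojourn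
begun there still lasts at `t` (`IsMarkovRenewal.lintegral_stateAt`).

Products that grow on the left do not converge pathwise. For independent identically distributed
factors, however, the law of a product is unchanged when the order is reversed, and the clock, being
additive, does not notice the reversal. The reversed products grow on the right, so by the strong
law of large numbers their slopes tend to `0` and their shifts converge almost surely to a
perpetuity, whose law is the unique solution of the fixed point equation (`Contractive.ae_tendsto`,
`Contractive.eq_of_solvesSRE`). The perpetuity is thus nearly a function of the most recent `n`
cycles, with `n` fixed, while the clocks of the remaining cycles form an independent renewal
process. The key renewal theorem, applied to this process, makes the age asymptotically independent
of the perpetuity (`Contractive.tendsto_tsum_lintegral_affPow`). The truncation error is uniform in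
`t` because the weighted number `tailSum` of renewals near `t` has second moment at most `2`.

The key renewal theorem itself (`tendsto_renewalFn`) rests on two facts. The renewal measure `U`
satisfies `U * tail = 1` on the half line, hence `Z = U * g` satisfies `Z * tail = ∫_{x ≤ t} g`.
Absolute continuity makes high convolution powers almost invariant under translation, so `Z t - Z (t
- s) → 0`. Together, `m Z t` is close to `(Z * tail) t`, which tends to `∫ g`.

The constants come from the cycle formula: `μ` is proportional to the expected occupation of a cycle
(`StationaryDistribution.eq_mul_occupation`), so the mean rate over a cycle is the mean cycle length
times `E_π a`, and `holdTail / cycleMean` is `π_j` times the density of `π_j^*`. The limits for the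
single states add up by a Scheffé argument, since the limit has total mass one
(`tendsto_tsum_of_add_eq_one`). Finally the values at the last jump are advanced to time `t` by the
continuous map `advance`. -/

/-! ### The renewal theorem for absolutely continuous laws -/

section Renewal

/-- The convolution powers of a measure on the line. -/
def convPow (F : Measure ℝ) : ℕ → Measure ℝ
  | 0 => Measure.dirac 0
  | n + 1 => F ∗ convPow F n

instance convPow_finite (F : Measure ℝ) [IsFiniteMeasure F] (n : ℕ) :
    IsFiniteMeasure (convPow F n) := by
  induction n with
  | zero => unfold convPow; infer_instance
  | succ n ih => unfold convPow; infer_instance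

instance convPow_probability (F : Measure ℝ) [IsProbabilityMeasure F] (n : ℕ) :
    IsProbabilityMeasure (convPow F n) := by
  induction n with
  | zero => unfold convPow; infer_instance
  | succ n ih => unfold convPow; infer_instance

theorem convPow_add (F : Measure ℝ) [IsFiniteMeasure F] (n m : ℕ) :
    convPow F (n + m) = convPow F n ∗ convPow F m := by
  induction n with
  | zero => simp [convPow]
  | succ n ih =>
    rw [Nat.succ_add, convPow, ih, convPow, Measure.conv_assoc]

/-- The tail of `F` on the half line. -/
def tailFn (F : Measure ℝ) (x : ℝ) : ℝ≥0∞ := if 0 ≤ x then F (Ioi x) else 0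

theorem measurable_measure_Ioi (F : Measure ℝ) : Measurable fun x : ℝ => F (Ioi x) :=
  Antitone.measurable fun _ _ h => measure_mono (Ioi_subset_Ioi h)

@[fun_prop]
theorem measurable_tailFn (F : Measure ℝ) : Measurable (tailFn F) :=
  Measurable.ite measurableSet_Ici (measurable_measure_Ioi F) measurable_const

theorem tailFn_le_one (F : Measure ℝ) [IsProbabilityMeasure F] (x : ℝ) : tailFn F x ≤ 1 := by
  unfold tailFn
  split_ifs
  · exact prob_le_one
  · simp

/-- Condition on the `k`-th epoch `s ≤ t`: the next step either overshoots `t` or stays below it.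
Steps are positive, so an epoch beyond `t` contributes to neither term. This is the telescoping step
behind `lintegral_tailFn_renewalMeasure`. -/
theorem lintegral_tailFn_convPow (F : Measure ℝ) [IsProbabilityMeasure F] (hF : F (Iic 0) = 0)
    (t : ℝ) (k : ℕ) :
    ∫⁻ s, tailFn F (t - s) ∂(convPow F k) + convPow F (k + 1) (Iic t) = convPow F k (Iic t) := by
  have h1 : convPow F (k + 1) (Iic t) = ∫⁻ s, F (Iic (t - s)) ∂(convPow F k) := by
    rw [convPow, Measure.conv_comm, ← lintegral_indicator_one measurableSet_Iic,
      Measure.lintegral_conv (measurable_one.indicator measurableSet_Iic)]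
    refine lintegral_congr fun s => ?_
    rw [← lintegral_indicator_one measurableSet_Iic]
    refine lintegral_congr fun y => ?_
    simp only [indicator, mem_Iic, Pi.one_apply]
    congr 1
    exact propext ⟨fun h => by linarith, fun h => by linarith⟩
  rw [h1, ← lintegral_add_left (by fun_prop), ← lintegral_indicator_one measurableSet_Iic]
  refine lintegral_congr fun s => ?_
  simp only [tailFn, indicator, mem_Iic, Pi.one_apply, sub_nonneg]
  split_ifs with h
  · have := prob_add_prob_compl (μ := F) (measurableSet_Iic (a := t - s))
    rw [compl_Iic] at this
    rw [add_comm, this]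
  · rw [zero_add]
    exact measure_mono_null (Iic_subset_Iic.2 (by linarith)) hF

theorem lintegral_exp_convPow (F : Measure ℝ) [IsProbabilityMeasure F] (n : ℕ) :
    ∫⁻ x, ENNReal.ofReal (Real.exp (-x)) ∂(convPow F n)
      = (∫⁻ x, ENNReal.ofReal (Real.exp (-x)) ∂F) ^ n := by
  induction n with
  | zero => simp [convPow]
  | succ n ih =>
    rw [convPow, Measure.lintegral_conv (by fun_prop), pow_succ', ← ih,
      ← lintegral_mul_const _ (by fun_prop)]
    refine lintegral_congr fun x => ?_
    rw [← lintegral_const_mul _ (by fun_prop)]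
    refine lintegral_congr fun y => ?_
    rw [← ENNReal.ofReal_mul (Real.exp_pos _).le, ← Real.exp_add, neg_add]

/-- An exponential Markov inequality: the Laplace transform at `1` is some `r < 1` because `F` lives
on `(0, ∞)`, and it is multiplicative under convolution. -/
theorem tendsto_convPow_Iic (F : Measure ℝ) [IsProbabilityMeasure F] (hF : F (Iic 0) = 0)
    (t : ℝ) : Tendsto (fun n => convPow F n (Iic t)) atTop (𝓝 0) := by
  set r := ∫⁻ x, ENNReal.ofReal (Real.exp (-x)) ∂F with hr
  have hpos : ∀ᵐ x ∂F, 0 < x := by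
    rw [ae_iff]; simpa [Iic_def] using hF
  have hr1 : r < 1 := by
    have h1 : (1 : ℝ≥0∞) = ∫⁻ _, 1 ∂F := by simp
    rw [h1]
    refine lintegral_strict_mono (IsProbabilityMeasure.ne_zero F) (by fun_prop) ?_ ?_
    · refine ne_top_of_le_ne_top (b := 1) (by simp) ?_
      rw [h1]
      refine lintegral_mono_ae ?_
      filter_upwards [hpos] with x hx
      exact ENNReal.ofReal_le_one.2 (Real.exp_le_one_iff.2 (by linarith))
    · filter_upwards [hpos] with x hx
      exact ENNReal.ofReal_lt_one.2 (Real.exp_lt_one_iff.2 (by linarith))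
  have hb : ∀ n, convPow F n (Iic t) ≤ ENNReal.ofReal (Real.exp t) * r ^ n := fun n => by
    rw [hr, ← lintegral_exp_convPow, ← lintegral_const_mul _ (by fun_prop),
      ← lintegral_indicator_one measurableSet_Iic]
    refine lintegral_mono fun x => ?_
    simp only [indicator, mem_Iic, Pi.one_apply]
    split_ifs with h
    · rw [← ENNReal.ofReal_mul (Real.exp_pos _).le, ← Real.exp_add]
      exact ENNReal.one_le_ofReal.2 (Real.one_le_exp (by linarith))
    · exact zero_le
  refine tendsto_of_tendsto_of_tendsto_of_le_of_le tendsto_const_nhds ?_ (fun _ => zero_le) hb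
  have := ENNReal.Tendsto.const_mul (a := ENNReal.ofReal (Real.exp t))
    (ENNReal.tendsto_pow_atTop_nhds_zero_of_lt_one hr1) (Or.inr ENNReal.ofReal_ne_top)
  simpa using this

/-- The renewal measure. -/
def renewalMeasure (F : Measure ℝ) : Measure ℝ := Measure.sum (convPow F)

instance renewalMeasure_sFinite (F : Measure ℝ) [IsFiniteMeasure F] :
    SFinite (renewalMeasure F) := by
  unfold renewalMeasure; infer_instance

/-- Exactly one renewal interval covers a given `t ≥ 0`. Analytically, the partial sums telescope
and the remainder `convPow F n (Iic t)` vanishes. -/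
theorem lintegral_tailFn_renewalMeasure (F : Measure ℝ) [IsProbabilityMeasure F]
    (hF : F (Iic 0) = 0) (t : ℝ) :
    ∫⁻ s, tailFn F (t - s) ∂(renewalMeasure F) = if 0 ≤ t then 1 else 0 := by
  have h1 : ∀ n, ∑ k ∈ Finset.range n, ∫⁻ s, tailFn F (t - s) ∂(convPow F k)
      + convPow F n (Iic t) = if 0 ≤ t then 1 else 0 := by
    intro n
    induction n with
    | zero => simp [convPow, indicator]
    | succ n ih => rw [Finset.sum_range_succ, add_assoc, lintegral_tailFn_convPow F hF, ih]
  rw [renewalMeasure, lintegral_sum_measure]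
  have h2 := (ENNReal.summable (f := fun k =>
    ∫⁻ s, tailFn F (t - s) ∂(convPow F k))).hasSum.tendsto_sum_nat
  have h3 := h2.add (tendsto_convPow_Iic F hF t)
  simp only [h1, add_zero] at h3
  exact tendsto_nhds_unique h3 tendsto_const_nhds

/-- Restarting at the `n`-th epoch exposes one convolution power, to which the approximate
translation invariance of `convPow F n` can be applied. -/
theorem renewalMeasure_eq (F : Measure ℝ) [IsFiniteMeasure F] (n : ℕ) :
    renewalMeasure F
      = ∑ k ∈ Finset.range n, convPow F k + convPow F n ∗ renewalMeasure F := by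
  refine Measure.ext_of_lintegral _ fun f hf => ?_
  have h1 : ∀ k, ∫⁻ x, f x ∂(convPow F (k + n))
      = ∫⁻ x, ∫⁻ y, f (x + y) ∂(convPow F k) ∂(convPow F n) := fun k => by
    rw [add_comm, convPow_add, Measure.lintegral_conv hf]
  have h2 : ∫⁻ x, f x ∂(convPow F n ∗ renewalMeasure F)
      = ∑' k, ∫⁻ x, f x ∂(convPow F (k + n)) := by
    rw [Measure.lintegral_conv hf]
    simp only [h1]
    rw [← lintegral_tsum fun k => Measurable.aemeasurable
      (Measurable.lintegral_prod_right' (f := fun p : ℝ × ℝ => f (p.1 + p.2)) (by fun_prop))]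
    simp only [renewalMeasure, lintegral_sum_measure]
  have h3 := Summable.sum_add_tsum_nat_add' (f := fun k => ∫⁻ x, f x ∂(convPow F k)) (k := n)
    ENNReal.summable
  have h4 : ∫⁻ x, f x ∂(renewalMeasure F) = ∑' k, ∫⁻ x, f x ∂(convPow F k) :=
    lintegral_sum_measure _ _
  rw [h4, ← h3, lintegral_add_measure, h2, lintegral_finsetSum_measure]

end Renewal

/-! ### Approximate translation invariance of convolution powers. -/

section Translation

/-- A set of positive Lebesgue measure meets its small translates in a set of positive measure. -/
theorem exists_forall_volume_inter_translate_ne_zero {E : Set ℝ} (hE : MeasurableSet E)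
    (h0 : volume E ≠ 0) :
    ∃ δ > 0, ∀ h : ℝ, |h| < δ → volume (E ∩ (fun y => y + h) ⁻¹' E) ≠ 0 := by
  obtain ⟨K, hKE, hK, hKpos⟩ := hE.exists_lt_isCompact (pos_iff_ne_zero.2 h0)
  have hKfin : volume K ≠ ∞ := hK.measure_lt_top.ne
  have h2 : volume K < 2 * volume K := by
    rw [two_mul]; exact ENNReal.lt_add_right hKfin hKpos.ne'
  -- `K` and a small translate both lie in `V`, whose measure is less than `2 * volume K`; they
  -- cannot be disjoint up to null sets.
  obtain ⟨V, hKV, hVo, hV⟩ := K.exists_isOpen_lt_of_lt _ h2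
  obtain ⟨δ, hδ, hthick⟩ := hK.exists_thickening_subset_open hVo hKV
  refine ⟨δ, hδ, fun h hh hz => ?_⟩
  have hz' : volume (K ∩ (fun y => y + h) ⁻¹' K) = 0 :=
    measure_mono_null (inter_subset_inter hKE (preimage_mono hKE)) hz
  have hsub : (fun y => y + h) ⁻¹' K ⊆ V := fun y hy => hthick <| by
    rw [Metric.mem_thickening_iff]
    exact ⟨y + h, hy, by simpa [Real.dist_eq] using hh⟩
  have hm : MeasurableSet ((fun y => y + h) ⁻¹' K) := hK.measurableSet.preimage (by fun_prop)
  have h3 := measure_union_add_inter (μ := volume) K hm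
  rw [hz', add_zero, measure_preimage_add_right, ← two_mul] at h3
  exact absurd (h3 ▸ measure_mono (union_subset hKV hsub)) (not_le.2 hV)

/-- The density of `F` overlaps its small translates, since a set of positive measure does; the
common part can be placed both at its own position and at the translated one. This gives `F` a
component that performs a fair choice between `0` and `h`. -/
theorem exists_add_map_translate_le (F : Measure ℝ) [IsProbabilityMeasure F] (hac : F ≪ volume) :
    ∃ δ > 0, ∀ h : ℝ, |h| < δ →
      ∃ θ : Measure ℝ, IsFiniteMeasure θ ∧ θ ≠ 0 ∧ θ + θ.map (fun y => y + h) ≤ F := by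
  set u := F.rnDeriv volume with hu
  have hum : Measurable u := Measure.measurable_rnDeriv _ _
  have hFu : volume.withDensity u = F := Measure.withDensity_rnDeriv_eq _ _ hac
  have hE : MeasurableSet {y | u y ≠ 0} := measurableSet_eq_fun hum measurable_const |>.compl
  have hE0 : volume {y | u y ≠ 0} ≠ 0 := fun h0 => by
    have : u =ᵐ[volume] 0 := by rw [Filter.EventuallyEq, ae_iff]; simpa using h0
    exact IsProbabilityMeasure.ne_zero F (by rw [← hFu, withDensity_congr_ae this]; simp)
  obtain ⟨δ, hδ, H⟩ := exists_forall_volume_inter_translate_ne_zero hE hE0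
  refine ⟨δ, hδ, fun h hh => ?_⟩
  -- Half of the overlap, so that `w` and its translate each use at most half of the density.
  set w : ℝ → ℝ≥0∞ := fun y => min (u y) (u (y + h)) / 2 with hw
  have hwm : Measurable w := by fun_prop
  have hsum : ∀ s, MeasurableSet s → ∫⁻ y in s, u y / 2 = F s / 2 := fun s hs => by
    simp only [div_eq_mul_inv]
    rw [lintegral_mul_const _ hum, ← withDensity_apply _ hs, hFu]
  have hle : volume.withDensity w + (volume.withDensity w).map (fun y => y + h) ≤ F := by
    refine Measure.le_iff.2 fun s hs => ?_
    rw [Measure.add_apply, Measure.map_apply (by fun_prop) hs, withDensity_apply _ hs,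
      withDensity_apply _ (hs.preimage (by fun_prop)), ← ENNReal.add_halves (F s), ← hsum s hs]
    refine add_le_add (lintegral_mono fun y => ENNReal.div_le_div_right (min_le_left _ _) _) ?_
    rw [← lintegral_indicator (hs.preimage (by fun_prop)), ← lintegral_indicator hs,
      ← lintegral_add_right_eq_self (fun y => s.indicator (fun y => u y / 2) y) h]
    refine lintegral_mono fun y => ?_
    by_cases hy : y + h ∈ s
    · rw [indicator_of_mem (by exact hy), indicator_of_mem hy]
      exact ENNReal.div_le_div_right (min_le_right _ _) _
    · rw [indicator_of_notMem (by exact hy), indicator_of_notMem hy]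
  refine ⟨volume.withDensity w, ?_, fun h0 => ?_, hle⟩
  · exact isFiniteMeasure_of_le F (le_trans (Measure.le_add_right (le_refl _)) hle)
  · rw [withDensity_eq_zero_iff hwm.aemeasurable] at h0
    refine H h hh (measure_mono_null ?_ (ae_iff.1 h0))
    rintro y ⟨h1, h2⟩
    simp only [mem_preimage, mem_ofPred_eq] at h1 h2 ⊢
    simp [hw, ENNReal.div_eq_zero_iff, h1, h2]

/-- Expand the `n`-th convolution power of `θ` plus its translate: the translate by `i * h` appears
with a binomial coefficient, and each coefficient is at least `1`. -/
theorem sum_lintegral_translate_le_lintegral_convPow (F θ : Measure ℝ) [IsFiniteMeasure F]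
    [IsFiniteMeasure θ] (h : ℝ) (hle : θ + θ.map (fun y => y + h) ≤ F) (n : ℕ) (f : ℝ → ℝ≥0∞)
    (hf : Measurable f) :
    ∑ i ∈ Finset.range (n + 1), ∫⁻ y, f (y + i * h) ∂(convPow θ n)
      ≤ ∫⁻ y, f y ∂(convPow F n) := by
  induction n generalizing f with
  | zero => simp [convPow]
  | succ n ih =>
    set a : ℕ → ℝ → ℝ≥0∞ := fun i x => ∫⁻ y, f (x + y + i * h) ∂(convPow θ n) with ha
    have ham : ∀ i, Measurable (a i) := fun i =>
      Measurable.lintegral_prod_right' (f := fun p : ℝ × ℝ => f (p.1 + p.2 + i * h)) (by fun_prop)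
    have hshift : ∀ i x, a i (x + h) = a (i + 1) x := fun i x => by
      simp only [ha]
      refine lintegral_congr fun y => ?_
      congr 1; push_cast; ring
    rw [convPow, convPow, Measure.lintegral_conv hf]
    calc ∑ i ∈ Finset.range (n + 1 + 1), ∫⁻ y, f (y + i * h) ∂(θ ∗ convPow θ n)
        = ∑ i ∈ Finset.range (n + 1 + 1), ∫⁻ x, a i x ∂θ := by
          refine Finset.sum_congr rfl fun i _ => ?_
          rw [Measure.lintegral_conv (by fun_prop)]
      _ = ∫⁻ x, ∑ i ∈ Finset.range (n + 1 + 1), a i x ∂θ :=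
          (lintegral_finsetSum _ fun i _ => ham i).symm
      -- Pascal's rule, reduced to what is needed: every index up to `n + 1` occurs in the unshifted
      -- sum or in the shifted one.
      _ ≤ ∫⁻ x, (∑ i ∈ Finset.range (n + 1), a i x)
            + ∑ i ∈ Finset.range (n + 1), a i (x + h) ∂θ := by
          refine lintegral_mono fun x => ?_
          simp only [hshift]
          rw [Finset.sum_range_succ]
          gcongr
          exact Finset.single_le_sum (f := fun i => a (i + 1) x) (fun _ _ => zero_le)
            (Finset.mem_range.2 (Nat.lt_succ_self n))
      _ = ∫⁻ x, ∑ i ∈ Finset.range (n + 1), a i x ∂(θ + θ.map (fun y => y + h)) := by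
          rw [lintegral_add_measure, lintegral_map (by fun_prop) (by fun_prop),
            lintegral_add_left (by fun_prop)]
      _ ≤ ∫⁻ x, ∑ i ∈ Finset.range (n + 1), a i x ∂F := lintegral_mono' hle le_rfl
      _ ≤ ∫⁻ x, ∫⁻ y, f (x + y) ∂convPow F n ∂F :=
          lintegral_mono fun x => ih (fun y => f (x + y)) (by fun_prop)|>.trans' (by
            simp only [ha, add_assoc]; exact le_rfl)

theorem convPow_univ (F : Measure ℝ) [IsFiniteMeasure F] (n : ℕ) :
    convPow F n univ = F univ ^ n := by
  induction n with
  | zero => simp [convPow]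
  | succ n ih =>
    rw [convPow, Measure.conv, Measure.map_apply (by fun_prop) MeasurableSet.univ, preimage_univ,
      ← univ_prod_univ, Measure.prod_prod, ih, pow_succ']

theorem integral_conv_of_bounded {μ ν : Measure ℝ} [IsFiniteMeasure μ] [IsFiniteMeasure ν]
    {f : ℝ → ℝ} (hf : Measurable f) {C : ℝ} (hC : ∀ x, |f x| ≤ C) :
    ∫ x, f x ∂(μ ∗ ν) = ∫ x, ∫ y, f (x + y) ∂ν ∂μ := by
  rw [Measure.conv, integral_map (by fun_prop) hf.aestronglyMeasurable, integral_prod]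
  exact Integrable.of_bound (hf.comp measurable_add).aestronglyMeasurable C (Eventually.of_forall fun x => hC _)

theorem abs_integral_le_of_bounded {μ : Measure ℝ} [IsFiniteMeasure μ] {f : ℝ → ℝ} {C : ℝ}
    (hC : ∀ x, |f x| ≤ C) : |∫ x, f x ∂μ| ≤ C * μ.real univ :=
  norm_integral_le_of_norm_le_const (f := f) (Eventually.of_forall hC)


theorem real_univ_sum_map_translate (α : Measure ℝ) [IsFiniteMeasure α] (h : ℝ) (n : ℕ) :
    (∑ i ∈ Finset.range (n + 1), α.map (fun y => y + i * h)).real univ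
      = (n + 1) * α.real univ := by
  have h1 : ∀ i : ℕ, α.map (fun y => y + i * h) univ = α univ := fun i => by
    rw [Measure.map_apply (by fun_prop) MeasurableSet.univ, preimage_univ]
  rw [Measure.real, Measure.finsetSum_apply, Finset.sum_congr rfl fun i _ => h1 i]
  simp [Measure.real, ENNReal.toReal_add]

/-- A measure which dominates `∑_{i ≤ n} α(· - i h)` has convolution powers which are almost
invariant under translation by `h`, when tested against bounded functions. -/
theorem abs_integral_convPow_sub_translate_le (G α : Measure ℝ) [IsProbabilityMeasure G]
    [IsFiniteMeasure α] (h : ℝ) (n : ℕ)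
    (hle : ∑ i ∈ Finset.range (n + 1), α.map (fun y => y + i * h) ≤ G) (N : ℕ)
    (Z : ℝ → ℝ) (hZ : Measurable Z) (hZ1 : ∀ t, |Z t| ≤ 1) (t : ℝ) :
    |∫ y, (Z (t - y) - Z (t - y - h)) ∂(convPow G N)|
      ≤ 2 / (n + 1) + 2 * (1 - (n + 1) * α.real univ) ^ N := by
  set M := ∑ i ∈ Finset.range (n + 1), α.map (fun y => y + i * h) with hM
  have : IsFiniteMeasure M := isFiniteMeasure_of_le G hle
  have hMG : (G - M) + M = G := Measure.sub_add_cancel_of_le hle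
  set r := 1 - (n + 1) * α.real univ with hr
  have hMu : M.real univ = (n + 1) * α.real univ := real_univ_sum_map_translate α h n
  have : IsFiniteMeasure (G - M) := isFiniteMeasure_of_le G Measure.sub_le
  have hRu : (G - M).real univ = r := by
    have : ((G - M) + M).real univ = 1 := by rw [hMG]; simp
    rw [measureReal_add_apply, hMu] at this
    rw [hr]; linarith
  have hn : (0 : ℝ) < n + 1 := by positivity
  have hr0 : 0 ≤ r := by rw [← hRu]; exact measureReal_nonneg
  set W : ℝ → ℝ := fun t => Z t - Z (t - h) with hW
  have hWm : Measurable W := by fun_prop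
  have hW2 : ∀ t, |W t| ≤ 2 := fun t => (abs_sub _ _).trans (by linarith [hZ1 t, hZ1 (t - h)])
  suffices H : ∀ N t, |∫ y, W (t - y) ∂(convPow G N)| ≤ 2 / (n + 1) + 2 * r ^ N from H N t
  -- On `M` the differences telescope over the `n + 1` translates and leave two terms only, whatever
  -- `n` is.
  have hMW : ∀ t, |∫ y, W (t - y) ∂M| ≤ 2 * α.real univ := by
    intro t
    have h1 : ∫ y, W (t - y) ∂M = ∫ y, (Z (t - y) - Z (t - y - (n + 1 : ℕ) * h)) ∂α := by
      have hWt : Measurable fun y => W (t - y) := by fun_prop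
      rw [hM, integral_finsetSum_measure fun i _ => Integrable.of_bound (C := 2)
        hWt.aestronglyMeasurable (Eventually.of_forall fun x => hW2 _)]
      have hmap : ∀ i : ℕ, ∫ y, W (t - y) ∂(α.map fun y => y + i * h)
          = ∫ y, W (t - (y + i * h)) ∂α := fun i =>
        integral_map (by fun_prop) hWt.aestronglyMeasurable
      simp_rw [hmap]
      have hWi : ∀ i : ℕ, Measurable fun y => W (t - (y + i * h)) := fun i => by fun_prop
      rw [← integral_finsetSum _ fun i _ => Integrable.of_bound (C := 2)
        (hWi i).aestronglyMeasurable (Eventually.of_forall fun x => hW2 _)]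
      refine integral_congr_ae (Eventually.of_forall fun y => ?_)
      have h2 := Finset.sum_range_sub' (fun i : ℕ => Z (t - y - i * h)) (n + 1)
      simp only [Nat.cast_zero, zero_mul, sub_zero] at h2
      simp only [hW]
      rw [← h2]
      refine Finset.sum_congr rfl fun i _ => ?_
      congr 2 <;> push_cast <;> ring
    rw [h1]
    exact abs_integral_le_of_bounded fun y => (abs_sub _ _).trans
      (by linarith [hZ1 (t - y), hZ1 (t - y - (n + 1 : ℕ) * h)])
  intro N
  induction N with
  | zero =>
    intro t
    have h1 : (0 : ℝ) ≤ 2 / (n + 1) := by positivity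
    simp only [convPow, integral_dirac, pow_zero, sub_zero]
    linarith [hW2 t]
  | succ N ih =>
    intro t
    have hWt : Measurable fun y => W (t - y) := by fun_prop
    have hsplit : ∫ y, W (t - y) ∂(convPow G (N + 1))
        = ∫ x, ∫ y, W (t - x - y) ∂(convPow G N) ∂(G - M)
          + ∫ x, ∫ y, W (t - x - y) ∂M ∂(convPow G N) := by
      have hi : ∀ (μ ν : Measure ℝ) [IsFiniteMeasure μ] [IsFiniteMeasure ν],
          ∫ y, W (t - y) ∂(μ ∗ ν) = ∫ x, ∫ y, W (t - x - y) ∂ν ∂μ := fun μ ν _ _ => by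
        rw [integral_conv_of_bounded hWt (C := 2) fun x => hW2 _]
        simp only [sub_sub]
      have hint : ∀ (μ : Measure ℝ) [IsFiniteMeasure μ], Integrable (fun y => W (t - y)) μ :=
        fun μ _ => Integrable.of_bound hWt.aestronglyMeasurable 2
          (Eventually.of_forall fun x => hW2 _)
      rw [← hi, ← hi, Measure.conv_comm (convPow G N) M, ← integral_add_measure (hint _) (hint _),
        ← Measure.add_conv, hMG, convPow]
    have h1 : |∫ x, ∫ y, W (t - x - y) ∂(convPow G N) ∂(G - M)|
        ≤ (2 / (n + 1) + 2 * r ^ N) * r := by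
      have := abs_integral_le_of_bounded (μ := G - M) fun x => ih (t - x)
      rwa [hRu] at this
    have h2 : |∫ x, ∫ y, W (t - x - y) ∂M ∂(convPow G N)| ≤ 2 * α.real univ * 1 := by
      have := abs_integral_le_of_bounded (μ := convPow G N) fun x => hMW (t - x)
      simpa using this
    -- With this identity the bound is stable under the recursion: `2 / (n + 1)` is the fixed point
    -- of `x ↦ r * x + 2 * α.real univ`.
    have h3 : 2 * α.real univ = 2 / (n + 1) * (1 - r) := by rw [hr]; field_simp; ring
    rw [hsplit]
    refine (abs_add_le _ _).trans ((add_le_add h1 h2).trans (le_of_eq ?_))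
    rw [h3, pow_succ]; ring

theorem convPow_mul (F : Measure ℝ) [IsFiniteMeasure F] (n N : ℕ) :
    convPow F (n * N) = convPow (convPow F n) N := by
  induction N with
  | zero => simp [convPow]
  | succ N ih => rw [Nat.mul_succ, add_comm, convPow_add, ih, convPow]

/-- The convolution powers of an absolutely continuous law are asymptotically invariant under
small translations, uniformly over bounded test functions. -/
theorem exists_forall_convPow_translate_le (F : Measure ℝ) [IsProbabilityMeasure F]
    (hac : F ≪ volume) :
    ∃ δ > 0, ∀ h : ℝ, |h| < δ → ∀ ε > 0, ∃ N, ∀ Z : ℝ → ℝ, Measurable Z → (∀ t, |Z t| ≤ 1) →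
      ∀ t, |∫ y, (Z (t - y) - Z (t - y - h)) ∂(convPow F N)| ≤ ε := by
  obtain ⟨δ, hδ, H⟩ := exists_add_map_translate_le F hac
  refine ⟨δ, hδ, fun h hh ε hε => ?_⟩
  obtain ⟨θ, hθ, hθ0, hle⟩ := H h hh
  -- This `n` makes the telescoping error `2 / (n + 1)` at most `ε / 2`; afterwards `N` is chosen so
  -- that `2 * r ^ N` is also below `ε / 2`.
  obtain ⟨n, hn⟩ := exists_nat_gt (4 / ε)
  have hn0 : (0 : ℝ) < n + 1 := by positivity
  set α := convPow θ n with hα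
  have hα0 : 0 < α.real univ := by
    rw [Measure.real, hα, convPow_univ]
    refine ENNReal.toReal_pos (pow_ne_zero _ (by simpa using hθ0)) ?_
    exact ENNReal.pow_ne_top (measure_ne_top _ _)
  have hle' : ∑ i ∈ Finset.range (n + 1), α.map (fun y => y + i * h) ≤ convPow F n := by
    refine Measure.le_iff.2 fun s hs => ?_
    have := sum_lintegral_translate_le_lintegral_convPow F θ h hle n (s.indicator 1)
      (measurable_one.indicator hs)
    rw [lintegral_indicator_one hs] at this
    refine le_trans (le_of_eq ?_) this
    rw [Measure.finsetSum_apply]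
    refine Finset.sum_congr rfl fun i _ => ?_
    rw [← lintegral_indicator_one hs, lintegral_map (measurable_one.indicator hs) (by fun_prop)]
  have hα1 : (n + 1) * α.real univ ≤ 1 := by
    have h1 := ENNReal.toReal_mono (measure_ne_top (convPow F n) _) (hle' univ)
    rw [measure_univ (μ := convPow F n), ENNReal.toReal_one] at h1
    exact (real_univ_sum_map_translate α h n).symm.le.trans h1
  set r := 1 - (n + 1) * α.real univ with hr
  have hr1 : r < 1 := by rw [hr]; nlinarith
  have hr0 : 0 ≤ r := by rw [hr]; linarith
  obtain ⟨N, hN⟩ := exists_pow_lt_of_lt_one (show 0 < ε / 4 by positivity) hr1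
  refine ⟨n * N, fun Z hZ hZ1 t => ?_⟩
  rw [convPow_mul]
  refine (abs_integral_convPow_sub_translate_le (convPow F n) α h n hle' N Z hZ hZ1 t).trans ?_
  have : 2 / ((n : ℝ) + 1) ≤ ε / 2 := by
    rw [div_le_iff₀ hn0]
    rw [div_lt_iff₀ hε] at hn
    nlinarith
  linarith

end Translation

/-! ### The key renewal theorem. -/

section RenewalTheorem

variable {F : Measure ℝ} [IsProbabilityMeasure F] {g : ℝ → ℝ≥0∞}

/-- The solution of the renewal equation with inhomogeneity `g`. -/
def renewalFn (F : Measure ℝ) (g : ℝ → ℝ≥0∞) (t : ℝ) : ℝ≥0∞ :=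
  ∫⁻ s, g (t - s) ∂(renewalMeasure F)

theorem renewalFn_le_one (hF : F (Iic 0) = 0) (hle : ∀ x, g x ≤ tailFn F x) (t : ℝ) :
    renewalFn F g t ≤ 1 := by
  refine (lintegral_mono fun s => hle (t - s)).trans ?_
  rw [lintegral_tailFn_renewalMeasure F hF]
  split_ifs <;> simp

theorem measurable_renewalFn (hg : Measurable g) : Measurable (renewalFn F g) :=
  Measurable.lintegral_prod_right' (f := fun p : ℝ × ℝ => g (p.1 - p.2)) (by fun_prop)

theorem renewalFn_eq (hg : Measurable g) (n : ℕ) (t : ℝ) :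
    renewalFn F g t = ∑ k ∈ Finset.range n, ∫⁻ s, g (t - s) ∂(convPow F k)
      + ∫⁻ y, renewalFn F g (t - y) ∂(convPow F n) := by
  conv_lhs => rw [renewalFn, renewalMeasure_eq F n]
  rw [lintegral_add_measure, lintegral_finsetSum_measure, Measure.lintegral_conv (by fun_prop)]
  simp only [renewalFn, sub_sub]

theorem tendsto_tailFn_atTop (F : Measure ℝ) [IsProbabilityMeasure F] :
    Tendsto (tailFn F) atTop (𝓝 0) := by
  have h : Tendsto (fun x : ℝ => F (Ioi x)) atTop (𝓝 0) := by
    have h0 : (⋂ x : ℝ, Ioi x) = ∅ := by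
      ext y; simp only [mem_iInter, mem_Ioi, mem_empty_iff_false, iff_false, not_forall, not_lt]
      exact ⟨y, le_rfl⟩
    have := tendsto_measure_iInter_atTop (μ := F) (s := fun x : ℝ => Ioi x)
      (fun _ => measurableSet_Ioi.nullMeasurableSet) (fun _ _ h => Ioi_subset_Ioi h)
      ⟨0, measure_ne_top _ _⟩
    rwa [h0, measure_empty] at this
  refine h.congr' ?_
  filter_upwards [eventually_ge_atTop 0] with x hx
  simp [tailFn, hx]

theorem tendsto_lintegral_sub_atTop (hg : Measurable g) (hle : ∀ x, g x ≤ tailFn F x)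
    (μ : Measure ℝ) [IsFiniteMeasure μ] :
    Tendsto (fun t => ∫⁻ s, g (t - s) ∂μ) atTop (𝓝 0) := by
  have h := tendsto_lintegral_filter_of_dominated_convergence (μ := μ) (l := atTop)
    (F := fun (t : ℝ) s => g (t - s)) (f := fun _ => 0) (fun _ => 1)
    (Eventually.of_forall fun t => by fun_prop)
    (Eventually.of_forall fun t => Eventually.of_forall fun s =>
      (hle _).trans (tailFn_le_one F _)) (by simp)
    (Eventually.of_forall fun s => ?_)
  · simpa using h
  · have h1 : Tendsto (fun t : ℝ => t - s) atTop atTop := tendsto_atTop_add_const_right _ _ tendsto_id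
    exact tendsto_of_tendsto_of_tendsto_of_le_of_le tendsto_const_nhds
      ((tendsto_tailFn_atTop F).comp h1) (fun _ => zero_le) (fun _ => hle _)

/-- Restart at the `N`-th epoch. The first `N` terms vanish as `t → ∞`, and the rest is an average
of the bounded function `renewalFn F g` against `convPow F N`, which is almost invariant under small
translations. An arbitrary `h` is reached in finitely many small steps. -/
theorem tendsto_renewalFn_sub_translate (hF : F (Iic 0) = 0) (hac : F ≪ volume)
    (hg : Measurable g) (hle : ∀ x, g x ≤ tailFn F x) (h : ℝ) :
    Tendsto (fun t => (renewalFn F g t).toReal - (renewalFn F g (t - h)).toReal) atTop (𝓝 0) := by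
  set Z : ℝ → ℝ := fun t => (renewalFn F g t).toReal with hZ
  have hfin : ∀ t, renewalFn F g t ≠ ∞ := fun t =>
    ne_top_of_le_ne_top ENNReal.one_ne_top (renewalFn_le_one hF hle t)
  have hZm : Measurable Z := (measurable_renewalFn hg).ennreal_toReal
  have hZ0 : ∀ t, 0 ≤ Z t := fun t => ENNReal.toReal_nonneg
  have hZ1 : ∀ t, |Z t| ≤ 1 := fun t => by
    rw [abs_of_nonneg (hZ0 t)]
    exact ENNReal.toReal_mono ENNReal.one_ne_top (renewalFn_le_one hF hle t)
  obtain ⟨δ, hδ, H⟩ := exists_forall_convPow_translate_le F hac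
  have hsmall : ∀ h, |h| < δ → Tendsto (fun t => Z t - Z (t - h)) atTop (𝓝 0) := by
    intro h hh
    rw [Metric.tendsto_nhds]
    intro ε hε
    obtain ⟨N, hN⟩ := H h hh (ε / 2) (by positivity)
    set A : ℝ → ℝ≥0∞ := fun t => ∑ k ∈ Finset.range N, ∫⁻ s, g (t - s) ∂(convPow F k) with hA
    have hAlim : Tendsto A atTop (𝓝 0) := by
      have := tendsto_finsetSum (Finset.range N) fun k _ =>
        tendsto_lintegral_sub_atTop hg hle (convPow F k)
      simpa using this
    have hAr : Tendsto (fun t => (A t).toReal) atTop (𝓝 0) := by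
      simpa [Function.comp_def] using (ENNReal.tendsto_toReal ENNReal.zero_ne_top).comp hAlim
    have hAh : Tendsto (fun t => (A t).toReal - (A (t - h)).toReal) atTop (𝓝 0) := by
      have h1 : Tendsto (fun t : ℝ => t - h) atTop atTop :=
        tendsto_atTop_add_const_right _ _ tendsto_id
      simpa using hAr.sub (hAr.comp h1)
    have hdec : ∀ t, Z t = (A t).toReal + ∫ y, Z (t - y) ∂(convPow F N) := fun t => by
      have h1 := renewalFn_eq (F := F) hg N t
      have hf := hfin t
      rw [h1] at hf
      have h2 := ENNReal.add_ne_top.1 hf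
      have h5 : ∫ y, Z (t - y) ∂(convPow F N)
          = (∫⁻ y, renewalFn F g (t - y) ∂(convPow F N)).toReal := by
        refine integral_toReal ?_ (Eventually.of_forall fun y => (hfin _).lt_top)
        exact ((measurable_renewalFn hg).comp (by fun_prop)).aemeasurable
      rw [h5, ← ENNReal.toReal_add h2.1 h2.2, ← h1]
    have hint : ∀ t, Integrable (fun y => Z (t - y)) (convPow F N) := fun t =>
      Integrable.of_bound (hZm.comp (by fun_prop)).aestronglyMeasurable 1
        (Eventually.of_forall fun y => hZ1 _)
    filter_upwards [(Metric.tendsto_nhds.1 hAh) (ε / 2) (by positivity)] with t ht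
    rw [Real.dist_eq, sub_zero] at ht ⊢
    have h3 : Z t - Z (t - h) = ((A t).toReal - (A (t - h)).toReal)
        + ∫ y, (Z (t - y) - Z (t - y - h)) ∂(convPow F N) := by
      have h4 : ∀ y, Z (t - y - h) = Z (t - h - y) := fun y => by congr 1; ring
      simp only [h4]
      rw [integral_sub (hint t) (hint (t - h)), hdec t, hdec (t - h)]
      ring
    rw [h3]
    exact (abs_add_le _ _).trans_lt (by linarith [hN Z hZm hZ1 t])
  obtain ⟨n, hn⟩ := exists_nat_gt (|h| / δ)
  have hn0 : (0 : ℝ) < n := lt_of_le_of_lt (by positivity) hn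
  have hstep : |h / n| < δ := by
    rw [abs_div, abs_of_pos hn0, div_lt_iff₀ hn0]
    rw [div_lt_iff₀ hδ] at hn
    linarith
  have hind : ∀ k : ℕ, Tendsto (fun t => Z t - Z (t - k * (h / n))) atTop (𝓝 0) := by
    intro k
    induction k with
    | zero => simp
    | succ k ih =>
      have h1 : Tendsto (fun t : ℝ => t - k * (h / n)) atTop atTop :=
        tendsto_atTop_add_const_right _ _ tendsto_id
      have h2 := ih.add ((hsmall _ hstep).comp h1)
      rw [add_zero] at h2
      refine h2.congr fun t => ?_
      simp only [Function.comp]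
      rw [sub_add_sub_cancel]
      congr 2; push_cast; ring
  have := hind n
  rwa [mul_div_cancel₀ _ hn0.ne'] at this

/-- Convolution is associative and commutative: `(U * g) * tail = g * (U * tail)`, and `U * tail` is
the indicator of the half line. -/
theorem lintegral_renewalFn_mul_tailFn (hF : F (Iic 0) = 0) (hg : Measurable g) (t : ℝ) :
    ∫⁻ s, renewalFn F g (t - s) * tailFn F s = ∫⁻ x in Iic t, g x := by
  have h1 : ∀ s, renewalFn F g (t - s) * tailFn F s
      = ∫⁻ v, g (t - s - v) * tailFn F s ∂(renewalMeasure F) := fun s =>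
    (lintegral_mul_const _ (by fun_prop)).symm
  simp only [h1]
  rw [lintegral_lintegral_swap (by fun_prop)]
  have h2 : ∀ v, ∫⁻ s, g (t - s - v) * tailFn F s = ∫⁻ x, g (t - x) * tailFn F (x - v) := fun v => by
    rw [← lintegral_sub_right_eq_self (fun s => g (t - s - v) * tailFn F s) v]
    refine lintegral_congr fun x => ?_
    congr 2; ring
  simp only [h2]
  rw [lintegral_lintegral_swap (by fun_prop)]
  have h3 : ∀ x, ∫⁻ v, g (t - x) * tailFn F (x - v) ∂(renewalMeasure F)
      = (Iic t).indicator g (t - x) := fun x => by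
    rw [lintegral_const_mul _ (by fun_prop), lintegral_tailFn_renewalMeasure F hF]
    simp only [indicator, mem_Iic, sub_le_self_iff]
    split_ifs <;> simp
  simp only [h3]
  rw [lintegral_sub_left_eq_self (fun x => (Iic t).indicator g x) t,
    lintegral_indicator measurableSet_Iic]

/-- If the tail had integral zero, so would its convolution with the renewal measure over `[0, 1]`,
but that convolution equals `1` there. -/
theorem lintegral_tailFn_ne_zero (hF : F (Iic 0) = 0) : ∫⁻ x, tailFn F x ≠ 0 := fun h0 => by
  have h1 := lintegral_tailFn_renewalMeasure F hF
  have h4 : ∫⁻ x in Icc (0 : ℝ) 1, ∫⁻ s, tailFn F (x - s) ∂(renewalMeasure F) = 0 := by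
    refine le_antisymm ((setLIntegral_le_lintegral _ _).trans ?_) zero_le
    rw [lintegral_lintegral_swap (by fun_prop)]
    simp [lintegral_sub_right_eq_self (fun x => tailFn F x), h0]
  rw [setLIntegral_congr_fun (g := fun _ => 1) measurableSet_Icc fun x hx => by
    simp only [h1, hx.1, if_true]] at h4
  simp at h4

/-- **Key renewal theorem** for absolutely continuous laws and inhomogeneities dominated by the
tail of the law. -/
theorem tendsto_renewalFn (hF : F (Iic 0) = 0) (hac : F ≪ volume)
    (hm : ∫⁻ x, tailFn F x ≠ ∞) (hg : Measurable g) (hle : ∀ x, g x ≤ tailFn F x) :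
    Tendsto (renewalFn F g) atTop (𝓝 ((∫⁻ x, g x) / ∫⁻ x, tailFn F x)) := by
  set Z : ℝ → ℝ := fun t => (renewalFn F g t).toReal with hZ
  have hfin : ∀ t, renewalFn F g t ≠ ∞ := fun t =>
    ne_top_of_le_ne_top ENNReal.one_ne_top (renewalFn_le_one hF hle t)
  have hZm : Measurable Z := (measurable_renewalFn hg).ennreal_toReal
  have hZ0 : ∀ t, 0 ≤ Z t := fun t => ENNReal.toReal_nonneg
  have hZ1 : ∀ t, Z t ≤ 1 := fun t =>
    ENNReal.toReal_mono ENNReal.one_ne_top (renewalFn_le_one hF hle t)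
  have hgfin : ∫⁻ x, g x ≠ ∞ := ne_top_of_le_ne_top hm (lintegral_mono hle)
  have hm0 := lintegral_tailFn_ne_zero hF
  set m := (∫⁻ x, tailFn F x).toReal with hmdef
  have hmpos : 0 < m := ENNReal.toReal_pos hm0 hm
  have htint : Integrable (fun s => (tailFn F s).toReal) :=
    integrable_toReal_of_lintegral_ne_top (by fun_prop) hm
  have htfin : ∀ s, tailFn F s ≠ ∞ := fun s =>
    ne_top_of_le_ne_top ENNReal.one_ne_top (tailFn_le_one F s)
  have hmint : ∫ s, (tailFn F s).toReal = m :=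
    integral_toReal (by fun_prop) (Eventually.of_forall fun s => (htfin s).lt_top)
  have hconv : ∀ t, ∫ s, Z (t - s) * (tailFn F s).toReal = (∫⁻ x in Iic t, g x).toReal := fun t => by
    rw [← lintegral_renewalFn_mul_tailFn hF hg, ← integral_toReal]
    · simp only [ENNReal.toReal_mul, hZ]
    · exact (((measurable_renewalFn hg).comp (by fun_prop)).mul (by fun_prop)).aemeasurable
    · exact Eventually.of_forall fun s => ENNReal.mul_lt_top (hfin _).lt_top (htfin s).lt_top
  have hgl : Tendsto (fun t : ℝ => (∫⁻ x in Iic t, g x).toReal) atTop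
      (𝓝 (∫⁻ x, g x).toReal) := by
    refine (ENNReal.tendsto_toReal hgfin).comp ?_
    simp only [← lintegral_indicator measurableSet_Iic]
    refine tendsto_lintegral_filter_of_dominated_convergence g
      (Eventually.of_forall fun t => hg.indicator measurableSet_Iic)
      (Eventually.of_forall fun t => Eventually.of_forall fun x => indicator_le_self _ _ _) hgfin
      (Eventually.of_forall fun x => ?_)
    refine tendsto_const_nhds.congr' ?_
    filter_upwards [eventually_ge_atTop x] with t ht
    rw [indicator_of_mem (mem_Iic.2 ht)]
  -- The difference tends to zero for each fixed `s` by asymptotic invariance, and the integrable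
  -- tail dominates.
  have hD : Tendsto (fun t => ∫ s, (Z t - Z (t - s)) * (tailFn F s).toReal) atTop (𝓝 0) := by
    have := tendsto_integral_filter_of_dominated_convergence (μ := volume) (l := atTop)
      (F := fun (t : ℝ) s => (Z t - Z (t - s)) * (tailFn F s).toReal) (f := fun _ => 0)
      (fun s => (tailFn F s).toReal)
      (Eventually.of_forall fun t => ((measurable_const.sub (hZm.comp (by fun_prop))).mul
        (measurable_tailFn F).ennreal_toReal).aestronglyMeasurable)
      (Eventually.of_forall fun t => Eventually.of_forall fun s => ?_) htint
      (Eventually.of_forall fun s => ?_)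
    · simpa using this
    · rw [norm_mul, Real.norm_eq_abs, Real.norm_of_nonneg ENNReal.toReal_nonneg]
      refine mul_le_of_le_one_left ENNReal.toReal_nonneg ?_
      rw [abs_le]
      constructor <;> linarith [hZ0 t, hZ1 t, hZ0 (t - s), hZ1 (t - s)]
    · simpa using (tendsto_renewalFn_sub_translate hF hac hg hle s).mul_const (tailFn F s).toReal
  -- Averaging `Z` against the normalised tail costs only the error term just shown to vanish, and
  -- the average itself is known exactly.
  have hfinal : ∀ t, Z t = ((∫ s, (Z t - Z (t - s)) * (tailFn F s).toReal)
      + (∫⁻ x in Iic t, g x).toReal) / m := fun t => by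
    have hi : Integrable fun s => Z (t - s) * (tailFn F s).toReal :=
      htint.bdd_mul (c := 1) (hZm.comp (by fun_prop)).aestronglyMeasurable
        (Eventually.of_forall fun s => by
          rw [Real.norm_of_nonneg (hZ0 _)]; exact hZ1 _)
    rw [← hconv, eq_div_iff hmpos.ne']
    simp only [sub_mul]
    rw [integral_sub (htint.const_mul _) hi, integral_const_mul, hmint]
    ring
  have hZlim : Tendsto Z atTop (𝓝 ((∫⁻ x, g x).toReal / m)) := by
    have := (hD.add hgl).div_const m
    rw [zero_add] at this
    exact this.congr fun t => (hfinal t).symm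
  have := ENNReal.tendsto_ofReal hZlim
  rw [hmdef, ← ENNReal.toReal_div, ENNReal.ofReal_toReal (ENNReal.div_ne_top hgfin hm0)] at this
  exact this.congr fun t => ENNReal.ofReal_toReal (hfin t)

end RenewalTheorem

/-! ### Random affine maps with a clock -/

/-- The affine map `v ↦ i + exp (-l) v` together with an elapsed time `s`. -/
def Aff : Type := ℝ × ℝ × ℝ

namespace Aff

instance : MeasurableSpace Aff := inferInstanceAs (MeasurableSpace (ℝ × ℝ × ℝ))

instance : MeasurableSingletonClass Aff :=
  inferInstanceAs (MeasurableSingletonClass (ℝ × ℝ × ℝ))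

/-- The element with elapsed time `s`, rate `l` and shift `i`. -/
def mk (s l i : ℝ) : Aff := (s, l, i)

/-- The elapsed time. -/
def time (x : Aff) : ℝ := x.1

/-- The logarithm of the inverse slope. -/
def rate (x : Aff) : ℝ := x.2.1

/-- The value at `0`. -/
def shift (x : Aff) : ℝ := x.2.2

@[simp] theorem time_mk (s l i : ℝ) : (mk s l i).time = s := rfl
@[simp] theorem rate_mk (s l i : ℝ) : (mk s l i).rate = l := rfl
@[simp] theorem shift_mk (s l i : ℝ) : (mk s l i).shift = i := rfl

@[ext] theorem ext {x y : Aff} (h1 : x.time = y.time) (h2 : x.rate = y.rate)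
    (h3 : x.shift = y.shift) : x = y :=
  Prod.ext h1 (Prod.ext h2 h3)

@[fun_prop] theorem measurable_time : Measurable time := measurable_fst
@[fun_prop] theorem measurable_rate : Measurable rate := measurable_fst.comp measurable_snd
@[fun_prop] theorem measurable_shift : Measurable shift := measurable_snd.comp measurable_snd

theorem measurable_mk {α : Type*} [MeasurableSpace α] {f g h : α → ℝ}
    (hf : Measurable f) (hg : Measurable g) (hh : Measurable h) :
    Measurable fun x => mk (f x) (g x) (h x) :=
  hf.prodMk (hg.prodMk hh)

/-- The underlying affine map. -/
def act (x : Aff) (v : ℝ) : ℝ := x.shift + Real.exp (-x.rate) * v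

/-- Composition of maps, with addition of the elapsed times. -/
instance : Monoid Aff where
  mul x y := mk (x.time + y.time) (x.rate + y.rate) (x.act y.shift)
  one := mk 0 0 0
  mul_assoc x y z := by
    refine Aff.ext (add_assoc _ _ _) (add_assoc _ _ _) ?_
    change (x.shift + Real.exp (-x.rate) * y.shift) + Real.exp (-(x.rate + y.rate)) * z.shift
      = x.shift + Real.exp (-x.rate) * (y.shift + Real.exp (-y.rate) * z.shift)
    rw [neg_add, Real.exp_add]; ring
  one_mul x := by
    refine Aff.ext (zero_add _) (zero_add _) ?_
    change (0 : ℝ) + Real.exp (-0) * x.shift = x.shift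
    simp
  mul_one x := by
    refine Aff.ext (add_zero _) (add_zero _) ?_
    change x.shift + Real.exp (-x.rate) * 0 = x.shift
    simp

@[simp] theorem time_mul (x y : Aff) : (x * y).time = x.time + y.time := rfl
@[simp] theorem rate_mul (x y : Aff) : (x * y).rate = x.rate + y.rate := rfl
@[simp] theorem shift_mul (x y : Aff) :
    (x * y).shift = x.shift + Real.exp (-x.rate) * y.shift := rfl
@[simp] theorem time_one : (1 : Aff).time = 0 := rfl
@[simp] theorem rate_one : (1 : Aff).rate = 0 := rfl
@[simp] theorem shift_one : (1 : Aff).shift = 0 := rfl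

theorem act_mul (x y : Aff) (v : ℝ) : (x * y).act v = x.act (y.act v) := by
  simp only [act, shift_mul, rate_mul, neg_add, Real.exp_add]; ring

@[simp] theorem act_one (v : ℝ) : (1 : Aff).act v = v := by simp [act]

@[fun_prop] theorem measurable_act : Measurable fun p : Aff × ℝ => p.1.act p.2 := by
  unfold act; fun_prop

instance : MeasurableMul₂ Aff where
  measurable_mul := measurable_mk (by fun_prop) (by fun_prop)
    (show Measurable fun p : Aff × Aff => p.1.shift + Real.exp (-p.1.rate) * p.2.shift by fun_prop)

end Aff

/-! ### Products of independent elements of `Aff`. -/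

section Powers

/-- The convolution powers of a measure on `Aff`. -/
def affPow (κ : Measure Aff) : ℕ → Measure Aff
  | 0 => Measure.dirac 1
  | n + 1 => affPow κ n ∗ₘ κ

instance affPow_probability (κ : Measure Aff) [IsProbabilityMeasure κ] (n : ℕ) :
    IsProbabilityMeasure (affPow κ n) := by
  induction n with
  | zero => unfold affPow; infer_instance
  | succ n ih => unfold affPow; infer_instance

/-- Convolution powers can be extended at either end. This is the reversal of order on which the
argument turns: the path multiplies new cycles on the left, while the convergent products grow on
the right. -/
theorem affPow_succ' (κ : Measure Aff) [IsProbabilityMeasure κ] (n : ℕ) :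
    affPow κ (n + 1) = κ ∗ₘ affPow κ n := by
  induction n with
  | zero => simp [affPow]
  | succ n ih =>
    change affPow κ (n + 1) ∗ₘ κ = κ ∗ₘ (affPow κ n ∗ₘ κ)
    rw [ih, Measure.mconv_assoc]

/-- The clock is a homomorphism from `Aff` to the additive reals, so the epochs form an ordinary
renewal process. -/
theorem map_time_affPow (κ : Measure Aff) [IsProbabilityMeasure κ] (n : ℕ) :
    (affPow κ n).map Aff.time = convPow (κ.map Aff.time) n := by
  have : IsProbabilityMeasure (κ.map Aff.time) :=
    Measure.isProbabilityMeasure_map (by fun_prop)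
  induction n with
  | zero => simp [affPow, convPow, Measure.map_dirac' Aff.measurable_time]
  | succ n ih =>
    refine Measure.ext_of_lintegral _ fun f hf => ?_
    rw [affPow_succ', convPow, ← ih, lintegral_map hf (by fun_prop),
      Measure.lintegral_mconv (by fun_prop), Measure.lintegral_conv hf,
      lintegral_map (Measurable.lintegral_prod_right' (f := fun p : ℝ × ℝ => f (p.1 + p.2))
        (by fun_prop)) (by fun_prop)]
    refine lintegral_congr fun x => ?_
    rw [lintegral_map (by fun_prop) (by fun_prop)]
    simp

/-- The law of a sequence of independent elements with law `κ`. -/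
def seqLaw (κ : Measure Aff) [IsProbabilityMeasure κ] : Measure (ℕ → Aff) :=
  Measure.infinitePi fun _ => κ

instance (κ : Measure Aff) [IsProbabilityMeasure κ] : IsProbabilityMeasure (seqLaw κ) := by
  unfold seqLaw; infer_instance

/-- The product `ω k * ⋯ * ω (k + r - 1)`. -/
def blockProd (k : ℕ) : ℕ → (ℕ → Aff) → Aff
  | 0, _ => 1
  | r + 1, ω => blockProd k r ω * ω (k + r)

@[fun_prop]
theorem measurable_blockProd (k r : ℕ) : Measurable (blockProd k r) := by
  induction r with
  | zero => exact measurable_const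
  | succ r ih => exact ih.mul (measurable_pi_apply _)

theorem blockProd_congr (k r : ℕ) {ω ω' : ℕ → Aff}
    (h : ∀ i ∈ Finset.Ico k (k + r), ω i = ω' i) : blockProd k r ω = blockProd k r ω' := by
  induction r with
  | zero => rfl
  | succ r ih =>
    rw [blockProd, blockProd, ih fun i hi => h i (by simp at hi ⊢; omega), h (k + r) (by simp)]

theorem blockProd_add (k r : ℕ) (ω : ℕ → Aff) :
    blockProd 0 (k + r) ω = blockProd 0 k ω * blockProd k r ω := by
  induction r with
  | zero => simp [blockProd]
  | succ r ih => rw [← add_assoc, blockProd, ih, blockProd, zero_add, mul_assoc]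

variable (κ : Measure Aff) [IsProbabilityMeasure κ]

theorem iIndepFun_seqLaw : iIndepFun (fun (i : ℕ) (ω : ℕ → Aff) => ω i) (seqLaw κ) :=
  iIndepFun_infinitePi (X := fun _ x => x) fun _ => measurable_id

theorem map_eval_seqLaw (i : ℕ) : (seqLaw κ).map (fun ω => ω i) = κ :=
  Measure.infinitePi_map_eval (fun _ => κ) i

/-- The two products read disjoint sets of coordinates of an independent sequence. -/
theorem indepFun_blockProd (j k r m : ℕ) (h : j + k ≤ r) :
    IndepFun (blockProd j k) (blockProd r m) (seqLaw κ) := by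
  have hfac : ∀ k r, ∃ g : ((i : Finset.Ico k (k + r)) → Aff) → Aff, Measurable g ∧
      blockProd k r = g ∘ fun ω i => ω i := fun k r => by
    refine ⟨fun x => blockProd k r fun n =>
      if hn : n ∈ Finset.Ico k (k + r) then x ⟨n, hn⟩ else 1, ?_, ?_⟩
    · refine (measurable_blockProd k r).comp (measurable_pi_lambda _ fun n => ?_)
      by_cases hn : n ∈ Finset.Ico k (k + r)
      · simp only [hn, dite_true]; exact measurable_pi_apply _
      · simp only [hn, dite_false]; exact measurable_const
    · funext ω
      exact blockProd_congr k r fun i hi => by simp only [hi, dite_true]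
  obtain ⟨g, hg, hg'⟩ := hfac j k
  obtain ⟨g', hgm, hgm'⟩ := hfac r m
  have hd : Disjoint (Finset.Ico j (j + k)) (Finset.Ico r (r + m)) := by
    rw [Finset.disjoint_left]; intro a; simp only [Finset.mem_Ico]; omega
  rw [hg', hgm']
  exact ((iIndepFun_seqLaw κ).indepFun_finset _ _ hd fun i => measurable_pi_apply i).comp hg hgm

theorem map_blockProd (k r : ℕ) : (seqLaw κ).map (blockProd k r) = affPow κ r := by
  induction r with
  | zero =>
    have : blockProd k 0 = fun _ => 1 := rfl
    rw [this, Measure.map_const]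
    simp [affPow]
  | succ r ih =>
    have h1 : IndepFun (blockProd k r) (fun ω : ℕ → Aff => ω (k + r)) (seqLaw κ) := by
      have := indepFun_blockProd κ k r (k + r) 1 le_rfl
      have h2 : blockProd (k + r) 1 = fun ω => ω (k + r) := by
        funext ω; simp [blockProd]
      rwa [h2] at this
    have h3 := (indepFun_iff_map_prod_eq_prod_map_map (by fun_prop)
      (measurable_pi_apply _).aemeasurable).1 h1
    rw [ih, map_eval_seqLaw] at h3
    rw [affPow, Measure.mconv, ← h3, Measure.map_map (by fun_prop) (by fun_prop)]
    rfl

theorem map_blockProd_pair (k r : ℕ) :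
    (seqLaw κ).map (fun ω => (blockProd 0 k ω, blockProd k r ω))
      = (affPow κ k).prod (affPow κ r) := by
  have h := (indepFun_iff_map_prod_eq_prod_map_map (by fun_prop) (by fun_prop)).1
    (indepFun_blockProd κ 0 k k r (by omega))
  rw [h, map_blockProd, map_blockProd]

end Powers

/-! ### Convergence of the perpetuity; existence and uniqueness for the fixed point equation. -/

section Perpetuity

/-- The law of the pair (slope, shift). -/
def slopeShiftLaw (κ : Measure Aff) : Measure (ℝ × ℝ) :=
  κ.map fun x => (Real.exp (-x.rate), x.shift)

theorem map_slopeShiftLaw_prod (κ : Measure Aff) (ν : Measure ℝ) [SFinite ν] :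
    ((slopeShiftLaw κ).prod ν).map (fun q => q.1.1 * q.2 + q.1.2)
      = (κ.prod ν).map fun q => q.1.act q.2 := by
  have hm : Measurable fun x : Aff => (Real.exp (-x.rate), x.shift) := by fun_prop
  refine Measure.ext_of_lintegral _ fun f hf => ?_
  rw [lintegral_map hf (by fun_prop), lintegral_map hf (by fun_prop),
    lintegral_prod _ (by fun_prop), lintegral_prod _ (by fun_prop), slopeShiftLaw,
    lintegral_map (Measurable.lintegral_prod_right'
      (f := fun q : (ℝ × ℝ) × ℝ => f (q.1.1 * q.2 + q.1.2)) (by fun_prop)) hm]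
  simp only [Aff.act, add_comm]

variable (κ : Measure Aff) [IsProbabilityMeasure κ]

theorem ae_tendsto_average (φ : Aff → ℝ) (hφ : Measurable φ) (hint : Integrable φ κ) :
    ∀ᵐ ω ∂(seqLaw κ), Tendsto (fun n : ℕ => (∑ i ∈ Finset.range n, φ (ω i)) / n) atTop
      (𝓝 (∫ x, φ x ∂κ)) := by
  have hmp : ∀ i, MeasurePreserving (fun ω : ℕ → Aff => ω i) (seqLaw κ) κ := fun i =>
    ⟨measurable_pi_apply i, map_eval_seqLaw κ i⟩
  have hmap : ∀ i, (seqLaw κ).map (fun ω => φ (ω i)) = κ.map φ := fun i =>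
    (Measure.map_map hφ (measurable_pi_apply i)).symm.trans (by rw [map_eval_seqLaw])
  have h := strong_law_ae_real (μ := seqLaw κ) (fun i ω => φ (ω i))
    ((hmp 0).integrable_comp_of_integrable hint)
    (fun i j hij => ((iIndepFun_seqLaw κ).indepFun hij).comp hφ hφ)
    (fun i => ⟨(hφ.comp (measurable_pi_apply i)).aemeasurable,
      (hφ.comp (measurable_pi_apply 0)).aemeasurable, by
        rw [hmap i, hmap 0]⟩)
  have h0 : ∫ ω, φ (ω 0) ∂(seqLaw κ) = ∫ x, φ x ∂κ := by
    rw [← integral_map (f := φ) (φ := fun ω : ℕ → Aff => ω 0)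
      (measurable_pi_apply 0).aemeasurable hφ.aestronglyMeasurable, map_eval_seqLaw]
  rwa [h0] at h

/-- `u n / n` is, up to a factor tending to one, a difference of consecutive averages. It turns the
law of large numbers for `log⁺` of the shifts into their subexponential growth. -/
theorem tendsto_div_of_tendsto_average {u : ℕ → ℝ} {c : ℝ}
    (h : Tendsto (fun n : ℕ => (∑ i ∈ Finset.range n, u i) / n) atTop (𝓝 c)) :
    Tendsto (fun n : ℕ => u n / n) atTop (𝓝 0) := by
  have h1 := (tendsto_add_atTop_iff_nat 1).2 h
  have h2 : Tendsto (fun n : ℕ => ((n : ℝ) + 1) / n) atTop (𝓝 1) := by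
    have : Tendsto (fun n : ℕ => 1 + 1 / (n : ℝ)) atTop (𝓝 (1 + 0)) :=
      tendsto_const_nhds.add tendsto_one_div_atTop_nhds_zero_nat
    rw [add_zero] at this
    refine this.congr' ?_
    filter_upwards [eventually_gt_atTop 0] with n hn
    have : (n : ℝ) ≠ 0 := by positivity
    field_simp
  have h3 := (h1.mul h2).sub h
  rw [mul_one, sub_self] at h3
  refine h3.congr' ?_
  filter_upwards [eventually_gt_atTop 0] with n hn
  have : (n : ℝ) ≠ 0 := by positivity
  rw [Finset.sum_range_succ]
  push_cast
  field_simp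
  ring

theorem rate_blockProd (n : ℕ) (ω : ℕ → Aff) :
    (blockProd 0 n ω).rate = ∑ i ∈ Finset.range n, (ω i).rate := by
  induction n with
  | zero => simp [blockProd]
  | succ n ih => rw [blockProd, Aff.rate_mul, ih, Finset.sum_range_succ, zero_add]

theorem shift_blockProd (n : ℕ) (ω : ℕ → Aff) :
    (blockProd 0 n ω).shift
      = ∑ i ∈ Finset.range n, Real.exp (-(blockProd 0 i ω).rate) * (ω i).shift := by
  induction n with
  | zero => simp [blockProd]
  | succ n ih => rw [blockProd, Aff.shift_mul, ih, Finset.sum_range_succ, zero_add]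

/-- The conditions under which the perpetuity generated by `κ` converges. -/
structure Contractive (κ : Measure Aff) : Prop where
  integrable_rate : Integrable Aff.rate κ
  rate_pos : 0 < ∫ x, x.rate ∂κ
  integrable_posLog : Integrable (fun x : Aff => Real.posLog |x.shift|) κ

/-- The sum of the perpetuity. -/
def perpetuitySum (ω : ℕ → Aff) : ℝ :=
  ∑' i, Real.exp (-(blockProd 0 i ω).rate) * (ω i).shift

variable {κ}

theorem abs_le_exp_posLog (x : ℝ) : |x| ≤ Real.exp (Real.posLog |x|) := by
  rcases eq_or_ne x 0 with rfl | hx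
  · simp
  · calc |x| = Real.exp (Real.log |x|) := (Real.exp_log (abs_pos.2 hx)).symm
      _ ≤ _ := Real.exp_le_exp.2 (le_max_right _ _)

/-- With `c` the mean rate, the accumulated rate eventually exceeds `3 c n / 4`, while `log⁺` of the
`n`-th shift stays below `c n / 4`. The series is therefore dominated by a geometric one with terms
`exp (-c n / 2)`. -/
theorem Contractive.ae_tendsto (h : Contractive κ) :
    ∀ᵐ ω ∂(seqLaw κ), Tendsto (fun n => Real.exp (-(blockProd 0 n ω).rate)) atTop (𝓝 0) ∧
      Tendsto (fun n => (blockProd 0 n ω).shift) atTop (𝓝 (perpetuitySum ω)) := by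
  filter_upwards [ae_tendsto_average κ _ Aff.measurable_rate h.integrable_rate,
    ae_tendsto_average κ (fun x => Real.posLog |x.shift|)
      (Real.continuous_posLog.measurable.comp (by fun_prop)) h.integrable_posLog] with ω h1 h2
  set c := ∫ x, x.rate ∂κ with hc
  have hcpos : 0 < c := h.rate_pos
  have h3 := tendsto_div_of_tendsto_average h2
  have e1 : ∀ᶠ n : ℕ in atTop, 3 / 4 * c * n ≤ (blockProd 0 n ω).rate := by
    filter_upwards [h1.eventually (lt_mem_nhds (show 3 / 4 * c < c by linarith)),
      eventually_gt_atTop 0] with n hn hn0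
    have : (0 : ℝ) < n := by positivity
    rw [rate_blockProd]
    exact ((lt_div_iff₀ this).1 hn).le
  have e2 : ∀ᶠ n : ℕ in atTop, Real.posLog |(ω n).shift| ≤ 1 / 4 * c * n := by
    filter_upwards [h3.eventually (gt_mem_nhds (show 0 < 1 / 4 * c by positivity)),
      eventually_gt_atTop 0] with n hn hn0
    have : (0 : ℝ) < n := by positivity
    exact ((div_lt_iff₀ this).1 hn).le
  have hgeom : Summable fun n : ℕ => Real.exp (-(c / 2) * n) := by
    have : ∀ n : ℕ, Real.exp (-(c / 2) * n) = Real.exp (-(c / 2)) ^ n := fun n => by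
      rw [← Real.exp_nat_mul, mul_comm]
    simp only [this]
    exact summable_geometric_of_lt_one (Real.exp_nonneg _)
      (Real.exp_lt_one_iff.2 (by linarith))
  constructor
  · refine squeeze_zero' (Eventually.of_forall fun n => Real.exp_nonneg _) ?_
      hgeom.tendsto_atTop_zero
    filter_upwards [e1] with n hn
    refine Real.exp_le_exp.2 ?_
    have : 0 ≤ c * n := by positivity
    linarith
  · have hs : Summable fun i => Real.exp (-(blockProd 0 i ω).rate) * (ω i).shift := by
      refine Summable.of_norm_bounded_eventually_nat hgeom ?_
      filter_upwards [e1, e2] with n hn hn2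
      rw [norm_mul, Real.norm_eq_abs, Real.norm_eq_abs, abs_of_pos (Real.exp_pos _)]
      calc Real.exp (-(blockProd 0 n ω).rate) * |(ω n).shift|
          ≤ Real.exp (-(blockProd 0 n ω).rate) * Real.exp (Real.posLog |(ω n).shift|) := by
            gcongr; exact abs_le_exp_posLog _
        _ = Real.exp (-(blockProd 0 n ω).rate + Real.posLog |(ω n).shift|) :=
            (Real.exp_add _ _).symm
        _ ≤ _ := Real.exp_le_exp.2 (by linarith)
    simp only [shift_blockProd]
    exact hs.hasSum.tendsto_sum_nat

theorem Contractive.aemeasurable_perpetuitySum (h : Contractive κ) :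
    AEMeasurable perpetuitySum (seqLaw κ) :=
  aemeasurable_of_tendsto_metrizable_ae atTop
    (fun n => (Aff.measurable_shift.comp (measurable_blockProd 0 n)).aemeasurable)
    (h.ae_tendsto.mono fun _ hω => hω.2)

variable (κ) in
/-- The law of the perpetuity. -/
def perpetuityLaw : Measure ℝ := (seqLaw κ).map perpetuitySum

theorem Contractive.isProbabilityMeasure (h : Contractive κ) :
    IsProbabilityMeasure (perpetuityLaw κ) :=
  Measure.isProbabilityMeasure_map h.aemeasurable_perpetuitySum

theorem Contractive.ae_tendsto_act (h : Contractive κ) :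
    ∀ᵐ ω ∂(seqLaw κ), ∀ v, Tendsto (fun n => (blockProd 0 n ω).act v) atTop
      (𝓝 (perpetuitySum ω)) := by
  filter_upwards [h.ae_tendsto] with ω hω v
  simpa [Aff.act] using hω.2.add (hω.1.mul_const v)

/-- The iterated affine maps, applied to any point, converge in law to the perpetuity. -/
theorem Contractive.tendsto_integral_affPow (h : Contractive κ) (f : BoundedContinuousFunction ℝ ℝ)
    (v : ℝ) :
    Tendsto (fun n => ∫ x, f (x.act v) ∂(affPow κ n)) atTop
      (𝓝 (∫ z, f z ∂(perpetuityLaw κ))) := by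
  have h1 : ∀ n, ∫ x, f (x.act v) ∂(affPow κ n)
      = ∫ ω, f ((blockProd 0 n ω).act v) ∂(seqLaw κ) := fun n => by
    rw [← map_blockProd κ 0 n, integral_map (by fun_prop)]
    exact (f.continuous.measurable.comp (by fun_prop)).aestronglyMeasurable
  simp only [h1]
  rw [perpetuityLaw, integral_map h.aemeasurable_perpetuitySum
    f.continuous.aestronglyMeasurable]
  refine tendsto_integral_of_dominated_convergence (fun _ => ‖f‖) (fun n => ?_)
    (integrable_const _) (fun n => Eventually.of_forall fun ω => f.norm_coe_le_norm _) ?_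
  · exact (f.continuous.measurable.comp (by fun_prop)).aestronglyMeasurable
  · filter_upwards [h.ae_tendsto_act] with ω hω
    exact (f.continuous.tendsto _).comp (hω v)

theorem Contractive.tendsto_integral_integral_affPow (h : Contractive κ)
    (f : BoundedContinuousFunction ℝ ℝ) (ν : Measure ℝ) [IsProbabilityMeasure ν] :
    Tendsto (fun n => ∫ v, ∫ x, f (x.act v) ∂(affPow κ n) ∂ν) atTop
      (𝓝 (∫ z, f z ∂(perpetuityLaw κ))) := by
  have := tendsto_integral_of_dominated_convergence (μ := ν)
    (F := fun n v => ∫ x, f (x.act v) ∂(affPow κ n)) (f := fun _ => ∫ z, f z ∂(perpetuityLaw κ))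
    (fun _ => ‖f‖) (fun n => ?_) (integrable_const _) (fun n => Eventually.of_forall fun v => ?_)
    (Eventually.of_forall fun v => h.tendsto_integral_affPow f v)
  · simpa using this
  · have : StronglyMeasurable fun p : ℝ × Aff => f (p.2.act p.1) :=
      (f.continuous.measurable.comp (by fun_prop)).stronglyMeasurable
    exact this.integral_prod_right'.aestronglyMeasurable
  · refine (norm_integral_le_of_norm_le_const
      (Eventually.of_forall fun x => f.norm_coe_le_norm _)).trans ?_
    simp

/-- A law fixed by one random affine map is fixed by any number of independent ones. Since the
iterates forget their starting point, this determines the law. -/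
theorem integral_of_map_act_eq {ν : Measure ℝ} [IsProbabilityMeasure ν]
    (hν : (κ.prod ν).map (fun q => q.1.act q.2) = ν) (f : BoundedContinuousFunction ℝ ℝ) (n : ℕ) :
    ∫ v, ∫ x, f (x.act v) ∂(affPow κ n) ∂ν = ∫ z, f z ∂ν := by
  have hb : ∀ {α : Type} [MeasurableSpace α] (μ : Measure α) [IsFiniteMeasure μ] (g : α → ℝ),
      Measurable g → Integrable (fun x => f (g x)) μ := fun μ _ g hg =>
    Integrable.of_bound (f.continuous.measurable.comp hg).aestronglyMeasurable ‖f‖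
      (Eventually.of_forall fun x => f.norm_coe_le_norm _)
  induction n with
  | zero => simp [affPow]
  | succ n ih =>
    rw [← ih]
    have h1 : ∫ v, ∫ x, f (x.act v) ∂(affPow κ n) ∂ν
        = ∫ x, ∫ v, f (x.act v) ∂ν ∂(affPow κ n) :=
      integral_integral_swap (hb _ (fun p : ℝ × Aff => p.2.act p.1) (by fun_prop))
    have h2 : ∫ v, ∫ x, f (x.act v) ∂(affPow κ (n + 1)) ∂ν
        = ∫ x, ∫ v, f (x.act v) ∂ν ∂(affPow κ (n + 1)) :=
      integral_integral_swap (hb _ (fun p : ℝ × Aff => p.2.act p.1) (by fun_prop))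
    have hm : StronglyMeasurable fun x : Aff => ∫ v, f (x.act v) ∂ν := by
      have : StronglyMeasurable fun p : Aff × ℝ => f (p.1.act p.2) :=
        (f.continuous.measurable.comp (by fun_prop)).stronglyMeasurable
      exact this.integral_prod_right'
    rw [h1, h2, affPow, Measure.mconv, integral_map (by fun_prop) hm.aestronglyMeasurable,
      integral_prod]
    · refine integral_congr_ae (Eventually.of_forall fun x => ?_)
      simp only [Aff.act_mul]
      rw [← integral_prod (fun p : Aff × ℝ => f (x.act (p.1.act p.2)))
        (hb _ (fun p : Aff × ℝ => x.act (p.1.act p.2)) (by fun_prop))]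
      conv_rhs => rw [← hν]
      rw [integral_map (by fun_prop)]
      exact (f.continuous.measurable.comp (by fun_prop)).aestronglyMeasurable
    · refine Integrable.of_bound (hm.comp_measurable measurable_mul).aestronglyMeasurable ‖f‖
        (Eventually.of_forall fun p => ?_)
      refine (norm_integral_le_of_norm_le_const
        (Eventually.of_forall fun x => f.norm_coe_le_norm _)).trans ?_
      simp

/-- Split off the first factor of `affPow κ (n + 1)` and let `n → ∞` on both sides. The map is
continuous, so the inner integral converges for each first factor. -/
theorem Contractive.map_act_perpetuityLaw (h : Contractive κ) :
    (κ.prod (perpetuityLaw κ)).map (fun q => q.1.act q.2) = perpetuityLaw κ := by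
  have := h.isProbabilityMeasure
  have : IsProbabilityMeasure ((κ.prod (perpetuityLaw κ)).map fun q => q.1.act q.2) :=
    Measure.isProbabilityMeasure_map (by fun_prop)
  refine ext_of_forall_integral_eq_of_IsFiniteMeasure fun f => ?_
  have hmeas : Measurable fun q : Aff × ℝ => f (q.1.act q.2) :=
    f.continuous.measurable.comp (by fun_prop)
  rw [integral_map (by fun_prop) f.continuous.aestronglyMeasurable, integral_prod _
    (Integrable.of_bound hmeas.aestronglyMeasurable ‖f‖
      (Eventually.of_forall fun x => f.norm_coe_le_norm _))]
  have h1 : Tendsto (fun n => ∫ x, ∫ y, f (x.act (y.act 0)) ∂(affPow κ n) ∂κ) atTop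
      (𝓝 (∫ x, ∫ z, f (x.act z) ∂(perpetuityLaw κ) ∂κ)) := by
    refine tendsto_integral_of_dominated_convergence (fun _ => ‖f‖) (fun n => ?_)
      (integrable_const _) (fun n => Eventually.of_forall fun x => ?_)
      (Eventually.of_forall fun x => ?_)
    · have : StronglyMeasurable fun p : Aff × Aff => f (p.1.act (p.2.act 0)) :=
        (f.continuous.measurable.comp (by fun_prop)).stronglyMeasurable
      exact this.integral_prod_right'.aestronglyMeasurable
    · refine (norm_integral_le_of_norm_le_const
        (Eventually.of_forall fun x => f.norm_coe_le_norm _)).trans ?_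
      simp
    · have hx : Continuous fun z => x.act z := by unfold Aff.act; fun_prop
      exact h.tendsto_integral_affPow (f.compContinuous ⟨_, hx⟩) 0
  have h2 : ∀ n, ∫ x, ∫ y, f (x.act (y.act 0)) ∂(affPow κ n) ∂κ
      = ∫ x, f (x.act 0) ∂(affPow κ (n + 1)) := fun n => by
    have hm : Measurable fun p : Aff × Aff => f (p.1.act (p.2.act 0)) :=
      f.continuous.measurable.comp (by fun_prop)
    have hm' : Measurable fun p : Aff => f (p.act 0) :=
      f.continuous.measurable.comp (by fun_prop)
    rw [affPow_succ', Measure.mconv, integral_map (by fun_prop) hm'.aestronglyMeasurable]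
    simp only [Aff.act_mul]
    rw [integral_prod _ (Integrable.of_bound hm.aestronglyMeasurable ‖f‖
      (Eventually.of_forall fun x => f.norm_coe_le_norm _))]
  simp only [h2] at h1
  exact tendsto_nhds_unique h1
    ((tendsto_add_atTop_iff_nat 1).2 (h.tendsto_integral_affPow f 0))

theorem Contractive.eq_perpetuityLaw (h : Contractive κ) {ν : Measure ℝ} [IsProbabilityMeasure ν]
    (hν : (κ.prod ν).map (fun q => q.1.act q.2) = ν) : ν = perpetuityLaw κ := by
  have := h.isProbabilityMeasure
  refine ext_of_forall_integral_eq_of_IsFiniteMeasure fun f => ?_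
  refine tendsto_nhds_unique ?_ (h.tendsto_integral_integral_affPow f ν)
  simp only [integral_of_map_act_eq hν]
  exact tendsto_const_nhds

theorem Contractive.solvesSRE (h : Contractive κ) :
    SolvesSRE (slopeShiftLaw κ) (perpetuityLaw κ) := by
  have := h.isProbabilityMeasure
  exact ⟨this, by rw [map_slopeShiftLaw_prod, h.map_act_perpetuityLaw]⟩

theorem Contractive.eq_of_solvesSRE (h : Contractive κ) {ν : Measure ℝ}
    (hν : SolvesSRE (slopeShiftLaw κ) ν) : ν = perpetuityLaw κ := by
  have := hν.1
  exact h.eq_perpetuityLaw (by rw [← map_slopeShiftLaw_prod]; exact hν.2)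

end Perpetuity

/-! ### The renewal theorem for affine maps with a clock. -/

section AffineRenewal

/-- The sum of the tails over all renewal epochs. -/
def tailSum (κ : Measure Aff) (t : ℝ) (ω : ℕ → Aff) : ℝ≥0∞ :=
  ∑' k, tailFn (κ.map Aff.time) (t - (blockProd 0 k ω).time)

@[fun_prop]
theorem measurable_tailSum (κ : Measure Aff) (t : ℝ) : Measurable (tailSum κ t) :=
  Measurable.tsum fun k => by fun_prop

variable (κ : Measure Aff) [IsProbabilityMeasure κ]

instance isProbabilityMeasure_map_time : IsProbabilityMeasure (κ.map Aff.time) :=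
  Measure.isProbabilityMeasure_map (by fun_prop)

theorem lintegral_time_affPow {g : ℝ → ℝ≥0∞} (hg : Measurable g) (k : ℕ) :
    ∫⁻ x, g x.time ∂(affPow κ k) = ∫⁻ s, g s ∂(convPow (κ.map Aff.time) k) := by
  rw [← map_time_affPow, lintegral_map hg (by fun_prop)]

theorem tsum_lintegral_time_affPow {g : ℝ → ℝ≥0∞} (hg : Measurable g) (t : ℝ) :
    ∑' k, ∫⁻ x, g (t - x.time) ∂(affPow κ k) = renewalFn (κ.map Aff.time) g t := by
  rw [renewalFn, renewalMeasure, lintegral_sum_measure]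
  exact tsum_congr fun k => lintegral_time_affPow κ (g := fun s => g (t - s)) (by fun_prop) k

theorem lintegral_blockProd {H : Aff → ℝ≥0∞} (hH : Measurable H) (k r : ℕ) :
    ∫⁻ ω, H (blockProd k r ω) ∂(seqLaw κ) = ∫⁻ x, H x ∂(affPow κ r) := by
  rw [← map_blockProd κ k r, lintegral_map hH (by fun_prop)]

theorem lintegral_blockProd_pair {H : Aff × Aff → ℝ≥0∞} (hH : Measurable H) (k r : ℕ) :
    ∫⁻ ω, H (blockProd 0 k ω, blockProd k r ω) ∂(seqLaw κ)
      = ∫⁻ x, ∫⁻ y, H (x, y) ∂(affPow κ r) ∂(affPow κ k) := by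
  rw [← lintegral_prod _ (by fun_prop), ← map_blockProd_pair, lintegral_map hH (by fun_prop)]

/-- Each unordered pair of indices is listed with the smaller one first, so that the second moment
can be computed by restarting at the earlier epoch; the factor `2` accounts for the order. -/
theorem tsum_mul_tsum_le (u : ℕ → ℝ≥0∞) :
    (∑' k, u k) * ∑' k, u k ≤ 2 * ∑' k, ∑' r, u k * u (k + r) := by
  have hshift : ∀ k : ℕ, ∑' l, (if k ≤ l then u k * u l else 0) = ∑' r, u k * u (k + r) := by
    intro k
    have h := Summable.sum_add_tsum_nat_add' (f := fun l => if k ≤ l then u k * u l else 0)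
      (k := k) ENNReal.summable
    rw [← h, Finset.sum_eq_zero fun i hi => if_neg (not_le.2 (Finset.mem_range.1 hi)), zero_add]
    exact tsum_congr fun r => by rw [if_pos (Nat.le_add_left k r), add_comm r k]
  calc (∑' k, u k) * ∑' k, u k = ∑' k, ∑' l, u k * u l := by
        rw [← ENNReal.tsum_mul_right]
        exact tsum_congr fun k => ENNReal.tsum_mul_left.symm
    _ ≤ ∑' k, ∑' l, ((if k ≤ l then u k * u l else 0) + if l ≤ k then u l * u k else 0) := by
        refine ENNReal.tsum_le_tsum fun k => ENNReal.tsum_le_tsum fun l => ?_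
        rcases le_total k l with h | h
        · rw [if_pos h]; exact le_self_add
        · rw [if_pos h, mul_comm]; exact le_add_self
    _ = ∑' k, ∑' r, u k * u (k + r) + ∑' k, ∑' r, u k * u (k + r) := by
        simp only [ENNReal.tsum_add]
        congr 1
        · exact tsum_congr hshift
        · rw [ENNReal.tsum_comm]
          exact tsum_congr hshift
    _ = _ := (two_mul _).symm

variable {κ}

/-- Given the earlier epoch, the later ones form a fresh renewal process, whose expected tail sum is
at most one. The sum over the earlier epoch is then at most one again. -/
theorem lintegral_tailSum_mul_self_le (hF : κ.map Aff.time (Iic 0) = 0) (t : ℝ) :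
    ∫⁻ ω, tailSum κ t ω * tailSum κ t ω ∂(seqLaw κ) ≤ 2 := by
  set F := κ.map Aff.time with hFdef
  have hterm : ∀ k r, ∫⁻ ω, tailFn F (t - (blockProd 0 k ω).time)
      * tailFn F (t - (blockProd 0 (k + r) ω).time) ∂(seqLaw κ)
      = ∫⁻ x, ∫⁻ y, tailFn F (t - x.time) * tailFn F (t - x.time - y.time) ∂(affPow κ r)
          ∂(affPow κ k) := fun k r => by
    have h := lintegral_blockProd_pair κ (H := fun p => tailFn F (t - p.1.time)
      * tailFn F (t - p.1.time - p.2.time)) (by fun_prop) k r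
    rw [← h]
    refine lintegral_congr fun ω => ?_
    rw [blockProd_add, Aff.time_mul, sub_sub]
  have hm : ∀ r, Measurable fun x : Aff => ∫⁻ y : Aff, tailFn F (t - x.time)
      * tailFn F (t - x.time - y.time) ∂(affPow κ r) := fun r =>
    Measurable.lintegral_prod_right' (f := fun p : Aff × Aff => tailFn F (t - p.1.time)
      * tailFn F (t - p.1.time - p.2.time)) (by fun_prop)
  calc ∫⁻ ω, tailSum κ t ω * tailSum κ t ω ∂(seqLaw κ)
      ≤ ∫⁻ ω, 2 * ∑' k, ∑' r, tailFn F (t - (blockProd 0 k ω).time)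
          * tailFn F (t - (blockProd 0 (k + r) ω).time) ∂(seqLaw κ) :=
        lintegral_mono fun ω => tsum_mul_tsum_le _
    _ = 2 * ∑' k, ∑' r, ∫⁻ x, ∫⁻ y, tailFn F (t - x.time) * tailFn F (t - x.time - y.time)
          ∂(affPow κ r) ∂(affPow κ k) := by
        rw [lintegral_const_mul _ (Measurable.tsum fun k => Measurable.tsum fun r => by fun_prop),
          lintegral_tsum fun k => (Measurable.tsum fun r => by fun_prop).aemeasurable]
        congr 1
        refine tsum_congr fun k => ?_
        rw [lintegral_tsum fun r => by fun_prop]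
        exact tsum_congr fun r => hterm k r
    _ ≤ 2 * ∑' k, ∫⁻ x, tailFn F (t - x.time) ∂(affPow κ k) := by
        gcongr with k
        rw [← lintegral_tsum fun r => (hm r).aemeasurable]
        refine lintegral_mono fun x => ?_
        simp only
        have h1 : ∀ r, ∫⁻ y : Aff, tailFn F (t - x.time) * tailFn F (t - x.time - y.time)
            ∂(affPow κ r)
            = tailFn F (t - x.time) * ∫⁻ y : Aff, tailFn F (t - x.time - y.time) ∂(affPow κ r) :=
          fun r => lintegral_const_mul _ (by fun_prop)
        simp only [h1]
        rw [ENNReal.tsum_mul_left, tsum_lintegral_time_affPow κ (by fun_prop)]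
        exact mul_le_of_le_one_right' (renewalFn_le_one hF (fun _ => le_rfl) _)
    _ ≤ 2 := by
        rw [tsum_lintegral_time_affPow κ (by fun_prop)]
        exact mul_le_of_le_one_right' (renewalFn_le_one hF (fun _ => le_rfl) _)

/-- Truncation at level `M`: either `R ≤ M`, or `R ≤ R * R / M` and `W ≤ 1`. -/
theorem mul_le_natCast_mul_add {R W : ℝ≥0∞} (hW : W ≤ 1) {M : ℕ} (hM : M ≠ 0) :
    R * W ≤ M * W + (M : ℝ≥0∞)⁻¹ * (R * R) := by
  rcases le_total R M with h | h
  · exact (mul_le_mul_left h W).trans le_self_add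
  · refine le_trans ?_ le_add_self
    calc R * W ≤ R * 1 := by gcongr
      _ = (M : ℝ≥0∞)⁻¹ * (M * R) := by
        rw [← mul_assoc, ENNReal.inv_mul_cancel (by simpa using hM) (ENNReal.natCast_ne_top M),
          one_mul, mul_one]
      _ ≤ _ := by gcongr

/-- Uniform integrability of `tailSum`: against random variables converging to zero in mean its
integrals vanish uniformly in time. -/
theorem eventually_lintegral_tailSum_mul_le (hF : κ.map Aff.time (Iic 0) = 0)
    {W : ℕ → (ℕ → Aff) → ℝ≥0∞} (hWm : ∀ n, Measurable (W n)) (hW1 : ∀ n ω, W n ω ≤ 1)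
    (hW : Tendsto (fun n => ∫⁻ ω, W n ω ∂(seqLaw κ)) atTop (𝓝 0)) {δ : ℝ≥0∞} (hδ : 0 < δ) :
    ∀ᶠ n in atTop, ∀ t, ∫⁻ ω, tailSum κ t ω * W n ω ∂(seqLaw κ) ≤ δ := by
  have hδ2 : 0 < δ / 2 := ENNReal.div_pos hδ.ne' (by simp)
  have h1 : Tendsto (fun M : ℕ => (M : ℝ≥0∞)⁻¹ * 2) atTop (𝓝 0) := by
    simpa using ENNReal.Tendsto.mul_const ENNReal.tendsto_inv_nat_nhds_zero
      (Or.inr (ENNReal.ofNat_ne_top (n := 2)))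
  obtain ⟨M, hM, hM0⟩ := ((h1.eventually (gt_mem_nhds hδ2)).and (eventually_ne_atTop 0)).exists
  have h2 : Tendsto (fun n => (M : ℝ≥0∞) * ∫⁻ ω, W n ω ∂(seqLaw κ)) atTop (𝓝 0) := by
    simpa using ENNReal.Tendsto.const_mul hW (Or.inr (ENNReal.natCast_ne_top M))
  filter_upwards [h2.eventually (gt_mem_nhds hδ2)] with n hn t
  calc ∫⁻ ω, tailSum κ t ω * W n ω ∂(seqLaw κ)
      ≤ ∫⁻ ω, (M * W n ω + (M : ℝ≥0∞)⁻¹ * (tailSum κ t ω * tailSum κ t ω)) ∂(seqLaw κ) :=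
        lintegral_mono fun ω => mul_le_natCast_mul_add (hW1 n ω) hM0
    _ = M * ∫⁻ ω, W n ω ∂(seqLaw κ)
        + (M : ℝ≥0∞)⁻¹ * ∫⁻ ω, tailSum κ t ω * tailSum κ t ω ∂(seqLaw κ) := by
        rw [lintegral_add_left ((hWm n).const_mul _), lintegral_const_mul _ (hWm n),
          lintegral_const_mul _ (by fun_prop)]
    _ ≤ δ / 2 + δ / 2 := by
        refine add_le_add hn.le (le_trans ?_ hM.le)
        gcongr
        exact lintegral_tailSum_mul_self_le hF t
    _ = δ := ENNReal.add_halves δ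

/-- The deviation of the perpetuity, after `n` steps, from its later values. -/
def oscillation (C : ℝ≥0) (c d : ℝ) (n : ℕ) (ω : ℕ → Aff) : ℝ≥0∞ :=
  ⨆ r : ℕ, min 1 (C * ENNReal.ofReal (|Real.exp (-(blockProd 0 (n + r) ω).rate) * c|
    + |(blockProd 0 (n + r) ω).act d - (blockProd 0 n ω).shift|))

theorem measurable_oscillation (C : ℝ≥0) (c d : ℝ) (n : ℕ) : Measurable (oscillation C c d n) :=
  Measurable.iSup fun r => by
    have h1 : Measurable fun ω => (blockProd 0 (n + r) ω).act d :=
      Aff.measurable_act.comp ((measurable_blockProd 0 (n + r)).prodMk measurable_const)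
    have h2 : Measurable fun ω => |(blockProd 0 (n + r) ω).act d - (blockProd 0 n ω).shift| :=
      (h1.sub (by fun_prop)).abs
    have h3 : Measurable fun ω => |Real.exp (-(blockProd 0 (n + r) ω).rate) * c| :=
      Measurable.abs (by fun_prop)
    exact measurable_const.min ((h3.add h2).ennreal_ofReal.const_mul _)

theorem oscillation_le_one (C : ℝ≥0) (c d : ℝ) (n : ℕ) (ω : ℕ → Aff) :
    oscillation C c d n ω ≤ 1 :=
  iSup_le fun _ => min_le_left _ _

theorem Contractive.tendsto_lintegral_oscillation (h : Contractive κ) (C : ℝ≥0) (c d : ℝ) :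
    Tendsto (fun n => ∫⁻ ω, oscillation C c d n ω ∂(seqLaw κ)) atTop (𝓝 0) := by
  have := tendsto_lintegral_of_dominated_convergence (μ := seqLaw κ)
    (F := oscillation C c d) (f := fun _ => 0) (fun _ => 1)
    (fun n => measurable_oscillation C c d n)
    (fun n => Eventually.of_forall fun ω => oscillation_le_one C c d n ω) (by simp) ?_
  · simpa using this
  filter_upwards [h.ae_tendsto, h.ae_tendsto_act] with ω h1 h2
  rw [ENNReal.tendsto_nhds_zero]
  intro ε hε
  have ha : Tendsto (fun n => |Real.exp (-(blockProd 0 n ω).rate) * c|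
      + |(blockProd 0 n ω).act d - perpetuitySum ω|) atTop (𝓝 0) := by
    have e1 := (h1.1.mul_const c).abs
    have e2 := ((h2 d).sub_const (perpetuitySum ω)).abs
    simpa using e1.add e2
  have hb : Tendsto (fun n => |perpetuitySum ω - (blockProd 0 n ω).shift|) atTop (𝓝 0) := by
    simpa using (h1.2.const_sub (perpetuitySum ω)).abs
  obtain ⟨η, hη, hηε⟩ : ∃ η : ℝ, 0 < η ∧ C * ENNReal.ofReal (2 * η) ≤ ε := by
    have : Tendsto (fun η : ℝ => (C : ℝ≥0∞) * ENNReal.ofReal (2 * η)) (𝓝[>] 0) (𝓝 0) := by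
      have e : Tendsto (fun η : ℝ => ENNReal.ofReal (2 * η)) (𝓝[>] 0) (𝓝 0) := by
        have : Continuous fun η : ℝ => ENNReal.ofReal (2 * η) :=
        ENNReal.continuous_ofReal.comp (by fun_prop)
        simpa using (this.tendsto 0).mono_left nhdsWithin_le_nhds
      simpa using ENNReal.Tendsto.const_mul e (Or.inr ENNReal.coe_ne_top)
    obtain ⟨η, h1, h2⟩ := ((this.eventually (gt_mem_nhds hε)).and self_mem_nhdsWithin).exists
    exact ⟨η, h2, h1.le⟩
  obtain ⟨N, hN⟩ := eventually_atTop.1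
    ((ha.eventually (gt_mem_nhds hη)).and (hb.eventually (gt_mem_nhds hη)))
  filter_upwards [eventually_ge_atTop N] with n hn
  refine iSup_le fun r => (min_le_right _ _).trans (le_trans ?_ hηε)
  gcongr
  have e1 := (hN (n + r) (by omega)).1
  have e2 := (hN n hn).2
  have e3 := abs_sub_le ((blockProd 0 (n + r) ω).act d) (perpetuitySum ω) (blockProd 0 n ω).shift
  linarith

theorem tendsto_of_le_add_of_le_add {ι : Type*} {l : Filter ι} {u e : ι → ℝ≥0∞} {a : ℝ≥0∞}
    (ha : a ≠ ∞) (h1 : ∀ i, u i ≤ a + e i) (h2 : ∀ i, a ≤ u i + e i) (he : Tendsto e l (𝓝 0)) :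
    Tendsto u l (𝓝 a) := by
  rw [ENNReal.tendsto_nhds ha]
  intro ε hε
  filter_upwards [ENNReal.tendsto_nhds_zero.1 he ε hε] with i hi
  exact ⟨tsub_le_iff_right.2 ((h2 i).trans (by gcongr)), (h1 i).trans (by gcongr)⟩

/-- **Renewal theorem for random affine maps**: sums over all renewal epochs of a function of the
time to `t` and of the iterated affine maps converge as `t → ∞`. -/
theorem Contractive.tendsto_tsum_lintegral_affPow (h : Contractive κ)
    (hF : κ.map Aff.time (Iic 0) = 0) (hac : κ.map Aff.time ≪ volume)
    (hm : ∫⁻ x, tailFn (κ.map Aff.time) x ≠ ∞) {q : ℝ → ℝ≥0∞} (hq : Measurable q)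
    (hqle : ∀ x, q x ≤ tailFn (κ.map Aff.time) x) {f : ℝ × ℝ × ℝ → ℝ≥0∞} (hf : Measurable f)
    (hf1 : ∀ p, f p ≤ 1) {C : ℝ≥0}
    (hfL : ∀ x φ φ' i i', f (x, φ, i)
      ≤ f (x, φ', i') + C * ENNReal.ofReal (|φ - φ'| + |i - i'|)) (c d : ℝ) :
    Tendsto (fun t => ∑' k, ∫⁻ x, q (t - x.time)
        * f (t - x.time, Real.exp (-x.rate) * c, x.act d) ∂(affPow κ k)) atTop
      (𝓝 ((∫⁻ v, (∫⁻ x, q x * f (x, 0, v)) ∂(perpetuityLaw κ))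
        / ∫⁻ x, tailFn (κ.map Aff.time) x)) := by
  set F := κ.map Aff.time with hFdef
  set m := ∫⁻ x, tailFn F x with hmdef
  set G : ℝ → ℝ → ℝ≥0∞ := fun v x => q x * f (x, 0, v) with hG
  have hGm : Measurable fun p : ℝ × ℝ => G p.1 p.2 := by
    simp only [hG]; fun_prop
  have hGle : ∀ v x, G v x ≤ tailFn F x := fun v x =>
    (mul_le_of_le_one_right' (hf1 _)).trans (hqle x)
  set hh : ℝ → ℝ≥0∞ := fun v => ∫⁻ x, G v x with hhdef
  have hhm : Measurable hh := Measurable.lintegral_prod_right' hGm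
  have hhle : ∀ v, hh v ≤ m := fun v => lintegral_mono (hGle v)
  set A : ℝ → ℝ≥0∞ := fun t => ∑' k, ∫⁻ x, q (t - x.time)
        * f (t - x.time, Real.exp (-x.rate) * c, x.act d) ∂(affPow κ k) with hA
  set a : ℕ → ℝ → ℝ≥0∞ := fun n t => ∑ k ∈ Finset.range n, ∫⁻ x, q (t - x.time)
        * f (t - x.time, Real.exp (-x.rate) * c, x.act d) ∂(affPow κ k) with ha
  set B : ℕ → ℝ → ℝ≥0∞ := fun n t =>
    ∫⁻ x, renewalFn F (G x.shift) (t - x.time) ∂(affPow κ n) with hB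
  set W := oscillation C c d with hW
  set E : ℕ → ℝ → ℝ≥0∞ := fun n t => ∫⁻ ω, tailSum κ t ω * W n ω ∂(seqLaw κ) with hE
  have hactm : Measurable fun x : Aff => x.act d :=
    Aff.measurable_act.comp (measurable_id.prodMk measurable_const)
  have hterm : ∀ t, Measurable fun x : Aff =>
      q (t - x.time) * f (t - x.time, Real.exp (-x.rate) * c, x.act d) := fun t => by fun_prop
  -- The convolution powers are realised on one sequence of independent factors, multiplied to the
  -- right, so that from index `n` on the first `n` factors are common to all terms.
  have hsplit : ∀ n t, A t = a n t + ∑' r, ∫⁻ ω, q (t - (blockProd 0 (n + r) ω).time)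
        * f (t - (blockProd 0 (n + r) ω).time, Real.exp (-(blockProd 0 (n + r) ω).rate) * c,
          (blockProd 0 (n + r) ω).act d) ∂(seqLaw κ) := fun n t => by
    rw [hA, ha]
    simp only
    rw [← Summable.sum_add_tsum_nat_add' (k := n) ENNReal.summable]
    congr 1
    refine tsum_congr fun r => ?_
    rw [add_comm r n, ← lintegral_blockProd κ (hterm t) 0 (n + r)]
  -- With the perpetuity frozen at its value after the first `n` factors, the sum over the later
  -- factors is an ordinary renewal function, started at the independent time `x.time`.
  have hBeq : ∀ n t, B n t = ∑' r, ∫⁻ ω, G (blockProd 0 n ω).shift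
      (t - (blockProd 0 (n + r) ω).time) ∂(seqLaw κ) := fun n t => by
    have e1 : ∀ r, ∫⁻ ω, G (blockProd 0 n ω).shift (t - (blockProd 0 (n + r) ω).time) ∂(seqLaw κ)
        = ∫⁻ x, ∫⁻ y, G x.shift (t - x.time - y.time) ∂(affPow κ r) ∂(affPow κ n) := fun r => by
      rw [← lintegral_blockProd_pair κ (H := fun p => G p.1.shift (t - p.1.time - p.2.time))
        (hGm.comp (f := fun p : Aff × Aff => (p.1.shift, t - p.1.time - p.2.time)) (by fun_prop))]
      refine lintegral_congr fun ω => ?_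
      rw [blockProd_add, Aff.time_mul, sub_sub]
    simp only [e1]
    rw [← lintegral_tsum fun r => (Measurable.lintegral_prod_right'
      (f := fun p : Aff × Aff => G p.1.shift (t - p.1.time - p.2.time)) (hGm.comp
        (f := fun p : Aff × Aff => (p.1.shift, t - p.1.time - p.2.time))
        (by fun_prop))).aemeasurable]
    refine lintegral_congr fun x => ?_
    exact (tsum_lintegral_time_affPow κ (g := G x.shift) (by fun_prop) (t - x.time)).symm
  have hWr : ∀ n r ω, min 1 (C * ENNReal.ofReal (|Real.exp (-(blockProd 0 (n + r) ω).rate) * c|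
      + |(blockProd 0 (n + r) ω).act d - (blockProd 0 n ω).shift|)) ≤ W n ω := fun n r ω =>
    le_iSup (fun r : ℕ => min 1 (C * ENNReal.ofReal
      (|Real.exp (-(blockProd 0 (n + r) ω).rate) * c|
        + |(blockProd 0 (n + r) ω).act d - (blockProd 0 n ω).shift|))) r
  have hWm : ∀ n, Measurable (W n) := measurable_oscillation C c d
  have hcomp : ∀ u v X w : ℝ≥0∞, u ≤ v + X → u ≤ 1 → min 1 X ≤ w → u ≤ v + w :=
    fun u v X w h1 h2 h3 => by
      rcases le_total 1 X with hX | hX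
      · exact h2.trans (((min_eq_left hX).symm.le.trans h3).trans le_add_self)
      · exact h1.trans (by gcongr; exact (min_eq_right hX).symm.le.trans h3)
  have hsumE : ∀ n t, ∑' r, ∫⁻ ω, q (t - (blockProd 0 (n + r) ω).time) * W n ω ∂(seqLaw κ)
      ≤ E n t := fun n t => by
    rw [← lintegral_tsum fun r => Measurable.aemeasurable (by have := hWm n; fun_prop)]
    refine lintegral_mono fun ω => ?_
    simp only
    have e1 := Summable.sum_add_tsum_nat_add' (k := n)
      (f := fun k => tailFn F (t - (blockProd 0 k ω).time)) ENNReal.summable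
    rw [ENNReal.tsum_mul_right, tailSum, ← e1]
    gcongr
    refine le_trans ?_ le_add_self
    exact ENNReal.tsum_le_tsum fun r => by rw [add_comm r n]; exact hqle _
  have hGω : ∀ n r t, Measurable fun ω : ℕ → Aff => G (blockProd 0 n ω).shift
      (t - (blockProd 0 (n + r) ω).time) := fun n r t =>
    hGm.comp (f := fun ω : ℕ → Aff => ((blockProd 0 n ω).shift,
      t - (blockProd 0 (n + r) ω).time)) (by fun_prop)
  have hAω : ∀ k t, Measurable fun ω : ℕ → Aff => q (t - (blockProd 0 k ω).time)
      * f (t - (blockProd 0 k ω).time, Real.exp (-(blockProd 0 k ω).rate) * c,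
          (blockProd 0 k ω).act d) := fun k t => (hterm t).comp (measurable_blockProd 0 k)
  -- Freezing the perpetuity and setting the discount to zero costs at most `W n` per term, by the
  -- Lipschitz bound on `f` and `f ≤ 1`; weighted by the tails, the total cost is `E n t`.
  have hupper : ∀ n t, A t ≤ a n t + (B n t + E n t) := fun n t => by
    rw [hsplit n t]
    gcongr
    refine le_trans ?_ (add_le_add_right (hsumE n t) _)
    rw [hBeq, ← ENNReal.tsum_add]
    refine ENNReal.tsum_le_tsum fun r => ?_
    rw [← lintegral_add_left (hGω n r t)]
    refine lintegral_mono fun ω => ?_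
    simp only [hG]
    rw [← mul_add]
    gcongr
    refine hcomp _ _ _ _ (hfL _ _ 0 _ _) (hf1 _) ?_
    rw [sub_zero]
    exact hWr n r ω
  have hlower : ∀ n t, B n t ≤ A t + E n t := fun n t => by
    rw [hsplit n t, add_assoc]
    refine le_trans ?_ le_add_self
    refine le_trans ?_ (add_le_add_right (hsumE n t) _)
    rw [hBeq, ← ENNReal.tsum_add]
    refine ENNReal.tsum_le_tsum fun r => ?_
    rw [← lintegral_add_left (hAω (n + r) t)]
    refine lintegral_mono fun ω => ?_
    simp only [hG]
    rw [← mul_add]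
    gcongr
    refine hcomp _ _ _ _ (hfL _ _ (Real.exp (-(blockProd 0 (n + r) ω).rate) * c) _
      ((blockProd 0 (n + r) ω).act d)) (hf1 _) ?_
    rw [zero_sub, abs_neg, abs_sub_comm]
    exact hWr n r ω
  have hm0 : m ≠ 0 := lintegral_tailFn_ne_zero hF
  have hdiv : ∀ v, hh v / m ≤ 1 := fun v => ENNReal.div_le_of_le_mul (by simpa using hhle v)
  have halim : ∀ n, Tendsto (a n) atTop (𝓝 0) := fun n => by
    have e1 : ∀ k, Tendsto (fun t => ∫⁻ x, q (t - x.time)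
        * f (t - x.time, Real.exp (-x.rate) * c, x.act d) ∂(affPow κ k)) atTop (𝓝 0) := fun k => by
      refine tendsto_of_tendsto_of_tendsto_of_le_of_le tendsto_const_nhds
        (tendsto_lintegral_sub_atTop hq hqle (convPow F k)) (fun _ => zero_le) fun t => ?_
      rw [← lintegral_time_affPow κ (g := fun s => q (t - s)) (by fun_prop)]
      exact lintegral_mono fun x => mul_le_of_le_one_right' (hf1 _)
    simpa using tendsto_finsetSum (Finset.range n) fun k _ => e1 k
  set L : ℕ → ℝ≥0∞ := fun n => ∫⁻ x, hh x.shift / m ∂(affPow κ n) with hL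
  have hBlim : ∀ n, Tendsto (B n) atTop (𝓝 (L n)) := fun n => by
    refine tendsto_lintegral_filter_of_dominated_convergence (fun _ => 1)
      (Eventually.of_forall fun t => ?_) (Eventually.of_forall fun t =>
        Eventually.of_forall fun x => renewalFn_le_one hF (hGle _) _) (by simp)
      (Eventually.of_forall fun x => ?_)
    · exact Measurable.lintegral_prod_right' (ν := renewalMeasure F)
        (f := fun p : Aff × ℝ => G p.1.shift (t - p.1.time - p.2)) (hGm.comp
          (f := fun p : Aff × ℝ => (p.1.shift, t - p.1.time - p.2)) (by fun_prop))
    · have e1 : Tendsto (fun t : ℝ => t - x.time) atTop atTop :=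
        tendsto_atTop_add_const_right _ _ tendsto_id
      exact (tendsto_renewalFn hF hac hm (g := G x.shift) (by fun_prop) (hGle _)).comp e1
  set L' : ℝ≥0∞ := (∫⁻ v, hh v ∂(perpetuityLaw κ)) / m with hL'
  have hL'eq : L' = ∫⁻ ω, hh (perpetuitySum ω) / m ∂(seqLaw κ) := by
    rw [hL', perpetuityLaw, lintegral_map' hhm.aemeasurable h.aemeasurable_perpetuitySum]
    simp only [div_eq_mul_inv]
    rw [lintegral_mul_const'' (f := fun ω => hh (perpetuitySum ω)) _ (hhm.comp_aemeasurable h.aemeasurable_perpetuitySum)]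
  -- The Lipschitz bound survives integration over `x`, because `q` is dominated by a tail with
  -- finite integral.
  have hhcont : ∀ (u : ℕ → ℝ) (v : ℝ), Tendsto u atTop (𝓝 v) →
      Tendsto (fun n => hh (u n)) atTop (𝓝 (hh v)) := fun u v huv => by
    have e1 : ∀ v v', hh v ≤ hh v' + C * ENNReal.ofReal |v - v'| * m := fun v v' => by
      rw [hmdef, ← lintegral_const_mul _ (by fun_prop),
        ← lintegral_add_left (f := G v') (by fun_prop)]
      refine lintegral_mono fun x => ?_
      calc G v x ≤ q x * (f (x, 0, v') + C * ENNReal.ofReal |v - v'|) := by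
            simp only [hG]
            gcongr
            simpa using hfL x 0 0 v v'
        _ = G v' x + C * ENNReal.ofReal |v - v'| * q x := by rw [mul_add, mul_comm (q x) (_ * _)]
        _ ≤ _ := by gcongr; exact hqle x
    refine tendsto_of_le_add_of_le_add (ne_top_of_le_ne_top hm (hhle v))
      (fun n => e1 (u n) v) (fun n => ?_) ?_
    · rw [abs_sub_comm]; exact e1 v (u n)
    · have e2 : Tendsto (fun n => ENNReal.ofReal |u n - v|) atTop (𝓝 0) := by
        simpa using ENNReal.tendsto_ofReal (huv.sub_const v).abs
      have e3 := ENNReal.Tendsto.mul_const (ENNReal.Tendsto.const_mul e2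
        (Or.inr (ENNReal.coe_ne_top (r := C)))) (Or.inr hm)
      simpa using e3
  have hLlim : Tendsto L atTop (𝓝 L') := by
    have e1 : ∀ n, L n = ∫⁻ ω, hh (blockProd 0 n ω).shift / m ∂(seqLaw κ) := fun n =>
      (lintegral_blockProd κ (H := fun x => hh x.shift / m) (by fun_prop) 0 n).symm
    rw [show L = fun n => ∫⁻ ω, hh (blockProd 0 n ω).shift / m ∂(seqLaw κ) from funext e1, hL'eq]
    refine tendsto_lintegral_of_dominated_convergence (fun _ => 1) (fun n => by fun_prop)
      (fun n => Eventually.of_forall fun ω => hdiv _) (by simp) ?_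
    filter_upwards [h.ae_tendsto] with ω hω
    exact ENNReal.Tendsto.div_const (hhcont _ _ hω.2) (Or.inr hm0)
  have hL'fin : L' ≠ ∞ := by
    rw [hL'eq]
    refine ne_top_of_le_ne_top ENNReal.one_ne_top ((lintegral_mono fun ω => hdiv _).trans ?_)
    simp
  have hLfin : ∀ n, L n ≠ ∞ := fun n =>
    ne_top_of_le_ne_top ENNReal.one_ne_top ((lintegral_mono fun x => hdiv _).trans (by simp))
  change Tendsto A atTop (𝓝 L')
  rw [ENNReal.tendsto_nhds hL'fin]
  intro ε hε
  set δ := ε / 4 with hδ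
  have hδ0 : 0 < δ := ENNReal.div_pos hε.ne' (by simp)
  have h4 : δ + δ + δ + δ = ε := by
    have : δ + δ + δ + δ = δ * 4 := by ring
    rw [this, hδ, ENNReal.div_mul_cancel (by simp) (by simp)]
  -- The truncation `n` is fixed first, with an error bound valid for all `t`; only then does `t` go
  -- to infinity.
  obtain ⟨n, hn1, hn2⟩ := (((ENNReal.tendsto_nhds hL'fin).1 hLlim δ hδ0).and
    (eventually_lintegral_tailSum_mul_le hF hWm (oscillation_le_one C c d)
      (h.tendsto_lintegral_oscillation C c d) hδ0)).exists
  filter_upwards [(ENNReal.tendsto_nhds (hLfin n)).1 (hBlim n) δ hδ0,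
    ENNReal.tendsto_nhds_zero.1 (halim n) δ hδ0] with t ht1 ht2
  constructor
  · rw [tsub_le_iff_right, ← h4]
    calc L' ≤ L n + δ := tsub_le_iff_right.1 hn1.1
      _ ≤ B n t + δ + δ := by gcongr; exact tsub_le_iff_right.1 ht1.1
      _ ≤ A t + E n t + δ + δ := by gcongr; exact hlower n t
      _ ≤ A t + δ + δ + δ := by gcongr; exact hn2 t
      _ = A t + (δ + δ + δ) := by ring
      _ ≤ A t + (δ + δ + δ + δ) := by gcongr; exact le_self_add
  · rw [← h4]
    calc A t ≤ a n t + (B n t + E n t) := hupper n t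
      _ ≤ δ + (L n + δ + δ) := by gcongr; exacts [ht1.2, hn2 t]
      _ ≤ δ + (L' + δ + δ + δ) := by gcongr; exact hn1.2
      _ = _ := by ring

end AffineRenewal

/-! ### The embedded chain: hitting probabilities and occupation measures -/

section EmbeddedChain

variable {S : Type*} (P : S → PMF S) (j : S)

open Classical in
/-- The mass vector of the chain killed on leaving `j`, after `m` steps from the vector `d`. -/
def tabooVec (d : S → ℝ≥0∞) : ℕ → S → ℝ≥0∞
  | 0 => d
  | m + 1 => fun k => ∑' l, if l = j then 0 else tabooVec d m l * P l k

open Classical in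
theorem firstPassage_add_two (n : ℕ) (i : S) :
    firstPassage P j (n + 2) i = ∑' k, if k = j then 0 else P i k * firstPassage P j (n + 1) k :=
  rfl

-- The Chapman–Kolmogorov relation for the chain killed at `j`. `tabooVec` is built from its last
-- step and `firstPassage` from its first; the induction moves one step at a time from one to the
-- other.
open Classical in
theorem tsum_tabooVec_mul_firstPassage (d : S → ℝ≥0∞) (r m : ℕ) :
    ∑' l, (if l = j then 0 else tabooVec P j d m l * firstPassage P j (r + 1) l)
      = tabooVec P j d (m + r + 1) j := by
  induction r generalizing m with
  | zero => rfl
  | succ r ih =>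
    have h := ih (m + 1)
    rw [show m + (r + 1) + 1 = m + 1 + r + 1 by ring, ← h]
    have h1 : ∀ l, (if l = j then 0 else tabooVec P j d m l * firstPassage P j (r + 1 + 1) l)
        = ∑' k, if k = j then 0 else (if l = j then 0 else tabooVec P j d m l * P l k)
          * firstPassage P j (r + 1) k := fun l => by
      split_ifs with hl
      · simp
      · rw [firstPassage_add_two, ← ENNReal.tsum_mul_left]
        refine tsum_congr fun k => ?_
        split_ifs <;> simp [mul_assoc]
    simp only [h1]
    rw [ENNReal.tsum_comm]
    refine tsum_congr fun k => ?_
    by_cases hk : k = j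
    · simp [hk]
    · simp only [hk, if_false]
      rw [ENNReal.tsum_mul_right]
      rfl

-- Mass at `j` is present initially or arrives there for the first time later; each initial state
-- contributes its hitting probability.
open Classical in
theorem tsum_tabooVec_eq_tsum_firstPassage (d : S → ℝ≥0∞) :
    ∑' m, tabooVec P j d m j
      = d j + ∑' l, if l = j then 0 else d l * ∑' n, firstPassage P j n l := by
  rw [tsum_eq_zero_add' ENNReal.summable]
  congr 1
  have h1 : ∀ m, tabooVec P j d (m + 1) j
      = ∑' l, if l = j then 0 else d l * firstPassage P j (m + 1) l := fun m => by
    have := tsum_tabooVec_mul_firstPassage P j d m 0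
    rw [zero_add] at this
    rw [← this]
    rfl
  simp only [h1]
  rw [ENNReal.tsum_comm]
  refine tsum_congr fun l => ?_
  split_ifs with hl
  · simp
  · rw [ENNReal.tsum_mul_left, tsum_eq_zero_add' (f := fun n => firstPassage P j n l)
      ENNReal.summable]
    simp [firstPassage]

open Classical in
theorem tsum_firstPassage_eq (i : S) :
    ∑' n, firstPassage P j n i
      = P i j + ∑' k, if k = j then 0 else P i k * ∑' n, firstPassage P j n k := by
  rw [← tsum_tabooVec_eq_tsum_firstPassage]
  have h1 : ∀ m, tabooVec P j (P i) m j = firstPassage P j (m + 1) i := fun m => by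
    cases m with
    | zero => rfl
    | succ m =>
      have := tsum_tabooVec_mul_firstPassage P j (P i) m 0
      rw [zero_add] at this
      rw [← this]
      rfl
  simp only [h1]
  rw [tsum_eq_zero_add' ENNReal.summable]
  simp [firstPassage]

/-- The mass arriving at `j` from the row `P j` is the return probability, by the first-step
equation. Consequently `occupation P j j = 1` and cycle laws have mass one. -/
theorem tsum_tabooVec_self_of_recurrent (h : ∑' n, firstPassage P j n j = 1) :
    ∑' m, tabooVec P j (P j) m j = 1 := by
  classical
  rw [tsum_tabooVec_eq_tsum_firstPassage, ← tsum_firstPassage_eq, h]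

open Classical in
theorem tsum_ite_add (f : S → ℝ≥0∞) : f j + ∑' k, (if k = j then 0 else f k) = ∑' k, f k :=
  (Summable.tsum_eq_add_tsum_ite' j ENNReal.summable).symm

theorem tsum_firstPassage_le_one (i : S) : ∑' n, firstPassage P j n i ≤ 1 := by
  classical
  refine ENNReal.tsum_le_of_sum_range_le fun N => ?_
  have h1 : ∀ N i, ∑ n ∈ Finset.range N, firstPassage P j (n + 1) i ≤ 1 := by
    intro N
    induction N with
    | zero => simp
    | succ N ih =>
      intro i
      rw [Finset.sum_range_succ']
      have e : ∑ n ∈ Finset.range N, firstPassage P j (n + 1 + 1) i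
          = ∑' k, if k = j then 0 else P i k * ∑ n ∈ Finset.range N, firstPassage P j (n + 1) k := by
        simp only [firstPassage_add_two]
        rw [← Summable.tsum_finsetSum fun _ _ => ENNReal.summable]
        refine tsum_congr fun k => ?_
        split_ifs <;> simp [Finset.mul_sum]
      rw [e, add_comm, ← (P i).tsum_coe, ← tsum_ite_add j fun k => P i k]
      refine add_le_add le_rfl (ENNReal.tsum_le_tsum fun k => ?_)
      split_ifs
      · exact le_rfl
      · exact mul_le_of_le_one_right' (ih k)
  cases N with
  | zero => simp
  | succ N =>
    rw [Finset.sum_range_succ']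
    simpa [firstPassage] using h1 N i

variable {P j}

theorem nStep_succ_ne_zero {n : ℕ} {i k : S} (h : nStep P (n + 1) i k ≠ 0) :
    ∃ l, P i l ≠ 0 ∧ nStep P n l k ≠ 0 := by
  by_contra! hc
  refine h ?_
  change ((P i).bind (nStep P n)) k = 0
  rw [PMF.bind_apply, ENNReal.tsum_eq_zero]
  intro l
  by_cases hl : P i l = 0
  · simp [hl]
  · simp [hc l hl]

theorem nStep_zero_ne_zero {i k : S} (h : nStep P 0 i k ≠ 0) : k = i := by
  classical
  by_contra hc
  exact h (by simp [nStep, hc])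

/-- In an irreducible recurrent chain every state is hit from everywhere. -/
theorem tsum_firstPassage_eq_one (hirr : IrreducibleChain P)
    (h : ∑' n, firstPassage P j n j = 1) (i : S) : ∑' n, firstPassage P j n i = 1 := by
  classical
  -- The hitting probability is at most one and is averaged by the first-step equation. If it equals
  -- one at `i`, no successor of `i` can have a smaller value.
  have hstep : ∀ i k, ∑' n, firstPassage P j n i = 1 → P i k ≠ 0 →
      ∑' n, firstPassage P j n k = 1 := by
    intro i k hi hk
    rcases eq_or_ne k j with rfl | hkj
    · exact h
    refine le_antisymm (tsum_firstPassage_le_one P j k) (not_lt.1 fun hlt => ?_)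
    rw [tsum_firstPassage_eq, ← (P i).tsum_coe, ← tsum_ite_add j fun k => P i k] at hi
    have hfin : ∑' k, (if k = j then 0 else P i k * ∑' n, firstPassage P j n k) ≠ ∞ := by
      refine ne_top_of_le_ne_top ((P i).tsum_coe_ne_top) (ENNReal.tsum_le_tsum fun k => ?_)
      split_ifs
      · exact zero_le
      · exact mul_le_of_le_one_right' (tsum_firstPassage_le_one P j k)
    have := ENNReal.tsum_lt_tsum (i := k) hfin (g := fun k => if k = j then 0 else P i k)
      (fun k => by
        split_ifs
        · exact le_rfl
        · exact mul_le_of_le_one_right' (tsum_firstPassage_le_one P j k)) (by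
        simp only [hkj, if_false]
        calc P i k * ∑' n, firstPassage P j n k < P i k * 1 :=
              ENNReal.mul_lt_mul_right hk ((P i).apply_ne_top k) hlt
          _ = P i k := mul_one _)
    exact absurd hi (ENNReal.add_lt_add_left ((P i).apply_ne_top j) this).ne
  obtain ⟨n, hn⟩ := hirr j i
  have hpath : ∀ n k, nStep P n k i ≠ 0 → ∑' n, firstPassage P j n k = 1 →
      ∑' n, firstPassage P j n i = 1 := by
    intro n
    induction n with
    | zero => intro k hk h1; rw [nStep_zero_ne_zero hk]; exact h1
    | succ n ih =>
      intro k hk h1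
      obtain ⟨l, hl, hl'⟩ := nStep_succ_ne_zero hk
      exact ih l hl' (hstep k l h1 hl)
  exact hpath n j hn h

theorem StationaryDistribution.apply_eq {μ : PMF S} (hμ : StationaryDistribution P μ) (k : S) :
    μ k = ∑' l, μ l * P l k := by
  conv_lhs => rw [← show μ.bind P = μ from hμ]
  rw [PMF.bind_apply]

/-- Positive mass is carried along every possible transition, and by irreducibility some path leads
from the support to `j`. -/
theorem StationaryDistribution.apply_ne_zero {μ : PMF S} (hμ : StationaryDistribution P μ)
    (hirr : IrreducibleChain P) (j : S) : μ j ≠ 0 := by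
  obtain ⟨k, hk⟩ := μ.support_nonempty
  obtain ⟨n, hn⟩ := hirr k j
  have hpath : ∀ n k, nStep P n k j ≠ 0 → μ k ≠ 0 → μ j ≠ 0 := by
    intro n
    induction n with
    | zero => intro k hk h1; rw [nStep_zero_ne_zero hk]; exact h1
    | succ n ih =>
      intro k hk h1
      obtain ⟨l, hl, hl'⟩ := nStep_succ_ne_zero hk
      refine ih l hl' fun h0 => ?_
      rw [hμ.apply_eq, ENNReal.tsum_eq_zero] at h0
      exact mul_ne_zero h1 hl (h0 k)
  exact hpath n k hn ((PMF.mem_support_iff _ _).1 hk)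

variable (P j) in
/-- The expected number of visits to `k` during a cycle at `j`. -/
def occupation (k : S) : ℝ≥0∞ := ∑' m, tabooVec P j (P j) m k

open Classical in
theorem occupation_eq (k : S) :
    occupation P j k = P j k + ∑' l, if l = j then 0 else occupation P j l * P l k := by
  rw [occupation, tsum_eq_zero_add' ENNReal.summable]
  congr 1
  simp only [tabooVec]
  rw [ENNReal.tsum_comm]
  refine tsum_congr fun l => ?_
  split_ifs
  · simp
  · rw [ENNReal.tsum_mul_right]; rfl

/-- The taboo recursion restarts with the row `P j` where invariance needs the term of `j`; they
agree because a cycle visits `j` exactly once. -/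
theorem occupation_invariant (h : ∑' n, firstPassage P j n j = 1) (k : S) :
    occupation P j k = ∑' l, occupation P j l * P l k := by
  classical
  rw [← tsum_ite_add j fun l => occupation P j l * P l k, occupation_eq]
  congr 1
  rw [show occupation P j j = 1 from tsum_tabooVec_self_of_recurrent P j h, one_mul]

/-- Iterating `μ = μ P` and expanding only the mass away from `j` produces the partial sums of the
occupation measure, plus a nonnegative remainder. -/
theorem StationaryDistribution.mul_occupation_le {μ : PMF S} (hμ : StationaryDistribution P μ)
    (k : S) : μ j * occupation P j k ≤ μ k := by
  classical
  have h1 : ∀ N k, μ j * ∑ m ∈ Finset.range N, tabooVec P j (P j) m k ≤ μ k := by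
    intro N
    induction N with
    | zero => simp
    | succ N ih =>
      intro k
      rw [Finset.sum_range_succ']
      have e : ∑ m ∈ Finset.range N, tabooVec P j (P j) (m + 1) k
          = ∑' l, if l = j then 0
            else (∑ m ∈ Finset.range N, tabooVec P j (P j) m l) * P l k := by
        simp only [tabooVec]
        rw [← Summable.tsum_finsetSum fun _ _ => ENNReal.summable]
        refine tsum_congr fun l => ?_
        split_ifs <;> simp [Finset.sum_mul]
      rw [e, add_comm, mul_add, hμ.apply_eq k, ← tsum_ite_add j fun l => μ l * P l k]
      refine add_le_add le_rfl ?_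
      rw [← ENNReal.tsum_mul_left]
      refine ENNReal.tsum_le_tsum fun l => ?_
      split_ifs
      · simp
      · rw [← mul_assoc]; gcongr; exact ih l
  rw [occupation, ENNReal.tsum_eq_iSup_nat, ENNReal.mul_iSup]
  exact iSup_le fun N => h1 N k

/-- The stationary distribution is proportional to the occupation measure of a cycle. -/
theorem StationaryDistribution.eq_mul_occupation {μ : PMF S} (hμ : StationaryDistribution P μ)
    (hirr : IrreducibleChain P) (h : ∑' n, firstPassage P j n j = 1) (k : S) :
    μ k = μ j * occupation P j k := by
  set δ : S → ℝ≥0∞ := fun k => μ k - μ j * occupation P j k with hδ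
  have hsum : ∀ k, μ k = μ j * occupation P j k + δ k := fun k =>
    (add_tsub_cancel_of_le (hμ.mul_occupation_le k)).symm
  have hfin : ∀ k, μ j * occupation P j k ≠ ∞ := fun k =>
    ne_top_of_le_ne_top (μ.apply_ne_top k) (hμ.mul_occupation_le k)
  have hinv : ∀ k, δ k = ∑' l, δ l * P l k := fun k => by
    have e1 : μ j * occupation P j k + δ k
        = μ j * occupation P j k + ∑' l, δ l * P l k := by
      rw [← hsum, hμ.apply_eq k, occupation_invariant h, ← ENNReal.tsum_mul_left,
        ← ENNReal.tsum_add]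
      refine tsum_congr fun l => ?_
      rw [hsum l, add_mul, mul_assoc]
    exact (ENNReal.add_right_inj (hfin k)).1 e1
  have hj : δ j = 0 := by
    simp only [hδ]
    rw [show occupation P j j = 1 from tsum_tabooVec_self_of_recurrent P j h, mul_one, tsub_self]
  -- The defect `δ` is a nonnegative invariant vector that vanishes at `j`; hence it vanishes at
  -- every state from which `j` can be reached.
  have hpath : ∀ n k, nStep P n k j ≠ 0 → δ k = 0 := by
    intro n
    induction n with
    | zero => intro k hk; rw [← nStep_zero_ne_zero hk]; exact hj
    | succ n ih =>
      intro k hk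
      obtain ⟨l, hl, hl'⟩ := nStep_succ_ne_zero hk
      have h0 := ih l hl'
      rw [hinv, ENNReal.tsum_eq_zero] at h0
      exact (mul_eq_zero.1 (h0 k)).resolve_right hl
  obtain ⟨n, hn⟩ := hirr k j
  conv_lhs => rw [hsum k, hpath n k hn, add_zero]

end EmbeddedChain

/-! ### The Markov property along the path -/

section MarkovProperty

variable {S : Type*} [MeasurableSpace S] {Ω : Type*}

/-- The σ-algebra generated by the first `n + 1` states and sojourn times. -/
@[reducible] def history (J : ℕ → Ω → S) (T : ℕ → Ω → ℝ) (n : ℕ) : MeasurableSpace Ω :=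
  MeasurableSpace.comap (fun ω (k : Fin (n + 1)) => (J k ω, T k ω)) inferInstance

section History

variable {J : ℕ → Ω → S} {T : ℕ → Ω → ℝ}

theorem measurable_history_J {k n : ℕ} (hk : k ≤ n) : Measurable[history J T n] (J k) := by
  have h1 : Measurable fun x : Fin (n + 1) → S × ℝ => (x ⟨k, by omega⟩).1 :=
    measurable_fst.comp (measurable_pi_apply _)
  exact h1.comp (comap_measurable _)

theorem measurable_history_T {k n : ℕ} (hk : k ≤ n) : Measurable[history J T n] (T k) := by
  have h1 : Measurable fun x : Fin (n + 1) → S × ℝ => (x ⟨k, by omega⟩).2 :=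
    measurable_snd.comp (measurable_pi_apply _)
  exact h1.comp (comap_measurable _)

theorem history_mono {n m : ℕ} (hnm : n ≤ m) : history J T n ≤ history J T m := by
  have h1 : Measurable[history J T m] fun ω (k : Fin (n + 1)) => (J k ω, T k ω) :=
    @measurable_pi_lambda _ _ _ (history J T m) _ _ fun k =>
      have hk : (k : ℕ) ≤ m := by omega
      (measurable_history_J (J := J) (T := T) hk).prodMk (measurable_history_T (J := J) (T := T) hk)
  rintro _ ⟨B, hB, rfl⟩
  exact h1 hB

theorem measurableSet_history_J [DiscreteMeasurableSpace S] {k n : ℕ} (hk : k ≤ n) (l : S) :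
    MeasurableSet[history J T n] {ω | J k ω = l} :=
  measurable_history_J (T := T) hk (MeasurableSet.singleton l)

end History

variable [MeasurableSpace Ω]

/-- The sub-probability law of a sojourn at `l` followed by a jump to `k`. -/
def jumpLaw (P : S → PMF S) (F : S → S → Measure ℝ) (l k : S) : Measure ℝ := P l k • F l k

variable {P : S → PMF S} {F : S → S → Measure ℝ} {p : PMF S} {Pr : Measure Ω}
  {J : ℕ → Ω → S} {T : ℕ → Ω → ℝ}

theorem IsMarkovRenewal.history_le (h : IsMarkovRenewal P F p Pr J T) (n : ℕ) :
    history J T n ≤ ‹MeasurableSpace Ω› := by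
  rintro _ ⟨B, hB, rfl⟩
  have h1 : Measurable fun ω (k : Fin (n + 1)) => (J k ω, T k ω) :=
    measurable_pi_lambda _ fun k => (h.measurable_J k).prodMk (h.measurable_T k)
  exact h1 hB

variable [IsProbabilityMeasure Pr] [∀ l k, IsFiniteMeasure (jumpLaw P F l k)]

/-- The transition rule gives the two finite measures the same values on left half lines, and these
determine a finite measure. -/
theorem IsMarkovRenewal.map_restrict_T (h : IsMarkovRenewal P F p Pr J T) {n : ℕ} {E : Set Ω}
    (hE : MeasurableSet[history J T n] E) (l k : S) :
    (Pr.restrict (E ∩ {ω | J n ω = l} ∩ {ω | J (n + 1) ω = k})).map (T (n + 1))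
      = Pr (E ∩ {ω | J n ω = l}) • jumpLaw P F l k := by
  have : IsFiniteMeasure (Pr (E ∩ {ω | J n ω = l}) • jumpLaw P F l k) :=
    Measure.smul_finite _ (measure_ne_top _ _)
  refine Measure.ext_of_Iic _ _ fun t => ?_
  obtain ⟨B, hB, rfl⟩ := hE
  have hm := h.measurable_T (n + 1)
  rw [Measure.map_apply hm measurableSet_Iic, Measure.restrict_apply (hm measurableSet_Iic),
    Measure.smul_apply, jumpLaw, Measure.smul_apply, smul_eq_mul, smul_eq_mul]
  refine Eq.trans ?_ (h.transition n l k t B hB)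
  congr 1
  ext ω
  simp only [mem_inter_iff, mem_preimage, mem_Iic, mem_ofPred_eq]
  tauto

/-- The **Markov property**: the law of the next sojourn time, jointly with the past. -/
theorem IsMarkovRenewal.map_restrict_prodMk (h : IsMarkovRenewal P F p Pr J T) {n : ℕ}
    {E : Set Ω} (hE : MeasurableSet[history J T n] E) {α : Type*} [MeasurableSpace α]
    {y : Ω → α} (hy : Measurable[history J T n] y) (l k : S) :
    (Pr.restrict (E ∩ {ω | J n ω = l} ∩ {ω | J (n + 1) ω = k})).map (fun ω => (y ω, T (n + 1) ω))
      = ((Pr.restrict (E ∩ {ω | J n ω = l})).map y).prod (jumpLaw P F l k) := by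
  symm
  have hle := h.history_le n
  have hym : Measurable y := hy.mono hle le_rfl
  have hTm := h.measurable_T (n + 1)
  refine Measure.prod_eq fun s t hs ht => ?_
  have hE' : MeasurableSet[history J T n] (y ⁻¹' s ∩ E) :=
    @MeasurableSet.inter _ (history J T n) _ _ (hy hs) hE
  have h1 := h.map_restrict_T hE' l k
  have h2 := congrArg (fun μ => μ t) h1
  simp only [Measure.smul_apply, smul_eq_mul] at h2
  rw [Measure.map_apply hym hs, Measure.restrict_apply (hym hs), ← inter_assoc, ← h2,
    Measure.map_apply (hym.prodMk hTm) (hs.prod ht), Measure.map_apply hTm ht,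
    Measure.restrict_apply (hTm ht), Measure.restrict_apply ((hym.prodMk hTm) (hs.prod ht))]
  congr 1
  ext ω
  simp only [mem_inter_iff, mem_preimage, mem_ofPred_eq, mem_prod]
  tauto

theorem IsMarkovRenewal.measure_inter_J (h : IsMarkovRenewal P F p Pr J T) {n : ℕ}
    {E : Set Ω} (hE : MeasurableSet[history J T n] E) (l k : S) :
    Pr (E ∩ {ω | J n ω = l} ∩ {ω | J (n + 1) ω = k})
      = Pr (E ∩ {ω | J n ω = l}) * jumpLaw P F l k univ := by
  have h1 := congrArg (fun μ => μ univ) (h.map_restrict_T hE l k)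
  simpa [Measure.map_apply (h.measurable_T (n + 1)) MeasurableSet.univ] using h1

end MarkovProperty

/-! ### Sojourns as elements of `Aff` and their composition along a path. -/

section AffineWalk

/-- The integral `∫_0^x exp (-a (x - s)) ds`. -/
def expInt (a x : ℝ) : ℝ := ∫ s in (0 : ℝ)..x, Real.exp (-a * (x - s))

theorem continuous_expInt (a : ℝ) : Continuous (expInt a) := by
  have h : expInt a = fun x => Real.exp (-a * x) * ∫ s in (0 : ℝ)..x, Real.exp (a * s) := by
    funext x
    rw [expInt, ← intervalIntegral.integral_const_mul]
    refine intervalIntegral.integral_congr fun s _ => ?_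
    simp only [← Real.exp_add]
    congr 1; ring
  rw [h]
  have : Continuous fun x : ℝ => ∫ s in (0 : ℝ)..x, Real.exp (a * s) :=
    intervalIntegral.continuous_primitive
      (fun _ _ => (by fun_prop : Continuous fun s : ℝ => Real.exp (a * s)).intervalIntegrable _ _) 0
  fun_prop

variable {S : Type*} (a b : S → ℝ)

/-- The effect of a sojourn of length `t` at `l`. -/
def sojournMap (l : S) (t : ℝ) : Aff := Aff.mk t (a l * t) (b l * expInt (a l) t)

@[fun_prop]
theorem measurable_sojournMap (l : S) : Measurable (sojournMap a b l) :=
  Aff.measurable_mk measurable_id (by fun_prop)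
    ((continuous_expInt (a l)).measurable.const_mul (b l))

variable {Ω : Type*} (J : ℕ → Ω → S) (T : ℕ → Ω → ℝ)

/-- The composition of the sojourn maps of the steps `n, …, n + m - 1`. -/
def affWalk (n : ℕ) : ℕ → Ω → Aff
  | 0, _ => 1
  | m + 1, ω => sojournMap a b (J (n + m) ω) (T (n + m + 1) ω) * affWalk n m ω

theorem affWalk_add (n m : ℕ) (ω : Ω) :
    affWalk a b J T 0 (n + m) ω = affWalk a b J T n m ω * affWalk a b J T 0 n ω := by
  induction m with
  | zero => simp [affWalk]
  | succ m ih =>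
    rw [← add_assoc, affWalk, ih, affWalk, zero_add, mul_assoc]

variable [Countable S] [MeasurableSpace S] [DiscreteMeasurableSpace S]

theorem measurable_sojournMap_uncurry : Measurable fun q : S × ℝ => sojournMap a b q.1 q.2 :=
  measurable_from_prod_countable_right fun l => measurable_sojournMap a b l

theorem measurable_history_affWalk (n m : ℕ) :
    Measurable[history J T (n + m)] (affWalk a b J T n m) := by
  induction m with
  | zero => exact @measurable_const _ _ _ (history J T (n + 0)) _
  | succ m ih =>
    have hJ : Measurable[history J T (n + (m + 1))] (J (n + m)) :=
      measurable_history_J (by omega)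
    have hT : Measurable[history J T (n + (m + 1))] (T (n + m + 1)) :=
      measurable_history_T (by omega)
    have h1 : Measurable[history J T (n + (m + 1))]
        fun ω => sojournMap a b (J (n + m) ω) (T (n + m + 1) ω) :=
      (measurable_sojournMap_uncurry a b).comp (hJ.prodMk hT)
    exact h1.mul (ih.mono (history_mono (by omega)) le_rfl)

end AffineWalk

/-! ### The taboo convolution kernel -/

section SumMconv

variable {ι : Type*} [Countable ι]

theorem sum_mconv (μ : ι → Measure Aff) [∀ i, SFinite (μ i)] (ν : Measure Aff) [SFinite ν] :
    Measure.sum μ ∗ₘ ν = Measure.sum fun i => μ i ∗ₘ ν := by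
  refine Measure.ext_of_lintegral _ fun f hf => ?_
  rw [Measure.lintegral_mconv hf, lintegral_sum_measure, lintegral_sum_measure]
  exact tsum_congr fun i => (Measure.lintegral_mconv hf).symm

theorem mconv_sum (μ : Measure Aff) [SFinite μ] (ν : ι → Measure Aff) [∀ i, SFinite (ν i)] :
    μ ∗ₘ Measure.sum ν = Measure.sum fun i => μ ∗ₘ ν i := by
  refine Measure.ext_of_lintegral _ fun f hf => ?_
  rw [Measure.lintegral_mconv hf, lintegral_sum_measure]
  simp_rw [lintegral_sum_measure, Measure.lintegral_mconv hf]
  exact lintegral_tsum fun i =>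
    (Measurable.lintegral_prod_right' (f := fun p : Aff × Aff => f (p.1 * p.2))
      (by fun_prop)).aemeasurable

theorem mconv_apply_univ (μ ν : Measure Aff) [SFinite μ] [SFinite ν] :
    (μ ∗ₘ ν) univ = μ univ * ν univ := by
  rw [Measure.mconv, Measure.map_apply (by fun_prop) MeasurableSet.univ, preimage_univ,
    ← univ_prod_univ, Measure.prod_prod]

end SumMconv

/-! ### Laws of path segments that avoid a state. -/

section Kernel

variable {S : Type*} [Countable S]

/-- The law of the effect of a sojourn at `l` followed by a jump to `k`. -/
def stepMeas (P : S → PMF S) (F : S → S → Measure ℝ) (a b : S → ℝ) (l k : S) : Measure Aff :=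
  (jumpLaw P F l k).map (sojournMap a b l)

open Classical in
/-- The law of the composition of the first `m + 1` sojourn maps of the path started at `j`, on
the event that the path is at `k` after `m + 1` steps and not at `j` in between. -/
def tabooMeas (P : S → PMF S) (F : S → S → Measure ℝ) (a b : S → ℝ) (j : S) :
    ℕ → S → Measure Aff
  | 0 => stepMeas P F a b j
  | m + 1 => fun k => Measure.sum fun l =>
      if l = j then 0 else stepMeas P F a b l k ∗ₘ tabooMeas P F a b j m l

/-- The law of the composition of the sojourn maps of a cycle at `j`. -/
def cycleMeas (P : S → PMF S) (F : S → S → Measure ℝ) (a b : S → ℝ) (j : S) : Measure Aff :=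
  Measure.sum fun m => tabooMeas P F a b j m j

variable {P : S → PMF S} {F : S → S → Measure ℝ} {a b : S → ℝ}
  [∀ l k, IsFiniteMeasure (jumpLaw P F l k)]

instance (l k : S) : IsFiniteMeasure (stepMeas P F a b l k) := by
  unfold stepMeas; infer_instance

instance sFinite_tabooMeas (j : S) (m : ℕ) (k : S) : SFinite (tabooMeas P F a b j m k) := by
  induction m generalizing k with
  | zero => unfold tabooMeas; infer_instance
  | succ m ih =>
    unfold tabooMeas
    have : ∀ l, SFinite (open Classical in
        if l = j then (0 : Measure Aff) else stepMeas P F a b l k ∗ₘ tabooMeas P F a b j m l) := by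
      intro l
      split_ifs <;> infer_instance
    infer_instance

instance (j : S) : SFinite (cycleMeas P F a b j) := by
  unfold cycleMeas; infer_instance

theorem stepMeas_univ (h1 : ∀ l k, jumpLaw P F l k univ = P l k) (l k : S) :
    stepMeas P F a b l k univ = P l k := by
  rw [stepMeas, Measure.map_apply (by fun_prop) MeasurableSet.univ, preimage_univ, h1]

/-- Forgetting the affine maps leaves the embedded chain, so questions of total mass reduce to
recurrence. -/
theorem tabooMeas_univ (h1 : ∀ l k, jumpLaw P F l k univ = P l k) (j : S) (m : ℕ) (k : S) :
    tabooMeas P F a b j m k univ = tabooVec P j (P j) m k := by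
  induction m generalizing k with
  | zero => exact stepMeas_univ h1 j k
  | succ m ih =>
    rw [tabooMeas, tabooVec, Measure.sum_apply _ MeasurableSet.univ]
    refine tsum_congr fun l => ?_
    split_ifs
    · simp
    · rw [mconv_apply_univ, ih, stepMeas_univ h1, mul_comm]

theorem isProbabilityMeasure_cycleMeas (h1 : ∀ l k, jumpLaw P F l k univ = P l k) {j : S}
    (h : ∑' n, firstPassage P j n j = 1) : IsProbabilityMeasure (cycleMeas P F a b j) := by
  refine ⟨?_⟩
  rw [cycleMeas, Measure.sum_apply _ MeasurableSet.univ]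
  simp_rw [tabooMeas_univ h1]
  exact tsum_tabooVec_self_of_recurrent P j h

end Kernel

/-! ### The taboo kernel as the law of a segment of the path. -/

section Path

variable {S : Type*} [Countable S] [MeasurableSpace S] [DiscreteMeasurableSpace S]
  {Ω : Type*} [MeasurableSpace Ω] {P : S → PMF S} {F : S → S → Measure ℝ} {p : PMF S}
  {Pr : Measure Ω} [IsProbabilityMeasure Pr] {J : ℕ → Ω → S} {T : ℕ → Ω → ℝ} {a b : S → ℝ}
  [∀ l k, IsFiniteMeasure (jumpLaw P F l k)]

/-- Given the present state `l`, the next sojourn is independent of the past, so adding it is a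
convolution on the left. -/
theorem IsMarkovRenewal.map_restrict_mul (h : IsMarkovRenewal P F p Pr J T) {n : ℕ} {E : Set Ω}
    (hE : MeasurableSet[history J T n] E) {y : Ω → Aff} (hy : Measurable[history J T n] y)
    (l k : S) :
    (Pr.restrict (E ∩ {ω | J n ω = l} ∩ {ω | J (n + 1) ω = k})).map
        (fun ω => sojournMap a b (J n ω) (T (n + 1) ω) * y ω)
      = stepMeas P F a b l k ∗ₘ (Pr.restrict (E ∩ {ω | J n ω = l})).map y := by
  have hym : Measurable y := hy.mono (h.history_le n) le_rfl
  have hTm := h.measurable_T (n + 1)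
  have hset : MeasurableSet (E ∩ {ω | J n ω = l} ∩ {ω | J (n + 1) ω = k}) :=
    ((h.history_le n _ hE).inter (h.measurable_J n (MeasurableSet.singleton l))).inter
      (h.measurable_J (n + 1) (MeasurableSet.singleton k))
  have h1 : (Pr.restrict (E ∩ {ω | J n ω = l} ∩ {ω | J (n + 1) ω = k})).map
        (fun ω => sojournMap a b (J n ω) (T (n + 1) ω) * y ω)
      = (Pr.restrict (E ∩ {ω | J n ω = l} ∩ {ω | J (n + 1) ω = k})).map
        ((fun q : Aff × ℝ => sojournMap a b l q.2 * q.1) ∘ fun ω => (y ω, T (n + 1) ω)) := by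
    refine Measure.map_congr ?_
    filter_upwards [ae_restrict_mem hset] with ω hω
    simp only [Function.comp_apply, show J n ω = l from hω.1.2]
  rw [h1, ← Measure.map_map (by fun_prop) (hym.prodMk hTm), h.map_restrict_prodMk hE hy]
  refine Measure.ext_of_lintegral _ fun f hf => ?_
  rw [lintegral_map hf (by fun_prop), lintegral_prod_symm _ (by fun_prop),
    Measure.lintegral_mconv hf, stepMeas, lintegral_map
      (Measurable.lintegral_prod_right' (f := fun p : Aff × Aff => f (p.1 * p.2))
      (by fun_prop)) (by fun_prop)]

theorem sum_map_restrict_inter {X : Ω → S} (hX : Measurable X) {D : Set Ω} (hD : MeasurableSet D)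
    {α : Type*} [MeasurableSpace α] {f : Ω → α} (hf : Measurable f) :
    (Pr.restrict D).map f = Measure.sum fun l => (Pr.restrict (D ∩ {ω | X ω = l})).map f := by
  have h1 : Pr.restrict (⋃ l, D ∩ {ω | X ω = l})
      = Measure.sum fun l => Pr.restrict (D ∩ {ω | X ω = l}) :=
    Measure.restrict_iUnion
      (fun l k hlk => Set.disjoint_left.2 fun ω h1 h2 => hlk (h1.2.symm.trans h2.2))
      (fun l => hD.inter (hX (MeasurableSet.singleton l)))
  have h2 : ⋃ l, D ∩ {ω | X ω = l} = D := by ext ω; simp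
  rw [h2] at h1
  rw [h1, Measure.map_sum hf.aemeasurable]

/-- The event that the path is not at `j` at the times `n + 1, …, n + m`. -/
def avoids (J : ℕ → Ω → S) (j : S) (n m : ℕ) : Set Ω := {ω | ∀ i < m, J (n + 1 + i) ω ≠ j}

theorem avoids_succ (j : S) (n m : ℕ) :
    avoids J j n (m + 1) = avoids J j n m ∩ {ω | J (n + 1 + m) ω ≠ j} := by
  ext ω
  simp only [avoids, mem_ofPred_eq, mem_inter_iff]
  exact ⟨fun h => ⟨fun i hi => h i (by omega), h m (by omega)⟩, fun h i hi => by
    rcases Nat.lt_succ_iff_lt_or_eq.1 hi with h1 | rfl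
    exacts [h.1 i h1, h.2]⟩

theorem measurableSet_history_avoids (j : S) (n m : ℕ) :
    MeasurableSet[history J T (n + m)] (avoids J j n m) := by
  induction m with
  | zero =>
    have : avoids J j n 0 = univ := by ext; simp [avoids]
    rw [this]; exact @MeasurableSet.univ _ (history J T (n + 0))
  | succ m ih =>
    rw [avoids_succ]
    refine MeasurableSet.inter (history_mono (by omega) _ ih) ?_
    exact (measurableSet_history_J (by omega) j).compl

/-- The law of a path segment between visits to `j`, jointly with the past. -/
theorem IsMarkovRenewal.map_restrict_avoids (h : IsMarkovRenewal P F p Pr J T) {n : ℕ}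
    {E : Set Ω} {j : S} (hE : MeasurableSet[history J T n] E) (hEj : ∀ ω ∈ E, J n ω = j)
    {y : Ω → Aff} (hy : Measurable[history J T n] y) (m : ℕ) (k : S) :
    (Pr.restrict (E ∩ avoids J j n m ∩ {ω | J (n + 1 + m) ω = k})).map
        (fun ω => affWalk a b J T n (m + 1) ω * y ω)
      = tabooMeas P F a b j m k ∗ₘ (Pr.restrict E).map y := by
  induction m generalizing k with
  | zero =>
    have h1 := h.map_restrict_mul (a := a) (b := b) hE hy j k
    have h2 : E ∩ {ω | J n ω = j} = E := inter_eq_left.2 hEj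
    rw [h2] at h1
    have h3 : E ∩ avoids J j n 0 = E := inter_eq_left.2 fun ω _ => by simp [avoids]
    rw [h3, tabooMeas, ← h1]
    simp [affWalk]
  | succ m ih =>
    have hmono := history_mono (J := J) (T := T) (show n ≤ n + 1 + m by omega)
    have hA : MeasurableSet[history J T (n + 1 + m)] (E ∩ avoids J j n m) :=
      (hmono _ hE).inter (history_mono (by omega) _ (measurableSet_history_avoids j n m))
    have hw : Measurable[history J T (n + 1 + m)]
        fun ω => affWalk a b J T n (m + 1) ω * y ω := by
      have h1 := measurable_history_affWalk a b J T n (m + 1)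
      rw [show n + (m + 1) = n + 1 + m by ring] at h1
      exact h1.mul (hy.mono hmono le_rfl)
    have hw' : Measurable fun ω => affWalk a b J T n (m + 1 + 1) ω * y ω :=
      ((measurable_history_affWalk a b J T n (m + 1 + 1)).mono (h.history_le _) le_rfl).mul
        (hy.mono (h.history_le n) le_rfl)
    have hD : MeasurableSet (E ∩ avoids J j n (m + 1) ∩ {ω | J (n + 1 + (m + 1)) ω = k}) :=
      ((h.history_le n _ hE).inter (h.history_le _ _ (measurableSet_history_avoids j n _))).inter
        (h.measurable_J _ (MeasurableSet.singleton k))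
    have : ∀ l, SFinite (open Classical in
        if l = j then (0 : Measure Aff) else stepMeas P F a b l k ∗ₘ tabooMeas P F a b j m l) := by
      intro l
      split_ifs <;> infer_instance
    rw [sum_map_restrict_inter (h.measurable_J (n + 1 + m)) hD hw', tabooMeas,
      show (Measure.sum fun l => _) ∗ₘ (Pr.restrict E).map y = _ from sum_mconv _ _]
    congr 1
    funext l
    -- The intermediate state is `l`. If `l = j` the event contradicts avoidance; otherwise the
    -- avoidance at that index is automatic and one step of the Markov property applies.
    split_ifs with hl
    · have : E ∩ avoids J j n (m + 1) ∩ {ω | J (n + 1 + (m + 1)) ω = k}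
          ∩ {ω | J (n + 1 + m) ω = l} = ∅ := by
        ext ω
        simp only [mem_inter_iff, mem_ofPred_eq, mem_empty_iff_false, iff_false, avoids_succ]
        rintro ⟨⟨⟨_, _, h1⟩, _⟩, h2⟩
        exact h1 (h2.trans hl)
      rw [this]
      simp
    · have hset : E ∩ avoids J j n (m + 1) ∩ {ω | J (n + 1 + (m + 1)) ω = k}
            ∩ {ω | J (n + 1 + m) ω = l}
          = E ∩ avoids J j n m ∩ {ω | J (n + 1 + m) ω = l} ∩ {ω | J (n + 1 + m + 1) ω = k} := by
        ext ω
        simp only [mem_inter_iff, mem_ofPred_eq, avoids_succ]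
        constructor
        · rintro ⟨⟨⟨h1, h2, h3⟩, h4⟩, h5⟩
          exact ⟨⟨⟨h1, h2⟩, h5⟩, h4⟩
        · rintro ⟨⟨⟨h1, h2⟩, h5⟩, h4⟩
          exact ⟨⟨⟨h1, h2, fun h => hl (h5.symm.trans h)⟩, h4⟩, h5⟩
      have hfun : (fun ω => affWalk a b J T n (m + 1 + 1) ω * y ω)
          = fun ω => sojournMap a b (J (n + 1 + m) ω) (T (n + 1 + m + 1) ω)
            * (affWalk a b J T n (m + 1) ω * y ω) := by
        funext ω
        rw [show n + 1 + m = n + (m + 1) by ring, ← mul_assoc]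
        rfl
      rw [Measure.mconv_assoc, ← ih l, ← h.map_restrict_mul hA hw l k, hset, hfun]

end Path

/-! ### Renewal decomposition at the visits to a state -/

theorem tsum_ite_lt_sub (i : ℕ) (c : ℕ → ℝ≥0∞) :
    ∑' n, (if i < n then c (n - 1 - i) else 0) = ∑' m, c m := by
  rw [← (ENNReal.summable).sum_add_tsum_nat_add' (k := i + 1), Finset.sum_eq_zero, zero_add]
  · refine tsum_congr fun m => ?_
    have h1 : i < m + (i + 1) := by omega
    have h2 : m + (i + 1) - 1 - i = m := by omega
    rw [if_pos h1, h2]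
  · intro n hn
    have h1 : ¬ i < n := by simp at hn; omega
    rw [if_neg h1]

section Decomposition

variable {S : Type*} [Countable S] [MeasurableSpace S] [DiscreteMeasurableSpace S]
  {Ω : Type*} [MeasurableSpace Ω] {P : S → PMF S} {F : S → S → Measure ℝ} {p : PMF S}
  {Pr : Measure Ω} {J : ℕ → Ω → S} {T : ℕ → Ω → ℝ} {a b : S → ℝ}

/-- The event that the first visit to `j` is at the index `n`. -/
def firstHit (J : ℕ → Ω → S) (j : S) (n : ℕ) : Set Ω := {ω | (∀ i < n, J i ω ≠ j) ∧ J n ω = j}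

theorem measurableSet_history_not_hit (j : S) {n m : ℕ} (hnm : n ≤ m + 1) :
    MeasurableSet[history J T m] {ω | ∀ i < n, J i ω ≠ j} := by
  induction n with
  | zero =>
    have : {ω : Ω | ∀ i < 0, J i ω ≠ j} = univ := by ext; simp
    rw [this]; exact @MeasurableSet.univ _ (history J T m)
  | succ n ih =>
    have : {ω : Ω | ∀ i < n + 1, J i ω ≠ j} = {ω | ∀ i < n, J i ω ≠ j} ∩ {ω | J n ω = j}ᶜ := by
      ext ω
      simp only [mem_ofPred_eq, mem_inter_iff, mem_compl_iff]
      exact ⟨fun h => ⟨fun i hi => h i (by omega), h n (by omega)⟩, fun h i hi => by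
        rcases Nat.lt_succ_iff_lt_or_eq.1 hi with h1 | rfl
        exacts [h.1 i h1, h.2]⟩
    rw [this]
    exact (ih (by omega)).inter (measurableSet_history_J (by omega) j).compl

theorem measurableSet_history_firstHit (j : S) (n : ℕ) :
    MeasurableSet[history J T n] (firstHit J j n) :=
  (measurableSet_history_not_hit j (by omega)).inter (measurableSet_history_J le_rfl j)

/-- The law of the walk at the index `n` on the event of a visit to `j`. -/
def visitMeas (Pr : Measure Ω) (J : ℕ → Ω → S) (T : ℕ → Ω → ℝ) (a b : S → ℝ) (j : S) (n : ℕ) :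
    Measure Aff :=
  (Pr.restrict {ω | J n ω = j}).map (affWalk a b J T 0 n)

/-- The law of the walk at the index `n` on the event of a first visit to `j`. -/
def firstHitMeas (Pr : Measure Ω) (J : ℕ → Ω → S) (T : ℕ → Ω → ℝ) (a b : S → ℝ) (j : S)
    (n : ℕ) : Measure Aff :=
  (Pr.restrict (firstHit J j n)).map (affWalk a b J T 0 n)

theorem IsMarkovRenewal.measurable_affWalk (h : IsMarkovRenewal P F p Pr J T) (n m : ℕ) :
    Measurable (affWalk a b J T n m) :=
  (measurable_history_affWalk a b J T n m).mono (h.history_le _) le_rfl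

variable [IsProbabilityMeasure Pr]

instance (j : S) (n : ℕ) : IsFiniteMeasure (firstHitMeas Pr J T a b j n) := by
  unfold firstHitMeas; infer_instance

variable [∀ l k, IsFiniteMeasure (jumpLaw P F l k)]

/-- Decomposition of a visit to `j` at the last visit before. -/
theorem IsMarkovRenewal.visitMeas_eq (h : IsMarkovRenewal P F p Pr J T) (j : S) (n : ℕ) :
    visitMeas Pr J T a b j n = firstHitMeas Pr J T a b j n
      + ∑ i ∈ Finset.range n, tabooMeas P F a b j (n - 1 - i) j ∗ₘ visitMeas Pr J T a b j i := by
  -- The event interpolates between a first visit at `n` (`r = 0`) and an arbitrary visit at `n` (`r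
  -- = n`). Raising `r` by one admits the paths whose last earlier visit is at index `r`.
  have key : ∀ r ≤ n, (Pr.restrict {ω | (∀ i < n, r ≤ i → J i ω ≠ j) ∧ J n ω = j}).map
        (affWalk a b J T 0 n)
      = firstHitMeas Pr J T a b j n
        + ∑ i ∈ Finset.range r,
          tabooMeas P F a b j (n - 1 - i) j ∗ₘ visitMeas Pr J T a b j i := by
    intro r
    induction r with
    | zero => intro _; simp [firstHitMeas, firstHit]
    | succ r ih =>
      intro hr
      obtain ⟨m, rfl⟩ : ∃ m, n = r + 1 + m := ⟨n - (r + 1), by omega⟩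
      rw [Finset.sum_range_succ, ← add_assoc, ← ih (by omega)]
      have hJr : MeasurableSet {ω | J r ω = j} := h.measurable_J r (MeasurableSet.singleton j)
      rw [← Measure.restrict_inter_add_sdiff _ hJr, Measure.map_add _ _ (h.measurable_affWalk _ _),
        add_comm]
      congr 1
      · congr 2
        ext ω
        simp only [Set.mem_sdiff, mem_ofPred_eq]
        constructor
        · rintro ⟨⟨h1, h2⟩, h3⟩
          refine ⟨fun i hi hri => ?_, h2⟩
          rcases hri.eq_or_lt with rfl | hri
          exacts [h3, h1 i hi hri]
        · rintro ⟨h1, h2⟩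
          exact ⟨⟨fun i hi hri => h1 i hi (by omega), h2⟩, h1 r (by omega) le_rfl⟩
      · have h1 := h.map_restrict_avoids (a := a) (b := b)
          (measurableSet_history_J (T := T) (k := r) le_rfl j) (fun ω hω => hω)
          
          (by have := measurable_history_affWalk a b J T 0 r; rwa [zero_add] at this) m j
        rw [show r + 1 + m - 1 - r = m by omega, visitMeas, ← h1]
        have hset : {ω | (∀ i < r + 1 + m, r + 1 ≤ i → J i ω ≠ j) ∧ J (r + 1 + m) ω = j}
              ∩ {ω | J r ω = j}
            = {ω | J r ω = j} ∩ avoids J j r m ∩ {ω | J (r + 1 + m) ω = j} := by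
          ext ω
          simp only [mem_inter_iff, mem_ofPred_eq, avoids]
          constructor
          · rintro ⟨⟨h1, h2⟩, h3⟩
            exact ⟨⟨h3, fun i hi => h1 _ (by omega) (by omega)⟩, h2⟩
          · rintro ⟨⟨h3, h1⟩, h2⟩
            refine ⟨⟨fun i hi hri => ?_, h2⟩, h3⟩
            have := h1 (i - (r + 1)) (by omega)
            rwa [show r + 1 + (i - (r + 1)) = i by omega] at this
        rw [hset]
        congr 1
        funext ω
        rw [show r + 1 + m = r + (m + 1) by ring, affWalk_add]
  rw [← key n le_rfl, visitMeas]
  congr 3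
  ext ω
  simp only [iff_and_self]
  intro _ i h1 h2
  omega

/-- The law of the walk at the index `n` on the event that this is the `k`-th visit to `j`. -/
def hitMeas (P : S → PMF S) (F : S → S → Measure ℝ) (Pr : Measure Ω) (J : ℕ → Ω → S)
    (T : ℕ → Ω → ℝ) (a b : S → ℝ) (j : S) : ℕ → ℕ → Measure Aff
  | 0 => firstHitMeas Pr J T a b j
  | k + 1 => fun n => Measure.sum fun i =>
      if i < n then tabooMeas P F a b j (n - 1 - i) j ∗ₘ hitMeas P F Pr J T a b j k i else 0

instance sFinite_hitMeas (j : S) (k n : ℕ) : SFinite (hitMeas P F Pr J T a b j k n) := by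
  induction k generalizing n with
  | zero => unfold hitMeas; infer_instance
  | succ k ih =>
    unfold hitMeas
    have : ∀ i, SFinite (if i < n then
        tabooMeas P F a b j (n - 1 - i) j ∗ₘ hitMeas P F Pr J T a b j k i else 0) := by
      intro l
      split_ifs <;> infer_instance
    infer_instance

/-- Both sides satisfy the same last-visit recursion: a visit is the first one, or follows an
earlier visit by one cycle. -/
theorem IsMarkovRenewal.sum_hitMeas_index (h : IsMarkovRenewal P F p Pr J T) (j : S) (n : ℕ) :
    Measure.sum (fun k => hitMeas P F Pr J T a b j k n) = visitMeas Pr J T a b j n := by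
  induction n using Nat.strong_induction_on with
  | _ n ih =>
    ext s hs
    rw [Measure.sum_apply _ hs, tsum_eq_zero_add' ENNReal.summable, h.visitMeas_eq,
      Measure.add_apply]
    congr 1
    simp_rw [hitMeas, Measure.sum_apply _ hs]
    rw [ENNReal.tsum_comm, Measure.finsetSum_apply, tsum_eq_sum (s := Finset.range n)]
    · refine Finset.sum_congr rfl fun i hi => ?_
      have hi' : i < n := by simpa using hi
      rw [← ih i hi', mconv_sum, Measure.sum_apply _ hs]
      simp [hi']
    · intro i hi
      have hi' : ¬ i < n := by simpa using hi
      simp [hi']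

/-- Summing over the absolute index frees the cycle length from it, and the cycle contributes its
full law. -/
theorem sum_hitMeas_succ (j : S) (k : ℕ) :
    Measure.sum (hitMeas P F Pr J T a b j (k + 1))
      = cycleMeas P F a b j ∗ₘ Measure.sum (hitMeas P F Pr J T a b j k) := by
  have h1 : ∀ i, cycleMeas P F a b j ∗ₘ hitMeas P F Pr J T a b j k i
      = Measure.sum fun m => tabooMeas P F a b j m j ∗ₘ hitMeas P F Pr J T a b j k i :=
    fun i => sum_mconv _ _
  rw [mconv_sum]
  simp only [h1]
  ext s hs
  simp only [hitMeas, Measure.sum_apply _ hs]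
  rw [ENNReal.tsum_comm]
  refine tsum_congr fun i => ?_
  refine Eq.trans (tsum_congr fun n => ?_) (tsum_ite_lt_sub i
    fun m => (tabooMeas P F a b j m j ∗ₘ hitMeas P F Pr J T a b j k i) s)
  split_ifs <;> simp

theorem sum_hitMeas [∀ j, IsProbabilityMeasure (cycleMeas P F a b j)] (j : S) (k : ℕ) :
    Measure.sum (hitMeas P F Pr J T a b j k)
      = affPow (cycleMeas P F a b j) k ∗ₘ Measure.sum (firstHitMeas Pr J T a b j) := by
  induction k with
  | zero => simp [affPow, hitMeas]
  | succ k ih => rw [sum_hitMeas_succ, ih, affPow_succ', Measure.mconv_assoc]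

/-- The walk at the visits to `j` is a delayed renewal process with step law `cycleMeas`. -/
theorem IsMarkovRenewal.sum_visitMeas [∀ j, IsProbabilityMeasure (cycleMeas P F a b j)]
    (h : IsMarkovRenewal P F p Pr J T) (j : S) :
    Measure.sum (visitMeas Pr J T a b j) = Measure.sum fun k =>
      affPow (cycleMeas P F a b j) k ∗ₘ Measure.sum (firstHitMeas Pr J T a b j) := by
  have h1 : visitMeas Pr J T a b j
      = fun n => Measure.sum fun k => hitMeas P F Pr J T a b j k n :=
    funext fun n => (h.sum_hitMeas_index j n).symm
  have h2 : (fun k => affPow (cycleMeas P F a b j) k ∗ₘ Measure.sum (firstHitMeas Pr J T a b j))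
      = fun k => Measure.sum (hitMeas P F Pr J T a b j k) :=
    funext fun k => (sum_hitMeas j k).symm
  rw [h1, h2, Measure.sum_comm]

theorem IsMarkovRenewal.T_zero (h : IsMarkovRenewal P F p Pr J T) : ∀ᵐ ω ∂Pr, T 0 ω = 0 := by
  have hm : MeasurableSet {ω | T 0 ω = 0} := h.measurable_T 0 (MeasurableSet.singleton 0)
  have h1 : Pr {ω | T 0 ω = 0} = 1 := by
    have h2 := congrArg (fun ν => ν univ)
      (sum_map_restrict_inter (Pr := Pr) (h.measurable_J 0) hm measurable_id)
    simp only [Measure.map_id, Measure.restrict_apply MeasurableSet.univ, univ_inter,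
      Measure.sum_apply _ MeasurableSet.univ] at h2
    rw [h2, ← p.tsum_coe]
    refine tsum_congr fun l => ?_
    rw [← h.initial l]
    congr 1; ext ω; simp [and_comm]
  exact (mem_ae_iff_prob_eq_one hm).2 h1

theorem IsMarkovRenewal.measure_J_zero (h : IsMarkovRenewal P F p Pr J T) (i : S) :
    Pr {ω | J 0 ω = i} = p i := by
  rw [← h.initial i]
  refine measure_congr ?_
  filter_upwards [h.T_zero] with ω hω
  exact propext ⟨fun h1 => ⟨h1, hω⟩, fun h1 => h1.1⟩

/-- The path started from `p` and killed at `j` evolves by the same recursion as `tabooVec`; this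
transfers the hitting results for the matrix to the path. -/
theorem IsMarkovRenewal.measure_not_hit (h : IsMarkovRenewal P F p Pr J T)
    (h1 : ∀ l k, jumpLaw P F l k univ = P l k) (j : S) (n : ℕ) (k : S) :
    Pr ({ω | ∀ i < n, J i ω ≠ j} ∩ {ω | J n ω = k}) = tabooVec P j p n k := by
  classical
  induction n generalizing k with
  | zero => simp [tabooVec, h.measure_J_zero]
  | succ n ih =>
    have hm : MeasurableSet ({ω | ∀ i < n + 1, J i ω ≠ j} ∩ {ω | J (n + 1) ω = k}) :=
      (h.history_le n _ (measurableSet_history_not_hit j le_rfl)).inter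
        (h.measurable_J _ (MeasurableSet.singleton k))
    have h2 := congrArg (fun ν => ν univ)
      (sum_map_restrict_inter (Pr := Pr) (h.measurable_J n) hm measurable_id)
    simp only [Measure.map_id, Measure.restrict_apply MeasurableSet.univ, univ_inter,
      Measure.sum_apply _ MeasurableSet.univ] at h2
    rw [h2, tabooVec]
    refine tsum_congr fun l => ?_
    split_ifs with hl
    · convert measure_empty (μ := Pr)
      ext ω
      simp only [mem_inter_iff, mem_ofPred_eq, mem_empty_iff_false, iff_false]
      rintro ⟨⟨h3, _⟩, h4⟩
      exact h3 n (by omega) (h4.trans hl)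
    · rw [← ih l, ← h1 l k, ← h.measure_inter_J (measurableSet_history_not_hit j (by omega)) l k]
      congr 1
      ext ω
      simp only [mem_inter_iff, mem_ofPred_eq]
      constructor
      · rintro ⟨⟨h3, h4⟩, h5⟩
        exact ⟨⟨fun i hi => h3 i (by omega), h5⟩, h4⟩
      · rintro ⟨⟨h3, h5⟩, h4⟩
        refine ⟨⟨fun i hi => ?_, h4⟩, h5⟩
        rcases Nat.lt_succ_iff_lt_or_eq.1 hi with h6 | rfl
        exacts [h3 i h6, fun h => hl (h5.symm.trans h)]

theorem IsMarkovRenewal.tsum_firstHit (h : IsMarkovRenewal P F p Pr J T)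
    (h1 : ∀ l k, jumpLaw P F l k univ = P l k) (hirr : IrreducibleChain P) {j : S}
    (hrec : ∑' n, firstPassage P j n j = 1) : ∑' n, Pr (firstHit J j n) = 1 := by
  classical
  have h2 : ∀ n, Pr (firstHit J j n) = tabooVec P j p n j := fun n =>
    h.measure_not_hit h1 j n j
  simp_rw [h2]
  rw [tsum_tabooVec_eq_tsum_firstPassage]
  simp_rw [tsum_firstPassage_eq_one hirr hrec, mul_one]
  rw [tsum_ite_add, p.tsum_coe]

end Decomposition

/-! ### Path integrals of the semi-Markov process -/

section Deterministic

variable {S Ω : Type*} {J : ℕ → Ω → S} {T : ℕ → Ω → ℝ} {a b : S → ℝ} {ω : Ω}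

/-- The path starts at time zero, all its sojourn times are positive, and it does not explode. -/
structure RegularPath (T : ℕ → Ω → ℝ) (ω : Ω) : Prop where
  zero : T 0 ω = 0
  pos : ∀ n, 0 < T (n + 1) ω
  finite : ∀ t : ℝ, 0 ≤ t → {n | jumpTime T n ω ≤ t}.Finite

theorem jumpTime_succ (n : ℕ) (ω : Ω) : jumpTime T (n + 1) ω = jumpTime T n ω + T (n + 1) ω :=
  Finset.sum_range_succ _ _

theorem time_affWalk (n m : ℕ) (ω : Ω) :
    (affWalk a b J T n m ω).time = jumpTime T (n + m) ω - jumpTime T n ω := by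
  induction m with
  | zero => simp [affWalk]
  | succ m ih =>
    rw [affWalk, Aff.time_mul, ih, ← add_assoc, jumpTime_succ]
    simp only [sojournMap, Aff.time_mk]; ring

theorem rate_affWalk (n m : ℕ) (ω : Ω) :
    (affWalk a b J T n m ω).rate
      = ∑ i ∈ Finset.range m, a (J (n + i) ω) * T (n + i + 1) ω := by
  induction m with
  | zero => simp [affWalk]
  | succ m ih =>
    rw [affWalk, Aff.rate_mul, ih, Finset.sum_range_succ, add_comm]
    rfl

theorem RegularPath.jumpTime_zero (h : RegularPath T ω) : jumpTime T 0 ω = 0 := by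
  simp [jumpTime, h.zero]

theorem RegularPath.strictMono (h : RegularPath T ω) : StrictMono fun n => jumpTime T n ω :=
  strictMono_nat_of_lt_succ fun n => by rw [jumpTime_succ]; linarith [h.pos n]

theorem RegularPath.jumpCount_eq (h : RegularPath T ω) {t : ℝ} {n : ℕ}
    (h1 : jumpTime T n ω ≤ t) (h2 : t < jumpTime T (n + 1) ω) : jumpCount T t ω = n := by
  have : {m | jumpTime T m ω ≤ t} = Iic n := by
    ext m
    simp only [mem_ofPred_eq, mem_Iic]
    constructor
    · intro hm
      have := h.strictMono.lt_iff_lt.1 (hm.trans_lt h2)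
      omega
    · exact fun hm => (h.strictMono.monotone hm).trans h1
  rw [jumpCount, this]
  exact csSup_Iic

theorem RegularPath.semiMarkov_eq (h : RegularPath T ω) {t : ℝ} {n : ℕ}
    (h1 : jumpTime T n ω ≤ t) (h2 : t < jumpTime T (n + 1) ω) :
    semiMarkov J T t ω = J n ω := by
  rw [semiMarkov, h.jumpCount_eq h1 h2]

theorem RegularPath.jumpTime_jumpCount (h : RegularPath T ω) {t : ℝ} (ht : 0 ≤ t) :
    jumpTime T (jumpCount T t ω) ω ≤ t ∧ t < jumpTime T (jumpCount T t ω + 1) ω := by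
  have hne : {n | jumpTime T n ω ≤ t}.Nonempty := ⟨0, by
    change jumpTime T 0 ω ≤ t
    rwa [h.jumpTime_zero]⟩
  refine ⟨Nat.sSup_mem hne (h.finite t ht).bddAbove, ?_⟩
  by_contra! hc
  have : jumpCount T t ω + 1 ≤ jumpCount T t ω := le_csSup (h.finite t ht).bddAbove hc
  omega

/-- Within one sojourn the path is constant. Only the right end point can belong to the next
sojourn, and it is a null set. -/
theorem RegularPath.integral_semiMarkov (h : RegularPath T ω) {n : ℕ} {s t : ℝ}
    (h1 : jumpTime T n ω ≤ s) (hst : s ≤ t) (h2 : t ≤ jumpTime T (n + 1) ω) :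
    IntervalIntegrable (fun r => a (semiMarkov J T r ω)) volume s t ∧
      ∫ r in s..t, a (semiMarkov J T r ω) = a (J n ω) * (t - s) := by
  have hae : ∀ᵐ r ∂volume, r ∈ uIoc s t → a (J n ω) = a (semiMarkov J T r ω) := by
    filter_upwards [Measure.ae_ne volume t] with r hr hrI
    rw [uIoc_of_le hst] at hrI
    rw [h.semiMarkov_eq (h1.trans hrI.1.le) ((lt_of_le_of_ne hrI.2 hr).trans_le h2)]
  constructor
  · exact (intervalIntegrable_const (c := a (J n ω))).congr_ae
      ((ae_restrict_iff' measurableSet_uIoc).2 hae)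
  · rw [← intervalIntegral.integral_congr_ae hae, intervalIntegral.integral_const, smul_eq_mul,
      mul_comm]

/-- The path integrals over `[u, t]` are those of an affine map `x`. -/
structure Represents (a b : S → ℝ) (y : ℝ → S) (u t : ℝ) (x : Aff) : Prop where
  integrable_rate : IntervalIntegrable (fun r => a (y r)) volume u t
  rate : ∫ r in u..t, a (y r) = x.rate
  integrable_shift : IntervalIntegrable (fun s => b (y s) * discount a y s t) volume u t
  shift : perpetuity a b y u t = x.shift

theorem expInt_sub (c u t : ℝ) : ∫ s in u..t, Real.exp (-c * (t - s)) = expInt c (t - u) := by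
  have h := intervalIntegral.integral_comp_add_right (a := 0) (b := t - u)
    (fun s => Real.exp (-c * (t - s))) u
  rw [zero_add, sub_add_cancel] at h
  rw [← h, expInt]
  refine intervalIntegral.integral_congr fun s _ => ?_
  congr 1; ring

/-- Splitting at the last jump, the discount factorises on the earlier part, so the old perpetuity
is multiplied by the discount of the new stretch, and the new stretch adds an explicit exponential
integral. This is left multiplication in `Aff`. Integrability is carried along because the
additivity of interval integrals requires it. -/
theorem RegularPath.represents_step (h : RegularPath T ω) {n : ℕ} {u t : ℝ} {x : Aff}
    (hx : Represents a b (fun s => semiMarkov J T s ω) u (jumpTime T n ω) x)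
    (hu : u ≤ jumpTime T n ω) (h1 : jumpTime T n ω ≤ t) (h2 : t ≤ jumpTime T (n + 1) ω) :
    Represents a b (fun s => semiMarkov J T s ω) u t
      (sojournMap a b (J n ω) (t - jumpTime T n ω) * x) := by
  obtain ⟨hi, hI⟩ := h.integral_semiMarkov (a := a) (J := J) le_rfl h1 h2
  have hd1 : ∀ s ∈ Icc u (jumpTime T n ω),
      discount a (fun s => semiMarkov J T s ω) s t
        = Real.exp (-(a (J n ω) * (t - jumpTime T n ω)))
          * discount a (fun s => semiMarkov J T s ω) s (jumpTime T n ω) := by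
    intro s hs
    have hsi : IntervalIntegrable (fun r => a (semiMarkov J T r ω)) volume s (jumpTime T n ω) :=
      hx.integrable_rate.mono_set (by
        rw [uIcc_of_le hs.2, uIcc_of_le hu]; exact Icc_subset_Icc_left hs.1)
    rw [discount, discount, ← intervalIntegral.integral_add_adjacent_intervals hsi hi, hI,
      neg_add, Real.exp_add, mul_comm]
  have hd2 : ∀ s ∈ Icc (jumpTime T n ω) t,
      discount a (fun s => semiMarkov J T s ω) s t = Real.exp (-a (J n ω) * (t - s)) := by
    intro s hs
    rw [discount, (h.integral_semiMarkov (a := a) (J := J) hs.1 hs.2 h2).2, neg_mul]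
  have hae : ∀ᵐ s ∂volume, s ∈ uIoc (jumpTime T n ω) t →
      b (J n ω) * Real.exp (-a (J n ω) * (t - s))
        = b (semiMarkov J T s ω) * discount a (fun s => semiMarkov J T s ω) s t := by
    filter_upwards [Measure.ae_ne volume t] with s hs hsI
    rw [uIoc_of_le h1] at hsI
    rw [h.semiMarkov_eq hsI.1.le ((lt_of_le_of_ne hsI.2 hs).trans_le h2),
      hd2 s ⟨hsI.1.le, hsI.2⟩]
  have hc1 : EqOn (fun s => Real.exp (-(a (J n ω) * (t - jumpTime T n ω)))
        * (b (semiMarkov J T s ω)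
          * discount a (fun s => semiMarkov J T s ω) s (jumpTime T n ω)))
      (fun s => b (semiMarkov J T s ω) * discount a (fun s => semiMarkov J T s ω) s t)
      (uIcc u (jumpTime T n ω)) := by
    intro s hs
    rw [uIcc_of_le hu] at hs
    simp only [hd1 s hs]; ring
  have hb1 : IntervalIntegrable
      (fun s => b (semiMarkov J T s ω) * discount a (fun s => semiMarkov J T s ω) s t) volume
      u (jumpTime T n ω) :=
    (hx.integrable_shift.const_mul _).congr (hc1.mono uIoc_subset_uIcc)
  have hb2 : IntervalIntegrable
      (fun s => b (semiMarkov J T s ω) * discount a (fun s => semiMarkov J T s ω) s t) volume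
      (jumpTime T n ω) t :=
    (Continuous.intervalIntegrable (by fun_prop :
      Continuous fun s => b (J n ω) * Real.exp (-a (J n ω) * (t - s))) _ _).congr_ae
      ((ae_restrict_iff' measurableSet_uIoc).2 hae)
  refine ⟨hx.integrable_rate.trans hi, ?_, hb1.trans hb2, ?_⟩
  · rw [← intervalIntegral.integral_add_adjacent_intervals hx.integrable_rate hi, hI, hx.rate,
      add_comm]
    rfl
  · rw [perpetuity, ← intervalIntegral.integral_add_adjacent_intervals hb1 hb2,
      ← intervalIntegral.integral_congr_ae hae, intervalIntegral.integral_const_mul, expInt_sub,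
      ← intervalIntegral.integral_congr hc1, intervalIntegral.integral_const_mul, Aff.shift_mul,
      ← hx.shift, add_comm]
    rfl

theorem RegularPath.represents_affWalk (h : RegularPath T ω) (n m : ℕ) :
    Represents a b (fun s => semiMarkov J T s ω) (jumpTime T n ω) (jumpTime T (n + m) ω)
      (affWalk a b J T n m ω) := by
  induction m with
  | zero =>
    refine ⟨?_, ?_, ?_, ?_⟩ <;> simp [affWalk, perpetuity]
  | succ m ih =>
    have h1 := h.represents_step ih (h.strictMono.monotone (Nat.le_add_right n m))
      (t := jumpTime T (n + (m + 1)) ω) (h.strictMono.monotone (by omega)) le_rfl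
    rwa [← add_assoc, jumpTime_succ, add_sub_cancel_left, ← jumpTime_succ, add_assoc] at h1

theorem RegularPath.represents_zero (h : RegularPath T ω) {t : ℝ} (ht : 0 ≤ t) :
    Represents a b (fun s => semiMarkov J T s ω) 0 t
      (sojournMap a b (semiMarkov J T t ω) (t - jumpTime T (jumpCount T t ω) ω)
        * affWalk a b J T 0 (jumpCount T t ω) ω) := by
  obtain ⟨h1, h2⟩ := h.jumpTime_jumpCount ht
  have h3 := h.represents_affWalk (J := J) (a := a) (b := b) 0 (jumpCount T t ω)
  rw [zero_add, h.jumpTime_zero] at h3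
  refine h.represents_step h3 ?_ h1 h2.le
  rw [← h.jumpTime_zero]
  exact h.strictMono.monotone (Nat.zero_le _)

theorem visitIndex_zero_eq {j : S} {n : ℕ} (h : ω ∈ firstHit J j n) : visitIndex J j 0 ω = n :=
  le_antisymm (Nat.sInf_le h.2) (le_csInf ⟨n, h.2⟩ fun i hi =>
    not_lt.1 fun hlt => h.1 i hlt hi)

/-- The event that the first visit to `j` is at the index `n` and the next one `m + 1` steps
later. -/
def cycleSet (J : ℕ → Ω → S) (j : S) (n m : ℕ) : Set Ω :=
  firstHit J j n ∩ avoids J j n m ∩ {ω | J (n + 1 + m) ω = j}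

theorem visitIndex_one_eq {j : S} {n m : ℕ} (h : ω ∈ cycleSet J j n m) :
    visitIndex J j 1 ω = n + 1 + m := by
  have h0 := visitIndex_zero_eq h.1.1
  have hmem : n + 1 + m ∈ {i | visitIndex J j 0 ω < i ∧ J i ω = j} :=
    ⟨by rw [h0]; omega, h.2⟩
  refine le_antisymm (Nat.sInf_le hmem) (le_csInf ⟨_, hmem⟩ fun i hi => ?_)
  rw [h0] at hi
  by_contra! hlt
  have := h.1.2 (i - (n + 1)) (by have := hi.1; omega)
  rw [show n + 1 + (i - (n + 1)) = i by have := hi.1; omega] at this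
  exact this hi.2

theorem RegularPath.cyclePair_eq (h : RegularPath T ω) {j : S} {n m : ℕ}
    (hω : ω ∈ cycleSet J j n m) :
    cyclePair a b J T j ω = (Real.exp (-(affWalk a b J T n (m + 1) ω).rate),
      (affWalk a b J T n (m + 1) ω).shift) := by
  have h1 := h.represents_affWalk (J := J) (a := a) (b := b) n (m + 1)
  rw [cyclePair, visitTime, visitTime, visitIndex_zero_eq hω.1.1, visitIndex_one_eq hω,
    show n + 1 + m = n + (m + 1) by ring, h1.shift, discount, h1.rate]

end Deterministic

/-! ### The law of a cycle -/

section Environment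

variable {S : Type*} {P : S → PMF S} {F : S → S → Measure ℝ} {μ : PMF S}

theorem ErgodicEnvironment.isFiniteMeasure (h : ErgodicEnvironment P F μ) (l k : S) :
    IsFiniteMeasure (jumpLaw P F l k) := by
  by_cases h0 : P l k = 0
  · simp only [jumpLaw, h0, zero_smul]; infer_instance
  · have := h.isProbabilityMeasure l k h0
    exact Measure.smul_finite _ ((P l).apply_ne_top k)

theorem ErgodicEnvironment.jumpLaw_univ (h : ErgodicEnvironment P F μ) (l k : S) :
    jumpLaw P F l k univ = P l k := by
  by_cases h0 : P l k = 0
  · simp [jumpLaw, h0]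
  · have := h.isProbabilityMeasure l k h0
    simp [jumpLaw]

theorem ErgodicEnvironment.jumpLaw_Iic (h : ErgodicEnvironment P F μ) (l k : S) :
    jumpLaw P F l k (Iic 0) = 0 := by
  by_cases h0 : P l k = 0
  · simp [jumpLaw, h0]
  · simp [jumpLaw, h.pos l k h0]

theorem ErgodicEnvironment.jumpLaw_ac (h : ErgodicEnvironment P F μ) (l k : S) :
    jumpLaw P F l k ≪ volume := by
  by_cases h0 : P l k = 0
  · simp only [jumpLaw, h0, zero_smul]; exact Measure.AbsolutelyContinuous.zero _
  · exact Measure.AbsolutelyContinuous.smul_left (h.absolutelyContinuous l k h0) _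

theorem ErgodicEnvironment.recurrent (h : ErgodicEnvironment P F μ) (j : S) :
    ∑' n, firstPassage P j n j = 1 := (h.positiveRecurrent j).1

/-- The layer cake formula identifies the mean of a positive law with the integral of its tail. -/
theorem lintegral_ofReal_jumpLaw (hpos : ∀ l k, jumpLaw P F l k (Iic 0) = 0) (l : S) :
    ∑' k, ∫⁻ t, ENNReal.ofReal t ∂(jumpLaw P F l k) = meanHolding P F l := by
  refine tsum_congr fun k => ?_
  rw [meanSojourn, lintegral_eq_lintegral_meas_lt (f := fun t => t) _ ?_ aemeasurable_id]
  · rw [← lintegral_const_mul _ (measurable_measure_Ioi _)]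
    rfl
  · rw [Filter.EventuallyLE, ae_iff]
    refine measure_mono_null (fun t ht => ?_) (hpos l k)
    simp only [Pi.zero_apply, not_le, mem_ofPred_eq] at ht
    exact ht.le

end Environment

/-! ### Identification of the first cycle of the process. -/

section CycleLaw

variable {S : Type*} [Countable S] [MeasurableSpace S] [DiscreteMeasurableSpace S]
  {Ω : Type*} [MeasurableSpace Ω] {P : S → PMF S} {F : S → S → Measure ℝ} {μ p : PMF S}
  {Pr : Measure Ω} [IsProbabilityMeasure Pr] {J : ℕ → Ω → S} {T : ℕ → Ω → ℝ} {a b : S → ℝ}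

theorem IsMarkovRenewal.ae_pos (h : IsMarkovRenewal P F p Pr J T)
    (hE : ErgodicEnvironment P F μ) (n : ℕ) : ∀ᵐ ω ∂Pr, 0 < T (n + 1) ω := by
  have := hE.isFiniteMeasure
  have h1 : ∀ᵐ ω ∂Pr, ∀ l k, J n ω = l → J (n + 1) ω = k → 0 < T (n + 1) ω := by
    rw [ae_all_iff]; intro l
    rw [ae_all_iff]; intro k
    have h2 := h.map_restrict_T (E := univ) (@MeasurableSet.univ _ (history J T n)) l k
    have h3 := congrArg (fun ν => ν (Iic 0)) h2
    simp only [Measure.smul_apply, hE.jumpLaw_Iic l k, smul_zero] at h3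
    rw [Measure.map_apply (h.measurable_T _) measurableSet_Iic,
      Measure.restrict_apply (h.measurable_T _ measurableSet_Iic)] at h3
    rw [ae_iff]
    refine measure_mono_null (fun ω hω => ?_) h3
    simp only [not_forall, mem_ofPred_eq, not_lt, exists_prop] at hω
    exact ⟨hω.2.2, ⟨mem_univ _, hω.1⟩, hω.2.1⟩
  filter_upwards [h1] with ω hω using hω _ _ rfl rfl

theorem IsMarkovRenewal.ae_regularPath (h : IsMarkovRenewal P F p Pr J T)
    (hE : ErgodicEnvironment P F μ) (hne : NonExplosive Pr T) : ∀ᵐ ω ∂Pr, RegularPath T ω := by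
  have := hE.isFiniteMeasure
  have h1 : ∀ᵐ ω ∂Pr, ∀ N : ℕ, {n | jumpTime T n ω ≤ N}.Finite :=
    ae_all_iff.2 fun N => hne N (Nat.cast_nonneg N)
  filter_upwards [h.T_zero, ae_all_iff.2 (h.ae_pos hE), h1] with ω h2 h3 h4
  exact ⟨h2, h3, fun t _ => (h4 ⌈t⌉₊).subset fun n hn => le_trans hn (Nat.le_ceil t)⟩

/-- Disjoint parts that carry the full mass of `E` exhaust it up to a null set. Recurrence thereby
allows decomposition by hitting index and cycle length. -/
theorem restrict_eq_sum_of_measure_eq {ι : Type*} [Countable ι] {E : Set Ω} {D : ι → Set Ω}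
    (hD : ∀ i, MeasurableSet (D i)) (hsub : ∀ i, D i ⊆ E)
    (hdisj : Pairwise fun i k => Disjoint (D i) (D k)) (hsum : ∑' i, Pr (D i) = Pr E) :
    Pr.restrict E = Measure.sum fun i => Pr.restrict (D i) := by
  rw [← Measure.restrict_iUnion hdisj hD]
  refine Measure.restrict_congr_set ?_
  rw [← measure_iUnion hdisj hD] at hsum
  exact (ae_eq_of_subset_of_measure_ge (iUnion_subset hsub) hsum.ge
    (MeasurableSet.iUnion hD).nullMeasurableSet (measure_ne_top _ _)).symm

theorem IsMarkovRenewal.measurableSet_firstHit (h : IsMarkovRenewal P F p Pr J T) (j : S) (n : ℕ) :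
    MeasurableSet (firstHit J j n) :=
  h.history_le n _ (measurableSet_history_firstHit j n)

theorem IsMarkovRenewal.measurableSet_avoids (h : IsMarkovRenewal P F p Pr J T) (j : S)
    (n m : ℕ) : MeasurableSet (avoids J j n m) :=
  h.history_le _ _ (measurableSet_history_avoids j n m)

theorem IsMarkovRenewal.measurableSet_cycleSet (h : IsMarkovRenewal P F p Pr J T) (j : S)
    (n m : ℕ) : MeasurableSet (cycleSet J j n m) :=
  ((h.measurableSet_firstHit j n).inter (h.measurableSet_avoids j n m)).inter
    (h.measurable_J _ (MeasurableSet.singleton j))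

theorem IsMarkovRenewal.eq_sum_restrict_firstHit (h : IsMarkovRenewal P F p Pr J T)
    (hE : ErgodicEnvironment P F μ) (j : S) :
    Pr = Measure.sum fun n => Pr.restrict (firstHit J j n) := by
  have := hE.isFiniteMeasure
  conv_lhs => rw [← Measure.restrict_univ (μ := Pr)]
  refine restrict_eq_sum_of_measure_eq (h.measurableSet_firstHit j)
    (fun _ => subset_univ _) (fun i k hik => Set.disjoint_left.2 fun ω h1 h2 => hik ?_) ?_
  · rw [← visitIndex_zero_eq h1, visitIndex_zero_eq h2]
  · rw [h.tsum_firstHit hE.jumpLaw_univ hE.irreducible (hE.recurrent j), measure_univ]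

/-- Only total masses matter, so the segment law is used with the zero coefficients `a` and `b`. -/
theorem IsMarkovRenewal.measure_firstHit_avoids (h : IsMarkovRenewal P F p Pr J T)
    (hE : ErgodicEnvironment P F μ) (j : S) (n m : ℕ) (k : S) :
    Pr (firstHit J j n ∩ avoids J j n m ∩ {ω | J (n + 1 + m) ω = k})
      = Pr (firstHit J j n) * tabooVec P j (P j) m k := by
  have := hE.isFiniteMeasure
  have h1 := h.map_restrict_avoids (a := fun _ => 0) (b := fun _ => 0)
    (measurableSet_history_firstHit j n) (fun ω hω => hω.2)
    (@measurable_const _ _ _ (history J T n) (1 : Aff)) m k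
  have h2 := congrArg (fun ν => ν univ) h1
  have hm : Measurable fun ω => affWalk (fun _ => 0) (fun _ => 0) J T n (m + 1) ω * (1 : Aff) := by
    simpa using h.measurable_affWalk _ _
  simp only [mconv_apply_univ, tabooMeas_univ hE.jumpLaw_univ] at h2
  rw [Measure.map_apply hm MeasurableSet.univ,
    Measure.map_apply measurable_const MeasurableSet.univ] at h2
  simpa [mul_comm] using h2

theorem IsMarkovRenewal.restrict_firstHit (h : IsMarkovRenewal P F p Pr J T)
    (hE : ErgodicEnvironment P F μ) (j : S) (n : ℕ) :
    Pr.restrict (firstHit J j n) = Measure.sum fun m => Pr.restrict (cycleSet J j n m) := by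
  refine restrict_eq_sum_of_measure_eq (h.measurableSet_cycleSet j n) (fun _ _ hω => hω.1.1)
    (fun i k hik => Set.disjoint_left.2 fun ω h1 h2 => hik ?_) ?_
  · have h3 := visitIndex_one_eq h1
    rw [visitIndex_one_eq h2] at h3
    omega
  · have h1 : ∀ m, Pr (cycleSet J j n m) = Pr (firstHit J j n) * tabooVec P j (P j) m j :=
      fun m => h.measure_firstHit_avoids hE j n m j
    simp_rw [h1]
    rw [ENNReal.tsum_mul_left, tsum_tabooVec_self_of_recurrent P j (hE.recurrent j), mul_one]

theorem IsMarkovRenewal.map_cycleSet (h : IsMarkovRenewal P F p Pr J T)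
    (hE : ErgodicEnvironment P F μ) (j : S) (n m : ℕ) :
    (Pr.restrict (cycleSet J j n m)).map (affWalk a b J T n (m + 1))
      = Pr (firstHit J j n) • tabooMeas P F a b j m j := by
  have := hE.isFiniteMeasure
  have h1 := h.map_restrict_avoids (a := a) (b := b)
    (measurableSet_history_firstHit j n) (fun ω hω => hω.2)
    (@measurable_const _ _ _ (history J T n) (1 : Aff)) m j
  simp only [mul_one] at h1
  rw [cycleSet]
  refine Eq.trans h1 ?_
  rw [Measure.map_const, Measure.restrict_apply_univ]
  refine Measure.ext_of_lintegral _ fun f hf => ?_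
  rw [Measure.lintegral_mconv hf, lintegral_smul_measure]
  simp only [lintegral_smul_measure, lintegral_dirac, mul_one, smul_eq_mul]
  rw [lintegral_const_mul _ hf]

/-- The cycle after the first visit has the law `cycleMeas` whatever the index of that visit, and
the visit occurs almost surely. Moments of the abstract law can therefore be computed along the
actual path. -/
theorem IsMarkovRenewal.lintegral_cycleMeas (h : IsMarkovRenewal P F p Pr J T)
    (hE : ErgodicEnvironment P F μ) (j : S) {f : Aff → ℝ≥0∞} (hf : Measurable f) :
    ∫⁻ x, f x ∂(cycleMeas P F a b j)
      = ∑' n, ∑' m, ∫⁻ ω in cycleSet J j n m, f (affWalk a b J T n (m + 1) ω) ∂Pr := by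
  have := hE.isFiniteMeasure
  have h1 : ∀ n m, ∫⁻ ω in cycleSet J j n m, f (affWalk a b J T n (m + 1) ω) ∂Pr
      = Pr (firstHit J j n) * ∫⁻ x, f x ∂(tabooMeas P F a b j m j) := fun n m => by
    rw [← lintegral_map hf (h.measurable_affWalk n (m + 1)), h.map_cycleSet hE,
      lintegral_smul_measure, smul_eq_mul]
  simp_rw [h1, ENNReal.tsum_mul_left]
  rw [ENNReal.tsum_mul_right, h.tsum_firstHit hE.jumpLaw_univ hE.irreducible (hE.recurrent j),
    one_mul, cycleMeas, lintegral_sum_measure]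

/-- The first cycle of the semi-Markov process has the law `cycleMeas`. -/
theorem IsMarkovRenewal.map_cyclePair (h : IsMarkovRenewal P F p Pr J T)
    (hE : ErgodicEnvironment P F μ) (hne : NonExplosive Pr T) (j : S) :
    AEMeasurable (cyclePair a b J T j) Pr ∧
      Pr.map (cyclePair a b J T j) = slopeShiftLaw (cycleMeas P F a b j) := by
  have := hE.isFiniteMeasure
  have hsum : Pr = Measure.sum fun n => Measure.sum fun m => Pr.restrict (cycleSet J j n m) := by
    conv_lhs => rw [h.eq_sum_restrict_firstHit hE j]
    simp_rw [← h.restrict_firstHit hE j]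
  have hcongr : ∀ n m, cyclePair a b J T j =ᵐ[Pr.restrict (cycleSet J j n m)]
      (fun x : Aff => (Real.exp (-x.rate), x.shift)) ∘ affWalk a b J T n (m + 1) := fun n m => by
    filter_upwards [ae_restrict_mem (h.measurableSet_cycleSet j n m),
      ae_restrict_of_ae (h.ae_regularPath hE hne)] with ω h1 h2
    exact h2.cyclePair_eq h1
  have hmeas : ∀ n m, Measurable
      ((fun x : Aff => (Real.exp (-x.rate), x.shift)) ∘ affWalk a b J T n (m + 1)) := fun n m =>
    (by fun_prop : Measurable fun x : Aff => (Real.exp (-x.rate), x.shift)).comp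
      (h.measurable_affWalk n (m + 1))
  have hae : ∀ n, AEMeasurable (cyclePair a b J T j)
      (Measure.sum fun m => Pr.restrict (cycleSet J j n m)) := fun n =>
    aemeasurable_sum_measure_iff.2 fun m => ⟨_, hmeas n m, hcongr n m⟩
  have hae' : AEMeasurable (cyclePair a b J T j) Pr := by
    rw [hsum]
    exact aemeasurable_sum_measure_iff.2 hae
  refine ⟨hae', Measure.ext_of_lintegral _ fun f hf => ?_⟩
  rw [lintegral_map' hf.aemeasurable hae', slopeShiftLaw, lintegral_map hf (by fun_prop),
    h.lintegral_cycleMeas hE j (by fun_prop)]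
  conv_lhs => rw [hsum, lintegral_sum_measure]
  refine tsum_congr fun n => ?_
  rw [lintegral_sum_measure]
  refine tsum_congr fun m => lintegral_congr_ae ?_
  filter_upwards [hcongr n m] with ω hω
  rw [hω]
  rfl

end CycleLaw

/-! ### Length, rate and absolute continuity of a cycle. -/

section CycleMoments

variable {S : Type*} [Countable S] [MeasurableSpace S] [DiscreteMeasurableSpace S]
  {Ω : Type*} [MeasurableSpace Ω] {P : S → PMF S} {F : S → S → Measure ℝ} {μ p : PMF S}
  {Pr : Measure Ω} [IsProbabilityMeasure Pr] {J : ℕ → Ω → S} {T : ℕ → Ω → ℝ} {a b : S → ℝ}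

/-- The tail of the sojourn time at `l`. -/
def holdTail (P : S → PMF S) (F : S → S → Measure ℝ) (l : S) (x : ℝ) : ℝ≥0∞ :=
  if 0 ≤ x then ∑' k, jumpLaw P F l k (Ioi x) else 0

theorem measurable_holdTail (l : S) : Measurable (holdTail P F l) :=
  Measurable.ite measurableSet_Ici
    (Measurable.tsum fun k => measurable_measure_Ioi (jumpLaw P F l k)) measurable_const

theorem IsMarkovRenewal.lintegral_sojourn (h : IsMarkovRenewal P F p Pr J T)
    (hE : ErgodicEnvironment P F μ) {n : ℕ} {E : Set Ω} (hEm : MeasurableSet[history J T n] E)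
    (l : S) {g : ℝ → ℝ≥0∞} (hg : Measurable g) :
    ∫⁻ ω in E ∩ {ω | J n ω = l}, g (T (n + 1) ω) ∂Pr
      = Pr (E ∩ {ω | J n ω = l}) * ∑' k, ∫⁻ t, g t ∂(jumpLaw P F l k) := by
  have := hE.isFiniteMeasure
  have hD : MeasurableSet (E ∩ {ω | J n ω = l}) :=
    (h.history_le n _ hEm).inter (h.measurable_J n (MeasurableSet.singleton l))
  have h1 := congrArg (fun ν => ∫⁻ t, g t ∂ν)
    (sum_map_restrict_inter (Pr := Pr) (h.measurable_J (n + 1)) hD (h.measurable_T (n + 1)))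
  simp only [lintegral_sum_measure, h.map_restrict_T hEm, lintegral_smul_measure, smul_eq_mul,
    ENNReal.tsum_mul_left] at h1
  rw [← h1, lintegral_map hg (h.measurable_T _)]

theorem lintegral_eq_tsum_fiber {X : Ω → S} (hX : Measurable X) {E : Set Ω}
    (hE : MeasurableSet E) (g : Ω → ℝ≥0∞) :
    ∫⁻ ω in E, g ω ∂Pr = ∑' l, ∫⁻ ω in E ∩ {ω | X ω = l}, g ω ∂Pr := by
  have h1 : ⋃ l, E ∩ {ω | X ω = l} = E := by ext ω; simp
  have h2 := lintegral_iUnion (μ := Pr) (fun l => hE.inter (hX (MeasurableSet.singleton l)))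
    (fun l k hlk => Set.disjoint_left.2 fun ω h1 h2 => hlk (h1.2.symm.trans h2.2)) g
  exact (congrArg (fun s => ∫⁻ ω in s, g ω ∂Pr) h1.symm).trans h2

-- `occupation` counts the steps `1, …` up to the return, whereas sojourns are counted from the
-- start of the cycle up to just before the return. The initial visit to `j` replaces the final one,
-- and both count once.
open Classical in
theorem IsMarkovRenewal.tsum_measure_firstHit_avoids (h : IsMarkovRenewal P F p Pr J T)
    (hE : ErgodicEnvironment P F μ) (j : S) (n : ℕ) (l : S) :
    ∑' i, Pr (firstHit J j n ∩ avoids J j n i ∩ {ω | J (n + i) ω = l})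
      = Pr (firstHit J j n) * occupation P j l := by
  rw [tsum_eq_zero_add' ENNReal.summable]
  have h0 : Pr (firstHit J j n ∩ avoids J j n 0 ∩ {ω | J (n + 0) ω = l})
      = if l = j then Pr (firstHit J j n) else 0 := by
    split_ifs with hl
    · congr 1; ext ω
      simp only [firstHit, avoids, mem_inter_iff, mem_ofPred_eq, hl]
      simp +contextual
    · convert measure_empty (μ := Pr)
      ext ω
      simp only [firstHit, mem_inter_iff, mem_ofPred_eq, mem_empty_iff_false, iff_false]
      rintro ⟨⟨⟨_, h1⟩, _⟩, h2⟩
      exact hl (h2.symm.trans h1)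
  have h1 : ∀ i, Pr (firstHit J j n ∩ avoids J j n (i + 1) ∩ {ω | J (n + (i + 1)) ω = l})
      = if l = j then 0 else Pr (firstHit J j n) * tabooVec P j (P j) i l := fun i => by
    split_ifs with hl
    · convert measure_empty (μ := Pr)
      ext ω
      simp only [avoids_succ, mem_inter_iff, mem_ofPred_eq, mem_empty_iff_false, iff_false]
      rintro ⟨⟨_, _, h1⟩, h2⟩
      rw [show n + 1 + i = n + (i + 1) by ring] at h1
      exact h1 (h2.trans hl)
    · rw [← h.measure_firstHit_avoids hE]
      congr 1; ext ω
      simp only [avoids_succ, mem_inter_iff, mem_ofPred_eq]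
      rw [show n + 1 + i = n + (i + 1) by ring]
      constructor
      · rintro ⟨⟨h1, h2, _⟩, h3⟩; exact ⟨⟨h1, h2⟩, h3⟩
      · rintro ⟨⟨h1, h2⟩, h3⟩; exact ⟨⟨h1, h2, fun h => hl (h3.symm.trans h)⟩, h3⟩
  simp_rw [h0, h1]
  split_ifs with hl
  · have : occupation P j l = 1 := by
      rw [hl]; exact tsum_tabooVec_self_of_recurrent P j (hE.recurrent j)
    simp [this]
  · rw [zero_add, ENNReal.tsum_mul_left, occupation]

/-- A cycle of `m + 1` steps contains the step `i < m + 1` exactly when `j` has been avoided for `i`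
steps; summing over `m` forgets how the cycle ends. -/
theorem IsMarkovRenewal.tsum_lintegral_cycleSet (h : IsMarkovRenewal P F p Pr J T)
    (hE : ErgodicEnvironment P F μ) (j : S) (n i : ℕ) (g : Ω → ℝ≥0∞) :
    ∑' m, (if i < m + 1 then ∫⁻ ω in cycleSet J j n m, g ω ∂Pr else 0)
      = ∫⁻ ω in firstHit J j n ∩ avoids J j n i, g ω ∂Pr := by
  have h1 : Pr.restrict (firstHit J j n ∩ avoids J j n i)
      = Measure.sum fun m => Pr.restrict (avoids J j n i ∩ cycleSet J j n m) := by
    rw [inter_comm, ← Measure.restrict_restrict (h.measurableSet_avoids j n i),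
      h.restrict_firstHit hE, Measure.restrict_sum _ (h.measurableSet_avoids j n i)]
    simp_rw [Measure.restrict_restrict (h.measurableSet_avoids j n i)]
  rw [h1, lintegral_sum_measure]
  refine tsum_congr fun m => ?_
  split_ifs with him
  · rw [inter_eq_right.2]
    intro ω hω k hk
    exact hω.1.2 k (by omega)
  · have : avoids J j n i ∩ cycleSet J j n m = ∅ := by
      ext ω
      simp only [mem_inter_iff, mem_empty_iff_false, iff_false]
      rintro ⟨h1, h2⟩
      exact h1 m (by omega) h2.2
    simp [this]

/-- The mean of an additive functional over a cycle. -/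
theorem IsMarkovRenewal.tsum_lintegral_sum (h : IsMarkovRenewal P F p Pr J T)
    (hE : ErgodicEnvironment P F μ) (j : S) (c : S → ℝ≥0∞) :
    ∑' n, ∑' m, ∫⁻ ω in cycleSet J j n m, ∑ i ∈ Finset.range (m + 1),
        c (J (n + i) ω) * ENNReal.ofReal (T (n + i + 1) ω) ∂Pr
      = ∑' l, occupation P j l * (c l * meanHolding P F l) := by
  have := hE.isFiniteMeasure
  have hcm : ∀ k, Measurable fun ω => c (J k ω) := fun k =>
    (Measurable.of_discrete (f := c)).comp (h.measurable_J k)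
  have hgm : ∀ k, Measurable fun ω => c (J k ω) * ENNReal.ofReal (T (k + 1) ω) := fun k =>
    (hcm k).mul (h.measurable_T (k + 1)).ennreal_ofReal
  have h1 : ∀ n m, ∫⁻ ω in cycleSet J j n m, ∑ i ∈ Finset.range (m + 1),
        c (J (n + i) ω) * ENNReal.ofReal (T (n + i + 1) ω) ∂Pr
      = ∑' i, if i < m + 1 then ∫⁻ ω in cycleSet J j n m,
        c (J (n + i) ω) * ENNReal.ofReal (T (n + i + 1) ω) ∂Pr else 0 := fun n m => by
    rw [lintegral_finsetSum _ fun i _ => hgm (n + i), tsum_eq_sum (s := Finset.range (m + 1))]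
    · exact Finset.sum_congr rfl fun i hi => by rw [if_pos (by simpa using hi)]
    · exact fun i hi => by rw [if_neg (by simpa using hi)]
  have h2 : ∀ n i, ∫⁻ ω in firstHit J j n ∩ avoids J j n i,
        c (J (n + i) ω) * ENNReal.ofReal (T (n + i + 1) ω) ∂Pr
      = ∑' l, Pr (firstHit J j n ∩ avoids J j n i ∩ {ω | J (n + i) ω = l})
          * (c l * meanHolding P F l) := fun n i => by
    rw [lintegral_eq_tsum_fiber (h.measurable_J (n + i))
      ((h.measurableSet_firstHit j n).inter (h.measurableSet_avoids j n i))]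
    refine tsum_congr fun l => ?_
    have hEm : MeasurableSet[history J T (n + i)] (firstHit J j n ∩ avoids J j n i) :=
      (history_mono (by omega) _ (measurableSet_history_firstHit j n)).inter
        (measurableSet_history_avoids j n i)
    have h3 := h.lintegral_sojourn hE hEm l ENNReal.measurable_ofReal
    rw [lintegral_ofReal_jumpLaw hE.jumpLaw_Iic] at h3
    rw [mul_left_comm, ← h3, ← lintegral_const_mul _ (h.measurable_T _).ennreal_ofReal]
    refine setLIntegral_congr_fun (((h.measurableSet_firstHit j n).inter
      (h.measurableSet_avoids j n i)).inter (h.measurable_J _ (MeasurableSet.singleton l)))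
      fun ω hω => ?_
    simp only [show J (n + i) ω = l from hω.2]
  simp_rw [h1]
  have h4 : ∀ n, (∑' m, ∑' i, if i < m + 1 then ∫⁻ ω in cycleSet J j n m,
        c (J (n + i) ω) * ENNReal.ofReal (T (n + i + 1) ω) ∂Pr else 0)
      = ∑' l, Pr (firstHit J j n) * (occupation P j l * (c l * meanHolding P F l)) := fun n => by
    rw [ENNReal.tsum_comm]
    simp_rw [h.tsum_lintegral_cycleSet hE, h2]
    rw [ENNReal.tsum_comm]
    refine tsum_congr fun l => ?_
    rw [ENNReal.tsum_mul_right, h.tsum_measure_firstHit_avoids hE, mul_assoc]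
  simp_rw [h4]
  rw [ENNReal.tsum_comm]
  refine tsum_congr fun l => ?_
  rw [ENNReal.tsum_mul_right, h.tsum_firstHit hE.jumpLaw_univ hE.irreducible (hE.recurrent j),
    one_mul]

/-- The sojourn at `j` is a part of the cycle at `j`. -/
theorem IsMarkovRenewal.holdTail_le (h : IsMarkovRenewal P F p Pr J T)
    (hE : ErgodicEnvironment P F μ) (j : S) (x : ℝ) :
    holdTail P F j x ≤ tailFn ((cycleMeas P F a b j).map Aff.time) x := by
  have := hE.isFiniteMeasure
  rw [holdTail, tailFn]
  split_ifs with hx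
  swap
  · rfl
  rw [Measure.map_apply Aff.measurable_time measurableSet_Ioi,
    ← lintegral_indicator_one (Aff.measurable_time measurableSet_Ioi),
    h.lintegral_cycleMeas hE j (measurable_one.indicator (Aff.measurable_time measurableSet_Ioi))]
  have h1 : ∀ n, ∫⁻ ω in firstHit J j n, (Ioi x).indicator 1 (T (n + 1) ω) ∂Pr
      = Pr (firstHit J j n) * ∑' k, jumpLaw P F j k (Ioi x) := fun n => by
    have h2 := h.lintegral_sojourn hE (measurableSet_history_firstHit j n) j
      (g := (Ioi x).indicator 1) (measurable_one.indicator measurableSet_Ioi)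
    rw [inter_eq_left.2 (fun ω hω => hω.2)] at h2
    rw [h2]
    simp_rw [lintegral_indicator_one measurableSet_Ioi]
  calc ∑' k, jumpLaw P F j k (Ioi x)
      = ∑' n, ∫⁻ ω in firstHit J j n, (Ioi x).indicator 1 (T (n + 1) ω) ∂Pr := by
        simp_rw [h1]
        rw [ENNReal.tsum_mul_right,
          h.tsum_firstHit hE.jumpLaw_univ hE.irreducible (hE.recurrent j), one_mul]
    _ = ∑' n, ∑' m, ∫⁻ ω in cycleSet J j n m, (Ioi x).indicator 1 (T (n + 1) ω) ∂Pr := by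
        simp_rw [h.restrict_firstHit hE, lintegral_sum_measure]
    _ ≤ _ := by
        refine ENNReal.tsum_le_tsum fun n => ENNReal.tsum_le_tsum fun m => lintegral_mono_ae ?_
        filter_upwards [ae_restrict_of_ae (ae_all_iff.2 (h.ae_pos hE))] with ω hω
        have h2 : T (n + 1) ω ≤ (affWalk a b J T n (m + 1) ω).time := by
          rw [time_affWalk, ← add_assoc, jumpTime, jumpTime, Finset.sum_range_succ' _ (n + m + 1),
            Finset.sum_range_succ' _ n]
          have h3 : ∑ k ∈ Finset.range (n + 1), T (k + 1) ω
              ≤ ∑ k ∈ Finset.range (n + m + 1), T (k + 1) ω :=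
            Finset.sum_le_sum_of_subset_of_nonneg (by simp) fun k _ _ => (hω k).le
          rw [Finset.sum_range_succ] at h3
          linarith
        by_cases hT : x < T (n + 1) ω
        · rw [indicator_of_mem (show T (n + 1) ω ∈ Ioi x from hT),
            indicator_of_mem (show affWalk a b J T n (m + 1) ω ∈ Aff.time ⁻¹' Ioi x from
              hT.trans_le h2)]
          rfl
        · rw [indicator_of_notMem (show T (n + 1) ω ∉ Ioi x from hT)]
          exact zero_le

theorem ae_time_pos_tabooMeas (hE : ErgodicEnvironment P F μ) (j : S) (m : ℕ) (k : S) :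
    ∀ᵐ x ∂(tabooMeas P F a b j m k), 0 < x.time := by
  have := hE.isFiniteMeasure
  have hm : MeasurableSet {x : Aff | 0 < x.time} := measurableSet_lt measurable_const (by fun_prop)
  have hstep : ∀ l k, ∀ᵐ x ∂(stepMeas P F a b l k), 0 < x.time := fun l k => by
    rw [stepMeas, ae_map_iff (by fun_prop) hm, ae_iff]
    refine measure_mono_null (fun t ht => ?_) (hE.jumpLaw_Iic l k)
    simpa [sojournMap] using ht
  induction m generalizing k with
  | zero => exact hstep j k
  | succ m ih =>
    rw [tabooMeas, Measure.ae_sum_iff' hm]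
    intro l
    split_ifs
    · simp
    · rw [Measure.mconv, ae_map_iff (by fun_prop) hm]
      filter_upwards [Measure.quasiMeasurePreserving_fst.ae (hstep l k),
        Measure.quasiMeasurePreserving_snd.ae (ih l)] with x h1 h2
      exact add_pos h1 h2

/-- Given the other factor, the time is a translate of one absolutely continuous sojourn, and
translates of null sets are null. -/
theorem absolutelyContinuous_tabooMeas (hE : ErgodicEnvironment P F μ) (j : S) (m : ℕ) (k : S) :
    (tabooMeas P F a b j m k).map Aff.time ≪ volume := by
  have := hE.isFiniteMeasure
  have hstep : ∀ l k, (stepMeas P F a b l k).map Aff.time ≪ volume := fun l k => by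
    rw [stepMeas, Measure.map_map (by fun_prop) (by fun_prop)]
    have : Aff.time ∘ sojournMap a b l = id := rfl
    rw [this, Measure.map_id]
    exact hE.jumpLaw_ac l k
  induction m generalizing k with
  | zero => exact hstep j k
  | succ m ih =>
    refine Measure.AbsolutelyContinuous.mk fun N hN hN0 => ?_
    rw [Measure.map_apply Aff.measurable_time hN, tabooMeas,
      Measure.sum_apply _ (Aff.measurable_time hN), ENNReal.tsum_eq_zero]
    intro l
    split_ifs
    · simp
    · have h1 : ∀ y : Aff, stepMeas P F a b l k
          ((fun x => (x, y)) ⁻¹' ((fun z : Aff × Aff => z.1 * z.2) ⁻¹' (Aff.time ⁻¹' N))) = 0 := by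
        intro y
        have h2 : (stepMeas P F a b l k).map Aff.time ((fun x => x + y.time) ⁻¹' N) = 0 :=
          hstep l k (by rwa [measure_preimage_add_right])
        rwa [Measure.map_apply Aff.measurable_time (measurable_add_const y.time hN)] at h2
      rw [Measure.mconv, Measure.map_apply measurable_mul (Aff.measurable_time hN),
        Measure.prod_apply_symm (measurable_mul (Aff.measurable_time hN))]
      simp only [h1, lintegral_zero]

theorem map_time_cycleMeas_Iic (hE : ErgodicEnvironment P F μ) (j : S) :
    (cycleMeas P F a b j).map Aff.time (Iic 0) = 0 := by
  rw [Measure.map_apply Aff.measurable_time measurableSet_Iic, cycleMeas,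
    Measure.sum_apply _ (Aff.measurable_time measurableSet_Iic), ENNReal.tsum_eq_zero]
  intro m
  refine measure_mono_null (fun x hx => ?_) (ae_iff.1 (ae_time_pos_tabooMeas hE j m j))
  simpa using hx

theorem absolutelyContinuous_cycleMeas (hE : ErgodicEnvironment P F μ) (j : S) :
    (cycleMeas P F a b j).map Aff.time ≪ volume := by
  rw [cycleMeas, Measure.map_sum Aff.measurable_time.aemeasurable]
  exact Measure.absolutelyContinuous_sum_left fun m => absolutelyContinuous_tabooMeas hE j m j

/-- The mean length of a cycle. -/
theorem IsMarkovRenewal.lintegral_time_cycleMeas (h : IsMarkovRenewal P F p Pr J T)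
    (hE : ErgodicEnvironment P F μ) (j : S) :
    ∫⁻ x, tailFn ((cycleMeas P F a b j).map Aff.time) x
      = ∑' l, occupation P j l * meanHolding P F l := by
  have := hE.isFiniteMeasure
  have h1 := h.tsum_lintegral_sum hE j fun _ => 1
  simp only [one_mul] at h1
  have h2 : ∫⁻ x, tailFn ((cycleMeas P F a b j).map Aff.time) x
      = ∫⁻ t, ENNReal.ofReal t ∂((cycleMeas P F a b j).map Aff.time) := by
    rw [lintegral_eq_lintegral_meas_lt (f := fun t => t) _ ?_ aemeasurable_id,
      restrict_Ioi_eq_restrict_Ici, ← lintegral_indicator measurableSet_Ici]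
    · refine lintegral_congr fun x => ?_
      rw [tailFn, indicator_apply]
      rfl
    · rw [Filter.EventuallyLE, ae_iff]
      refine measure_mono_null (fun t ht => ?_) (map_time_cycleMeas_Iic hE j)
      simp only [Pi.zero_apply, not_le, mem_ofPred_eq] at ht
      exact ht.le
  rw [h2, lintegral_map ENNReal.measurable_ofReal Aff.measurable_time,
    h.lintegral_cycleMeas hE j (by fun_prop), ← h1]
  refine tsum_congr fun n => tsum_congr fun m => lintegral_congr_ae ?_
  filter_upwards [ae_restrict_of_ae (ae_all_iff.2 (h.ae_pos hE))] with ω hω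
  rw [← ENNReal.ofReal_sum_of_nonneg fun i _ => (hω (n + i)).le, time_affWalk, jumpTime, jumpTime,
    show n + (m + 1) + 1 = n + 1 + (m + 1) by ring, Finset.sum_range_add, add_sub_cancel_left]
  congr 1
  refine Finset.sum_congr rfl fun i _ => ?_
  congr 1; ring

/-- The mean of the rate over a cycle. -/
theorem IsMarkovRenewal.rate_cycleMeas (h : IsMarkovRenewal P F p Pr J T)
    (hE : ErgodicEnvironment P F μ) (j : S)
    (hfin : ∑' l, occupation P j l * (ENNReal.ofReal |a l| * meanHolding P F l) ≠ ∞)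
    (hlt : ∑' l, occupation P j l * (ENNReal.ofReal (-a l) * meanHolding P F l)
      < ∑' l, occupation P j l * (ENNReal.ofReal (a l) * meanHolding P F l)) :
    Integrable Aff.rate (cycleMeas P F a b j) ∧ 0 < ∫ x, x.rate ∂(cycleMeas P F a b j) := by
  have hint : Integrable Aff.rate (cycleMeas P F a b j) := by
    refine ⟨Aff.measurable_rate.aestronglyMeasurable, ?_⟩
    rw [HasFiniteIntegral, h.lintegral_cycleMeas hE j (by fun_prop)]
    refine lt_of_le_of_lt ?_ hfin.lt_top
    rw [← h.tsum_lintegral_sum hE j fun l => ENNReal.ofReal |a l|]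
    refine ENNReal.tsum_le_tsum fun n => ENNReal.tsum_le_tsum fun m => lintegral_mono_ae ?_
    filter_upwards [ae_restrict_of_ae (ae_all_iff.2 (h.ae_pos hE))] with ω hω
    rw [rate_affWalk, ← ofReal_norm, Real.norm_eq_abs]
    refine (ENNReal.ofReal_le_ofReal (Finset.abs_sum_le_sum_abs _ _)).trans ?_
    rw [ENNReal.ofReal_sum_of_nonneg fun i _ => abs_nonneg _]
    refine Finset.sum_le_sum fun i _ => ?_
    rw [abs_mul, ENNReal.ofReal_mul (abs_nonneg _), abs_of_pos (hω (n + i))]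
  refine ⟨hint, ?_⟩
  -- Pathwise, the rate plus the negative part of the additive functional equals its positive part.
  -- The identity is arranged so that no subtraction occurs in `ℝ≥0∞`.
  have hkey : ∫⁻ x, ENNReal.ofReal x.rate ∂(cycleMeas P F a b j)
        + ∑' l, occupation P j l * (ENNReal.ofReal (-a l) * meanHolding P F l)
      = ∫⁻ x, ENNReal.ofReal (-x.rate) ∂(cycleMeas P F a b j)
        + ∑' l, occupation P j l * (ENNReal.ofReal (a l) * meanHolding P F l) := by
    rw [h.lintegral_cycleMeas hE j (by fun_prop), h.lintegral_cycleMeas hE j (by fun_prop),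
      ← h.tsum_lintegral_sum hE j, ← h.tsum_lintegral_sum hE j, ← ENNReal.tsum_add,
      ← ENNReal.tsum_add]
    refine tsum_congr fun n => ?_
    rw [← ENNReal.tsum_add, ← ENNReal.tsum_add]
    refine tsum_congr fun m => ?_
    have hm : Measurable fun ω => (affWalk a b J T n (m + 1) ω).rate :=
      Aff.measurable_rate.comp (h.measurable_affWalk n (m + 1))
    rw [← lintegral_add_left hm.ennreal_ofReal, ← lintegral_add_left (f := fun ω => ENNReal.ofReal (-(affWalk a b J T n (m + 1) ω).rate))
        hm.neg.ennreal_ofReal]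
    refine lintegral_congr_ae ?_
    filter_upwards [ae_restrict_of_ae (ae_all_iff.2 (h.ae_pos hE))] with ω hω
    have h1 : ∀ c : S → ℝ, ∑ i ∈ Finset.range (m + 1),
          ENNReal.ofReal (c (J (n + i) ω)) * ENNReal.ofReal (T (n + i + 1) ω)
        = ENNReal.ofReal (∑ i ∈ Finset.range (m + 1),
          max (c (J (n + i) ω)) 0 * T (n + i + 1) ω) := fun c => by
      rw [ENNReal.ofReal_sum_of_nonneg fun i _ => mul_nonneg (le_max_right _ _) (hω (n + i)).le]
      refine Finset.sum_congr rfl fun i _ => ?_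
      rw [ENNReal.ofReal_mul (le_max_right _ _)]
      congr 1
      rw [ENNReal.ofReal_max, ENNReal.ofReal_zero, max_eq_left zero_le]
    have hp : ∀ c : S → ℝ, 0 ≤ ∑ i ∈ Finset.range (m + 1),
          max (c (J (n + i) ω)) 0 * T (n + i + 1) ω := fun c =>
      Finset.sum_nonneg fun i _ => mul_nonneg (le_max_right _ _) (hω (n + i)).le
    have h2 : (affWalk a b J T n (m + 1) ω).rate
        + ∑ i ∈ Finset.range (m + 1), max (-a (J (n + i) ω)) 0 * T (n + i + 1) ω
        = ∑ i ∈ Finset.range (m + 1), max (a (J (n + i) ω)) 0 * T (n + i + 1) ω := by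
      rw [rate_affWalk, ← Finset.sum_add_distrib]
      refine Finset.sum_congr rfl fun i _ => ?_
      rw [← add_mul]
      congr 1
      rcases le_total (a (J (n + i) ω)) 0 with h0 | h0
      · rw [max_eq_right h0, max_eq_left (by linarith)]; ring
      · rw [max_eq_left h0, max_eq_right (by linarith)]; ring
    rw [h1 a, h1 fun l => -a l]
    have hp1 := hp a
    have hp2 := hp fun l => -a l
    set r := (affWalk a b J T n (m + 1) ω).rate
    rcases le_total r 0 with hr | hr
    · rw [ENNReal.ofReal_of_nonpos hr, zero_add, ← ENNReal.ofReal_add (by linarith) hp1, ← h2]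
      congr 1; ring
    · rw [ENNReal.ofReal_of_nonpos (neg_nonpos.2 hr), zero_add, ← ENNReal.ofReal_add hr hp2, ← h2]
  have hf1 : ∫⁻ x, ENNReal.ofReal x.rate ∂(cycleMeas P F a b j) ≠ ∞ :=
    ((lintegral_mono fun x => Real.ofReal_le_enorm _).trans_lt hint.2).ne
  have hf2 : ∫⁻ x, ENNReal.ofReal (-x.rate) ∂(cycleMeas P F a b j) ≠ ∞ :=
    ((lintegral_mono fun x => Real.ofReal_le_enorm _).trans_lt hint.neg.2).ne
  rw [integral_eq_lintegral_pos_part_sub_lintegral_neg_part hint, sub_pos]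
  refine (ENNReal.toReal_lt_toReal hf2 hf1).2 ?_
  by_contra! hc
  have h3 := ENNReal.add_lt_add_of_le_of_lt hf1 hc hlt
  exact h3.ne hkey

end CycleMoments

/-! ### Cycles and the limit weights -/

section Weights

variable {S : Type*} [Countable S] [MeasurableSpace S] [DiscreteMeasurableSpace S]
  {Ω : Type*} [MeasurableSpace Ω] {P : S → PMF S} {F : S → S → Measure ℝ} {μ p : PMF S}
  {Pr : Measure Ω} [IsProbabilityMeasure Pr] {J : ℕ → Ω → S} {T : ℕ → Ω → ℝ} {a b : S → ℝ}

/-- The mean length of a cycle at `j`. -/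
def cycleMean (P : S → PMF S) (F : S → S → Measure ℝ) (j : S) : ℝ≥0∞ :=
  ∑' l, occupation P j l * meanHolding P F l

/-- Proportionality of `μ` to the occupation of a cycle turns the normalisation of `π` into a mean
cycle length, up to the factor `μ j`. -/
theorem ErgodicEnvironment.mul_cycleMean (hE : ErgodicEnvironment P F μ) (j : S) :
    ∑' k, μ k * meanHolding P F k = μ j * cycleMean P F j := by
  rw [cycleMean, ← ENNReal.tsum_mul_left]
  refine tsum_congr fun k => ?_
  rw [hE.stationary.eq_mul_occupation hE.irreducible (hE.recurrent j) k, mul_assoc]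

theorem ErgodicEnvironment.meanHolding_le (hE : ErgodicEnvironment P F μ) :
    ∃ C : ℝ≥0, ∀ l, meanHolding P F l ≤ C := by
  obtain ⟨C, hC⟩ := hE.bounded_mean
  refine ⟨C, fun l => ?_⟩
  calc meanHolding P F l ≤ ∑' k, P l k * C := ENNReal.tsum_le_tsum fun k => by
        by_cases h0 : P l k = 0
        · simp [h0]
        · gcongr; exact hC l k h0
    _ = C := by rw [ENNReal.tsum_mul_right, (P l).tsum_coe, one_mul]

theorem ErgodicEnvironment.meanHolding_ne_top (hE : ErgodicEnvironment P F μ) (l : S) :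
    meanHolding P F l ≠ ∞ := by
  obtain ⟨C, hC⟩ := hE.meanHolding_le
  exact ne_top_of_le_ne_top ENNReal.coe_ne_top (hC l)

theorem ErgodicEnvironment.meanHolding_ne_zero (hE : ErgodicEnvironment P F μ) (l : S) :
    meanHolding P F l ≠ 0 := by
  obtain ⟨k, hk⟩ := (P l).support_nonempty
  have hk : P l k ≠ 0 := hk
  rw [← lintegral_ofReal_jumpLaw hE.jumpLaw_Iic]
  intro h0
  have h1 := ENNReal.tsum_eq_zero.1 h0 k
  rw [lintegral_eq_zero_iff ENNReal.measurable_ofReal] at h1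
  have h2 : ∀ᵐ t ∂(jumpLaw P F l k), 0 < t := by
    rw [ae_iff]; simpa [← Set.Iic_def] using hE.jumpLaw_Iic l k
  have h3 : ∀ᵐ t ∂(jumpLaw P F l k), False := by
    filter_upwards [h1, h2] with t h3 h4
    exact (ENNReal.ofReal_pos.2 h4).ne' h3
  have h4 : jumpLaw P F l k univ = 0 := by simpa [ae_iff] using h3
  exact hk ((hE.jumpLaw_univ l k).symm.trans h4)

/-- The stationary mean holding time is finite by the uniform bound on the mean sojourn times, and
it is the cycle mean times the nonzero mass `μ j`. -/
theorem ErgodicEnvironment.cycleMean_ne_top (hE : ErgodicEnvironment P F μ) (j : S) :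
    cycleMean P F j ≠ ∞ := by
  intro h0
  have h1 := hE.mul_cycleMean j
  rw [h0, ENNReal.mul_top (hE.stationary.apply_ne_zero hE.irreducible j)] at h1
  obtain ⟨C, hC⟩ := hE.meanHolding_le
  refine ne_top_of_le_ne_top (b := (C : ℝ≥0∞)) ENNReal.coe_ne_top ?_ h1
  calc ∑' k, μ k * meanHolding P F k ≤ ∑' k, μ k * C :=
        ENNReal.tsum_le_tsum fun k => mul_le_mul_right (hC k) _
    _ = C := by rw [ENNReal.tsum_mul_right, μ.tsum_coe, one_mul]

theorem ErgodicEnvironment.cycleMean_ne_zero (hE : ErgodicEnvironment P F μ) (j : S) :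
    cycleMean P F j ≠ 0 := by
  intro h0
  have h1 := ENNReal.tsum_eq_zero.1 h0 j
  have h2 : occupation P j j = 1 := tsum_tabooVec_self_of_recurrent P j (hE.recurrent j)
  rw [h2, one_mul] at h1
  exact hE.meanHolding_ne_zero j h1

theorem ErgodicEnvironment.limitWeight_eq (hE : ErgodicEnvironment P F μ) (j l : S) :
    limitWeight P F μ l = occupation P j l * meanHolding P F l / cycleMean P F j := by
  rw [limitWeight, hE.mul_cycleMean j,
    hE.stationary.eq_mul_occupation hE.irreducible (hE.recurrent j) l, mul_assoc,
    ENNReal.mul_div_mul_left _ _ (hE.stationary.apply_ne_zero hE.irreducible j) (μ.apply_ne_top j)]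

theorem ErgodicEnvironment.limitWeight_self (hE : ErgodicEnvironment P F μ) (j : S) :
    limitWeight P F μ j = meanHolding P F j / cycleMean P F j := by
  have h2 : occupation P j j = 1 := tsum_tabooVec_self_of_recurrent P j (hE.recurrent j)
  rw [hE.limitWeight_eq j, h2, one_mul]

theorem ErgodicEnvironment.tsum_limitWeight (hE : ErgodicEnvironment P F μ) :
    ∑' j, limitWeight P F μ j = 1 := by
  obtain ⟨j, _⟩ := μ.support_nonempty
  simp_rw [hE.limitWeight_eq j, div_eq_mul_inv]
  rw [ENNReal.tsum_mul_right]
  exact ENNReal.mul_inv_cancel (hE.cycleMean_ne_zero j) (hE.cycleMean_ne_top j)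

theorem ErgodicEnvironment.isProbabilityMeasure_limitLaw (hE : ErgodicEnvironment P F μ) :
    IsProbabilityMeasure (limitLaw P F μ) := by
  refine ⟨?_⟩
  rw [limitLaw, Measure.sum_apply _ MeasurableSet.univ]
  simpa using hE.tsum_limitWeight

theorem lintegral_limitLaw (c : S → ℝ≥0∞) :
    ∫⁻ l, c l ∂(limitLaw P F μ) = ∑' l, limitWeight P F μ l * c l := by
  rw [limitLaw, lintegral_sum_measure]
  simp

/-- The renewal-reward formula: applied to the positive and negative parts of `a`, it translates the
sign of `E_π a` into the sign of the mean rate over a cycle. -/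
theorem ErgodicEnvironment.tsum_occupation (hE : ErgodicEnvironment P F μ) (j : S)
    (c : S → ℝ≥0∞) :
    ∑' l, occupation P j l * (c l * meanHolding P F l)
      = cycleMean P F j * ∫⁻ l, c l ∂(limitLaw P F μ) := by
  rw [lintegral_limitLaw, ← ENNReal.tsum_mul_left]
  refine tsum_congr fun l => ?_
  rw [hE.limitWeight_eq j, ← mul_assoc, ← mul_assoc (cycleMean P F j), ENNReal.mul_div_cancel
    (hE.cycleMean_ne_zero j) (hE.cycleMean_ne_top j)]
  ring

theorem ErgodicEnvironment.isProbabilityMeasure_cycleMeas (hE : ErgodicEnvironment P F μ) (j : S) :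
    IsProbabilityMeasure (cycleMeas P F a b j) := by
  have := hE.isFiniteMeasure
  exact SemiMarkov.isProbabilityMeasure_cycleMeas hE.jumpLaw_univ (hE.recurrent j)

theorem IsMarkovRenewal.contractive (h : IsMarkovRenewal P F p Pr J T)
    (hE : ErgodicEnvironment P F μ) (hne : NonExplosive Pr T)
    (ha_int : Integrable a (limitLaw P F μ)) (ha_pos : 0 < ∫ i, a i ∂(limitLaw P F μ)) {j : S}
    (hb : Integrable (fun ω => Real.posLog |(cyclePair a b J T j ω).2|) Pr) :
    Contractive (cycleMeas P F a b j) := by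
  have hf1 : ∫⁻ l, ENNReal.ofReal (a l) ∂(limitLaw P F μ) ≠ ∞ :=
    ((lintegral_mono fun x => Real.ofReal_le_enorm _).trans_lt ha_int.2).ne
  have hf2 : ∫⁻ l, ENNReal.ofReal (-a l) ∂(limitLaw P F μ) ≠ ∞ :=
    ((lintegral_mono fun x => Real.ofReal_le_enorm _).trans_lt ha_int.neg.2).ne
  have h1 := h.rate_cycleMeas (a := a) (b := b) hE j (by
      rw [hE.tsum_occupation j fun l => ENNReal.ofReal |a l|]
      refine ENNReal.mul_ne_top (hE.cycleMean_ne_top j) ?_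
      have := ha_int.2
      simp_rw [HasFiniteIntegral, ← ofReal_norm, Real.norm_eq_abs] at this
      exact this.ne) (by
      rw [hE.tsum_occupation j fun l => ENNReal.ofReal (-a l),
        hE.tsum_occupation j fun l => ENNReal.ofReal (a l)]
      refine (ENNReal.mul_lt_mul_iff_right (hE.cycleMean_ne_zero j) (hE.cycleMean_ne_top j)).2 ?_
      rw [integral_eq_lintegral_pos_part_sub_lintegral_neg_part ha_int, sub_pos] at ha_pos
      exact (ENNReal.toReal_lt_toReal hf2 hf1).1 ha_pos)
  refine ⟨h1.1, h1.2, ?_⟩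
  obtain ⟨hae, hmap⟩ := h.map_cyclePair (a := a) (b := b) hE hne j
  have hm : Measurable fun q : ℝ × ℝ => Real.posLog |q.2| :=
    Real.continuous_posLog.measurable.comp (by fun_prop)
  have h2 := (integrable_map_measure hm.aestronglyMeasurable hae).2 hb
  rw [hmap, slopeShiftLaw, integrable_map_measure hm.aestronglyMeasurable
    (by fun_prop : Measurable _).aemeasurable] at h2
  exact h2

end Weights

/-! ### The renewal argument along the path -/

section State

variable {S : Type*} {Ω : Type*}

/-- The age of the current sojourn at time `t`, the discount and the perpetuity at the last jump,
and the current state. -/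
def stateAt (a b : S → ℝ) (J : ℕ → Ω → S) (T : ℕ → Ω → ℝ) (t : ℝ) (ω : Ω) : ℝ × ℝ × ℝ × S :=
  (t - jumpTime T (jumpCount T t ω) ω,
    Real.exp (-(affWalk a b J T 0 (jumpCount T t ω) ω).rate),
    (affWalk a b J T 0 (jumpCount T t ω) ω).shift, semiMarkov J T t ω)

variable {J : ℕ → Ω → S} {T : ℕ → Ω → ℝ} {a b : S → ℝ}

/-- The event that `t` lies in the sojourn after the `n`-th jump. -/
def sojournSet (T : ℕ → Ω → ℝ) (t : ℝ) (n : ℕ) : Set Ω :=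
  {ω | jumpTime T n ω ≤ t ∧ t < jumpTime T (n + 1) ω}

theorem RegularPath.stateAt_eq {ω : Ω} (h : RegularPath T ω) {t : ℝ} {n : ℕ}
    (hω : ω ∈ sojournSet T t n) :
    stateAt a b J T t ω = (t - (affWalk a b J T 0 n ω).time,
      Real.exp (-(affWalk a b J T 0 n ω).rate), (affWalk a b J T 0 n ω).shift, J n ω) := by
  rw [stateAt, h.jumpCount_eq hω.1 hω.2, h.semiMarkov_eq hω.1 hω.2, time_affWalk, zero_add,
    h.jumpTime_zero, sub_zero]

end State

/-! ### Expectations at time `t` as sums over the visits to a state. -/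

section PathFormula

variable {S : Type*} [Countable S] [MeasurableSpace S] [DiscreteMeasurableSpace S]
  {Ω : Type*} [MeasurableSpace Ω] {P : S → PMF S} {F : S → S → Measure ℝ} {μ p : PMF S}
  {Pr : Measure Ω} [IsProbabilityMeasure Pr] {J : ℕ → Ω → S} {T : ℕ → Ω → ℝ} {a b : S → ℝ}

theorem IsMarkovRenewal.measurable_jumpTime (h : IsMarkovRenewal P F p Pr J T) (n : ℕ) :
    Measurable (jumpTime T n) :=
  Finset.measurable_sum _ fun k _ => h.measurable_T k

theorem IsMarkovRenewal.measurableSet_sojournSet (h : IsMarkovRenewal P F p Pr J T) (t : ℝ)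
    (n : ℕ) : MeasurableSet (sojournSet T t n) :=
  (measurableSet_le (h.measurable_jumpTime n) measurable_const).inter
    (measurableSet_lt measurable_const (h.measurable_jumpTime (n + 1)))

/-- On a regular path exactly one sojourn contains `t`. The sets are disjoint only almost surely,
since the jump times need not increase on the exceptional set. -/
theorem IsMarkovRenewal.eq_sum_restrict_sojournSet (h : IsMarkovRenewal P F p Pr J T)
    (hE : ErgodicEnvironment P F μ) (hne : NonExplosive Pr T) {t : ℝ} (ht : 0 ≤ t) :
    Pr = Measure.sum fun n => Pr.restrict (sojournSet T t n) := by
  have hreg := h.ae_regularPath hE hne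
  have h1 : Pr = Pr.restrict (⋃ n, sojournSet T t n) := by
    conv_lhs => rw [← Measure.restrict_univ (μ := Pr)]
    refine Measure.restrict_congr_set ?_
    filter_upwards [hreg] with ω hω
    exact propext ⟨fun _ => mem_iUnion.2 ⟨_, hω.jumpTime_jumpCount ht⟩, fun _ => trivial⟩
  conv_lhs => rw [h1]
  refine Measure.restrict_iUnion_ae (fun i k hik => ?_)
    fun n => (h.measurableSet_sojournSet t n).nullMeasurableSet
  have h2 : ∀ᵐ ω ∂Pr, ω ∉ sojournSet T t i ∩ sojournSet T t k := by
    filter_upwards [hreg] with ω hω h3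
    exact hik (by rw [← hω.jumpCount_eq h3.1.1 h3.1.2, ← hω.jumpCount_eq h3.2.1 h3.2.2])
  exact measure_mono_null (fun ω hω => not_not.2 hω) (ae_iff.1 h2)

theorem IsMarkovRenewal.ae_restrict_stateAt (h : IsMarkovRenewal P F p Pr J T)
    (hE : ErgodicEnvironment P F μ) (hne : NonExplosive Pr T) (t : ℝ) (n : ℕ) :
    ∀ᵐ ω ∂(Pr.restrict (sojournSet T t n)), RegularPath T ω ∧ ω ∈ sojournSet T t n := by
  filter_upwards [ae_restrict_of_ae (h.ae_regularPath hE hne),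
    ae_restrict_mem (h.measurableSet_sojournSet t n)] with ω h1 h2 using ⟨h1, h2⟩

theorem IsMarkovRenewal.aemeasurable_stateAt (h : IsMarkovRenewal P F p Pr J T)
    (hE : ErgodicEnvironment P F μ) (hne : NonExplosive Pr T) {t : ℝ} (ht : 0 ≤ t) :
    AEMeasurable (stateAt a b J T t) Pr := by
  rw [h.eq_sum_restrict_sojournSet hE hne ht]
  refine aemeasurable_sum_measure_iff.2 fun n => ⟨fun ω => (t - (affWalk a b J T 0 n ω).time,
      Real.exp (-(affWalk a b J T 0 n ω).rate), (affWalk a b J T 0 n ω).shift, J n ω), ?_, ?_⟩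
  · have hw := h.measurable_affWalk (a := a) (b := b) 0 n
    exact ((by fun_prop : Measurable fun x : Aff => t - x.time).comp hw).prodMk
      (((by fun_prop : Measurable fun x : Aff => Real.exp (-x.rate)).comp hw).prodMk
        ((Aff.measurable_shift.comp hw).prodMk (h.measurable_J n)))
  · filter_upwards [h.ae_restrict_stateAt hE hne t n] with ω hω
    exact hω.1.stateAt_eq hω.2

/-- The contribution of a last jump with composition `x` to an expectation at time `t`. -/
def lastJump (P : S → PMF S) (F : S → S → Measure ℝ) (j : S) (f : ℝ × ℝ × ℝ → ℝ≥0∞) (t : ℝ)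
    (x : Aff) : ℝ≥0∞ :=
  holdTail P F j (t - x.time) * f (t - x.time, Real.exp (-x.rate), x.shift)

theorem measurable_lastJump (j : S) {f : ℝ × ℝ × ℝ → ℝ≥0∞} (hf : Measurable f) (t : ℝ) :
    Measurable (lastJump P F j f t) :=
  ((measurable_holdTail j).comp (by fun_prop)).mul (hf.comp (by fun_prop))

/-- The `n`-th jump is the last one before `t` when its time is at most `t` and the next sojourn
exceeds the age. That sojourn is independent of the past given the state `j`, and integrating it out
leaves `holdTail` at the age. -/
theorem IsMarkovRenewal.lintegral_inter_sojournSet (h : IsMarkovRenewal P F p Pr J T)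
    (hE : ErgodicEnvironment P F μ) (j : S) {f : ℝ × ℝ × ℝ → ℝ≥0∞} (hf : Measurable f)
    (t : ℝ) (n : ℕ) :
    ∫⁻ ω in sojournSet T t n ∩ {ω | J n ω = j}, f (t - (affWalk a b J T 0 n ω).time,
        Real.exp (-(affWalk a b J T 0 n ω).rate), (affWalk a b J T 0 n ω).shift) ∂Pr
      = ∫⁻ x, lastJump P F j f t x ∂(visitMeas Pr J T a b j n) := by
  have := hE.isFiniteMeasure
  have hw := h.measurable_affWalk (a := a) (b := b) 0 n
  have hwh : Measurable[history J T n] (affWalk a b J T 0 n) := by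
    have := measurable_history_affWalk a b J T 0 n
    rwa [zero_add] at this
  have hJ : MeasurableSet {ω | J n ω = j} := h.measurable_J n (MeasurableSet.singleton j)
  let G : Aff × ℝ → ℝ≥0∞ := {q : Aff × ℝ | q.1.time ≤ t ∧ t - q.1.time < q.2}.indicator
    fun q => f (t - q.1.time, Real.exp (-q.1.rate), q.1.shift)
  have hGs : MeasurableSet {q : Aff × ℝ | q.1.time ≤ t ∧ t - q.1.time < q.2} :=
    (measurableSet_le (f := fun q : Aff × ℝ => q.1.time) (by fun_prop) measurable_const).inter
      (measurableSet_lt (f := fun q : Aff × ℝ => t - q.1.time) (g := fun q => q.2)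
        (by fun_prop) (by fun_prop))
  have hG : Measurable G := Measurable.indicator (by fun_prop) hGs
  have h1 : ∫⁻ ω in sojournSet T t n ∩ {ω | J n ω = j}, f (t - (affWalk a b J T 0 n ω).time,
        Real.exp (-(affWalk a b J T 0 n ω).rate), (affWalk a b J T 0 n ω).shift) ∂Pr
      = ∫⁻ ω in {ω | J n ω = j}, G (affWalk a b J T 0 n ω, T (n + 1) ω) ∂Pr := by
    rw [← Measure.restrict_restrict (h.measurableSet_sojournSet t n),
      ← lintegral_indicator (h.measurableSet_sojournSet t n)]
    refine lintegral_congr_ae ?_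
    filter_upwards [ae_restrict_of_ae (h.T_zero)] with ω hω
    have h2 : (affWalk a b J T 0 n ω).time = jumpTime T n ω := by
      rw [time_affWalk, zero_add]; simp [jumpTime, hω]
    have h3 : ω ∈ sojournSet T t n ↔ (affWalk a b J T 0 n ω, T (n + 1) ω)
        ∈ {q : Aff × ℝ | q.1.time ≤ t ∧ t - q.1.time < q.2} := by
      simp only [sojournSet, mem_ofPred_eq, h2, jumpTime_succ]
      refine and_congr_right fun _ => ⟨fun _ => by linarith, fun _ => by linarith⟩
    by_cases h4 : ω ∈ sojournSet T t n
    · simp only [G, indicator_of_mem h4, indicator_of_mem (h3.1 h4)]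
    · simp only [G, indicator_of_notMem h4, indicator_of_notMem (fun h5 => h4 (h3.2 h5))]
  have h2 : ∀ x : Aff, ∑' k, ∫⁻ s, G (x, s) ∂(jumpLaw P F j k) = lastJump P F j f t x := by
    intro x
    have h3 : ∀ k, ∫⁻ s, G (x, s) ∂(jumpLaw P F j k)
        = (if 0 ≤ t - x.time then jumpLaw P F j k (Ioi (t - x.time)) else 0)
          * f (t - x.time, Real.exp (-x.rate), x.shift) := fun k => by
      split_ifs with hx
      · rw [mul_comm, ← lintegral_indicator_one measurableSet_Ioi,
          ← lintegral_const_mul _ (measurable_one.indicator measurableSet_Ioi)]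
        refine lintegral_congr fun s => ?_
        by_cases hs : t - x.time < s
        · simp [G, hs, sub_nonneg.1 hx]
        · simp [G, hs]
      · have : ¬ x.time ≤ t := fun hc => hx (sub_nonneg.2 hc)
        simp [G, this]
    simp_rw [h3]
    rw [ENNReal.tsum_mul_right, lastJump, holdTail]
    split_ifs <;> simp
  have h4 := congrArg (fun ν => ∫⁻ q, G q ∂ν) (sum_map_restrict_inter (Pr := Pr)
    (h.measurable_J (n + 1)) hJ (hw.prodMk (h.measurable_T (n + 1))))
  have h5 : ∀ k, (Pr.restrict ({ω | J n ω = j} ∩ {ω | J (n + 1) ω = k})).map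
        (fun ω => (affWalk a b J T 0 n ω, T (n + 1) ω))
      = (visitMeas Pr J T a b j n).prod (jumpLaw P F j k) := fun k => by
    have := h.map_restrict_prodMk (E := univ) (@MeasurableSet.univ _ (history J T n)) hwh j k
    rwa [univ_inter] at this
  simp only [h5, lintegral_sum_measure, lintegral_prod _ hG.aemeasurable] at h4
  rw [lintegral_map hG (hw.prodMk (h.measurable_T (n + 1)))] at h4
  rw [h1, h4, ← lintegral_tsum fun k => (Measurable.lintegral_prod_right' hG).aemeasurable]
  simp_rw [h2]

-- Sum over the index of the last jump and insert the renewal structure of the visits to `j`. Here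
-- `y` is the stretch up to the first visit and `x` the product of the complete cycles since then.
open Classical in
theorem IsMarkovRenewal.lintegral_stateAt (h : IsMarkovRenewal P F p Pr J T)
    (hE : ErgodicEnvironment P F μ) (hne : NonExplosive Pr T) (j : S)
    {f : ℝ × ℝ × ℝ → ℝ≥0∞} (hf : Measurable f) {t : ℝ} (ht : 0 ≤ t) :
    ∫⁻ ω, (if (stateAt a b J T t ω).2.2.2 = j then f ((stateAt a b J T t ω).1,
        (stateAt a b J T t ω).2.1, (stateAt a b J T t ω).2.2.1) else 0) ∂Pr
      = ∫⁻ y, ∑' k, ∫⁻ x, holdTail P F j (t - y.time - x.time)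
          * f (t - y.time - x.time, Real.exp (-x.rate) * Real.exp (-y.rate), x.act y.shift)
          ∂(affPow (cycleMeas P F a b j) k)
          ∂(Measure.sum (firstHitMeas Pr J T a b j)) := by
  have := hE.isFiniteMeasure
  have := hE.isProbabilityMeasure_cycleMeas (a := a) (b := b)
  have hlm := measurable_lastJump (P := P) (F := F) j hf t
  have h1 : ∫⁻ ω, (if (stateAt a b J T t ω).2.2.2 = j then f ((stateAt a b J T t ω).1,
        (stateAt a b J T t ω).2.1, (stateAt a b J T t ω).2.2.1) else 0) ∂Pr
      = ∫⁻ x, lastJump P F j f t x ∂(Measure.sum (visitMeas Pr J T a b j)) := by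
    conv_lhs => rw [h.eq_sum_restrict_sojournSet hE hne ht]
    rw [lintegral_sum_measure, lintegral_sum_measure]
    refine tsum_congr fun n => ?_
    have hJ : MeasurableSet {ω | J n ω = j} := h.measurable_J n (MeasurableSet.singleton j)
    rw [← h.lintegral_inter_sojournSet hE j hf, inter_comm, ← Measure.restrict_restrict hJ,
      ← lintegral_indicator hJ]
    refine lintegral_congr_ae ?_
    filter_upwards [h.ae_restrict_stateAt hE hne t n] with ω hω
    simp only [hω.1.stateAt_eq hω.2, indicator_apply, mem_ofPred_eq]
  rw [h1, h.sum_visitMeas (P := P) (F := F), lintegral_sum_measure]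
  have h2 : ∀ k, ∫⁻ x, lastJump P F j f t x
        ∂(affPow (cycleMeas P F a b j) k ∗ₘ Measure.sum (firstHitMeas Pr J T a b j))
      = ∫⁻ y, ∫⁻ x, lastJump P F j f t (x * y) ∂(affPow (cycleMeas P F a b j) k)
          ∂(Measure.sum (firstHitMeas Pr J T a b j)) := fun k => by
    rw [Measure.lintegral_mconv hlm]
    exact lintegral_lintegral_swap (hlm.comp measurable_mul).aemeasurable
  simp_rw [h2]
  rw [← lintegral_tsum fun k => (Measurable.lintegral_prod_left'
    (f := fun z : Aff × Aff => lastJump P F j f t (z.1 * z.2))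
    (hlm.comp measurable_mul)).aemeasurable]
  refine lintegral_congr fun y => tsum_congr fun k => lintegral_congr fun x => ?_
  have h3 : t - (x * y).time = t - y.time - x.time := by rw [Aff.time_mul]; ring
  have h4 : Real.exp (-(x * y).rate) = Real.exp (-x.rate) * Real.exp (-y.rate) := by
    rw [Aff.rate_mul, neg_add, Real.exp_add]
  rw [lastJump, h3, h4]
  rfl

open Classical in
/-- The limit law of the age, the discount, the perpetuity and the state, on the event that the
state is `j`. -/
theorem IsMarkovRenewal.tendsto_lintegral_stateAt
    [∀ j, IsProbabilityMeasure (cycleMeas P F a b j)] (h : IsMarkovRenewal P F p Pr J T)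
    (hE : ErgodicEnvironment P F μ) (hne : NonExplosive Pr T) (j : S)
    (hC : Contractive (cycleMeas P F a b j))
    {f : ℝ × ℝ × ℝ → ℝ≥0∞} (hf : Measurable f) (hf1 : ∀ q, f q ≤ 1) {C : ℝ≥0}
    (hfL : ∀ x φ φ' i i', f (x, φ, i)
      ≤ f (x, φ', i') + C * ENNReal.ofReal (|φ - φ'| + |i - i'|)) :
    Tendsto (fun t : ℝ => ∫⁻ ω, (
        if (stateAt a b J T t ω).2.2.2 = j then f ((stateAt a b J T t ω).1,
        (stateAt a b J T t ω).2.1, (stateAt a b J T t ω).2.2.1) else 0) ∂Pr) atTop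
      (𝓝 ((∫⁻ v, (∫⁻ x, holdTail P F j x * f (x, 0, v)) ∂(perpetuityLaw (cycleMeas P F a b j)))
        / cycleMean P F j)) := by
  have := hE.isFiniteMeasure
  set κ := cycleMeas P F a b j 
  set ν := Measure.sum (firstHitMeas Pr J T a b j) with hν
  have hmean : ∫⁻ x, tailFn (κ.map Aff.time) x = cycleMean P F j :=
    h.lintegral_time_cycleMeas hE j
  have hνp : IsProbabilityMeasure ν := by
    refine ⟨?_⟩
    rw [hν, Measure.sum_apply _ MeasurableSet.univ, ← h.tsum_firstHit hE.jumpLaw_univ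
      hE.irreducible (hE.recurrent j)]
    refine tsum_congr fun n => ?_
    rw [firstHitMeas, Measure.map_apply (h.measurable_affWalk 0 n) MeasurableSet.univ]
    simp
  have hκt : IsProbabilityMeasure (κ.map Aff.time) :=
    Measure.isProbabilityMeasure_map (by fun_prop)
  have hqm := measurable_holdTail (P := P) (F := F) j
  -- Given the initial stretch `y`, the renewal theorem applies with initial slope `exp (-y.rate)`
  -- and initial value `y.shift`; neither affects the limit, nor does the delay `y.time`.
  have hlim : ∀ y : Aff, Tendsto (fun t : ℝ => ∑' k, ∫⁻ x, holdTail P F j (t - y.time - x.time)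
          * f (t - y.time - x.time, Real.exp (-x.rate) * Real.exp (-y.rate), x.act y.shift)
          ∂(affPow κ k)) atTop
      (𝓝 ((∫⁻ v, (∫⁻ x, holdTail P F j x * f (x, 0, v)) ∂(perpetuityLaw κ))
        / cycleMean P F j)) := by
    intro y
    rw [← hmean]
    have h1 := hC.tendsto_tsum_lintegral_affPow (map_time_cycleMeas_Iic hE j)
      (absolutelyContinuous_cycleMeas hE j) (by rw [hmean]; exact hE.cycleMean_ne_top j)
      hqm (h.holdTail_le hE j) hf hf1 hfL (Real.exp (-y.rate)) y.shift
    exact h1.comp (tendsto_atTop_add_const_right _ (-y.time) tendsto_id)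
  have hbound : ∀ (t : ℝ) (y : Aff), ∑' k, ∫⁻ x, holdTail P F j (t - y.time - x.time)
          * f (t - y.time - x.time, Real.exp (-x.rate) * Real.exp (-y.rate), x.act y.shift)
          ∂(affPow κ k) ≤ 1 := by
    intro t y
    refine le_trans (ENNReal.tsum_le_tsum fun k => lintegral_mono fun x => ?_)
      ((tsum_lintegral_time_affPow κ hqm (t - y.time)).trans_le
        (renewalFn_le_one (map_time_cycleMeas_Iic hE j) (h.holdTail_le hE j) _))
    exact mul_le_of_le_one_right' (hf1 _)
  have hmain := tendsto_lintegral_filter_of_dominated_convergence (μ := ν) (l := atTop)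
    (F := fun (t : ℝ) (y : Aff) => ∑' k, ∫⁻ x, holdTail P F j (t - y.time - x.time)
          * f (t - y.time - x.time, Real.exp (-x.rate) * Real.exp (-y.rate), x.act y.shift)
          ∂(affPow κ k)) (f := fun _ =>
      (∫⁻ v, (∫⁻ x, holdTail P F j x * f (x, 0, v)) ∂(perpetuityLaw κ)) / cycleMean P F j)
    (fun _ => 1) (Eventually.of_forall fun t => ?_)
    (Eventually.of_forall fun t => Eventually.of_forall fun y => hbound t y) (by simp)
    (Eventually.of_forall hlim)
  · rw [lintegral_const, measure_univ, mul_one] at hmain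
    refine hmain.congr' ?_
    filter_upwards [eventually_ge_atTop 0] with t ht
    exact (h.lintegral_stateAt hE hne j hf ht).symm
  · refine Measurable.tsum fun k => ?_
    refine Measurable.lintegral_prod_left' (f := fun z : Aff × Aff =>
      holdTail P F j (t - z.2.time - z.1.time) * f (t - z.2.time - z.1.time,
        Real.exp (-z.1.rate) * Real.exp (-z.2.rate), z.1.act z.2.shift)) ?_
    unfold Aff.act
    fun_prop

end PathFormula

/-! ### Convergence in law -/

/-- A form of Scheffé's lemma. Termwise convergence only gives Fatou's lower bound for the sums;
applied to the complementary family `v`, the same bound is an upper bound for `u`, because the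
totals are one before and in the limit. No mass escapes to infinity in the state space. -/
theorem tendsto_tsum_of_add_eq_one {α ι : Type*} {l : Filter α} {u v : α → ι → ℝ≥0∞}
    {u' v' : ι → ℝ≥0∞} (hu : ∀ j, Tendsto (fun t => u t j) l (𝓝 (u' j)))
    (hv : ∀ j, Tendsto (fun t => v t j) l (𝓝 (v' j)))
    (h1 : ∀ᶠ t in l, ∑' j, u t j + ∑' j, v t j = 1) (h2 : ∑' j, u' j + ∑' j, v' j = 1) :
    Tendsto (fun t => ∑' j, u t j) l (𝓝 (∑' j, u' j)) := by
  have key : ∀ {w : α → ι → ℝ≥0∞} {w' : ι → ℝ≥0∞} (_ : ∀ j, Tendsto (fun t => w t j) l (𝓝 (w' j)))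
      {c : ℝ≥0∞}, c < ∑' j, w' j → ∀ᶠ t in l, c < ∑' j, w t j := by
    intro w w' hw c hc
    rw [ENNReal.tsum_eq_iSup_sum, lt_iSup_iff] at hc
    obtain ⟨s, hs⟩ := hc
    filter_upwards [(tendsto_finsetSum s fun j _ => hw j).eventually_const_lt hs] with t ht
    exact ht.trans_le (ENNReal.sum_le_tsum s)
  refine tendsto_order.2 ⟨fun c hc => key hu hc, fun c hc => ?_⟩
  rcases le_or_gt c 1 with hc1 | hc1
  · have hne : ∑' j, v' j ≠ ∞ := ne_top_of_le_ne_top ENNReal.one_ne_top (h2 ▸ le_add_self)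
    have hcv : ∀ x : ℝ≥0∞, 1 - c < x → 1 < c + x := fun x hx => by
      have := ENNReal.add_lt_add_of_le_of_lt (ne_top_of_le_ne_top ENNReal.one_ne_top hc1) le_rfl hx
      rwa [add_tsub_cancel_of_le hc1] at this
    have h3 : 1 - c < ∑' j, v' j := by
      by_contra! h4
      have h5 := ENNReal.add_lt_add_of_lt_of_le hne hc le_rfl
      rw [h2] at h5
      exact absurd (h5.trans_le ((add_le_add_right h4 c).trans_eq (add_tsub_cancel_of_le hc1)))
        (lt_irrefl _)
    filter_upwards [h1, key hv h3] with t h4 h5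
    have h5 := hcv _ h5
    by_contra! h6
    exact absurd (h5.trans_le ((add_le_add_left h6 _).trans h4.le)) (lt_irrefl _)
  · filter_upwards [h1] with t h4
    exact (h4 ▸ le_self_add : ∑' j, u t j ≤ 1).trans_lt hc1

/-! ### The limit law at the last jump. -/

section LimitState

variable {S : Type*} [Countable S] [MeasurableSpace S] [DiscreteMeasurableSpace S]
  {P : S → PMF S} {F : S → S → Measure ℝ} {μ : PMF S} {a b : S → ℝ} {V : S → Measure ℝ}

theorem lintegral_sizeBiasedLaw (j : S) {g : ℝ → ℝ≥0∞} (hg : Measurable g) :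
    ∫⁻ x, g x ∂(sizeBiasedLaw P F j)
      = (∫⁻ x, holdTail P F j x * g x) / meanHolding P F j := by
  have hm : Measurable fun y : ℝ => (∑' k, P j k * F j k (Ioi y)) / meanHolding P F j :=
    (Measurable.tsum fun k => (measurable_measure_Ioi _).const_mul _).div_const _
  rw [sizeBiasedLaw, lintegral_withDensity_eq_lintegral_mul _ hm hg,
    restrict_Ioi_eq_restrict_Ici, ← lintegral_indicator measurableSet_Ici, div_eq_mul_inv,
    ← lintegral_mul_const _ (f := fun x => holdTail P F j x * g x)
      ((measurable_holdTail j).mul hg)]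
  refine lintegral_congr fun x => ?_
  rw [indicator_apply, holdTail]
  simp only [mem_Ici]
  split_ifs
  · simp only [Pi.mul_apply, jumpLaw, Measure.smul_apply, smul_eq_mul, div_eq_mul_inv]
    ring
  · simp

theorem ErgodicEnvironment.isProbabilityMeasure_sizeBiasedLaw (hE : ErgodicEnvironment P F μ)
    (j : S) : IsProbabilityMeasure (sizeBiasedLaw P F j) := by
  have hm : ∀ k, Measurable fun y : ℝ => P j k * F j k (Ioi y) :=
    fun k => (measurable_measure_Ioi _).const_mul _
  refine ⟨?_⟩
  rw [sizeBiasedLaw, withDensity_apply _ MeasurableSet.univ, Measure.restrict_univ]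
  simp only [div_eq_mul_inv]
  rw [lintegral_mul_const _ (Measurable.tsum hm), lintegral_tsum fun k => (hm k).aemeasurable]
  simp_rw [lintegral_const_mul _ (measurable_measure_Ioi _)]
  exact ENNReal.mul_inv_cancel (hE.meanHolding_ne_zero j) (hE.meanHolding_ne_top j)

/-- The limit law of the age, the discount, the perpetuity and the state. -/
def limitStateLaw (P : S → PMF S) (F : S → S → Measure ℝ) (μ : PMF S) (V : S → Measure ℝ) :
    Measure (ℝ × ℝ × ℝ × S) :=
  Measure.sum fun j => limitWeight P F μ j •
    ((sizeBiasedLaw P F j).prod (V j)).map fun q => (q.1, 0, q.2, j)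

theorem lintegral_limitStateLaw {f : ℝ × ℝ × ℝ × S → ℝ≥0∞} (hf : Measurable f) :
    ∫⁻ q, f q ∂(limitStateLaw P F μ V) = ∑' j, limitWeight P F μ j *
      ∫⁻ q, f (q.1, 0, q.2, j) ∂((sizeBiasedLaw P F j).prod (V j)) := by
  rw [limitStateLaw, lintegral_sum_measure]
  refine tsum_congr fun j => ?_
  rw [lintegral_smul_measure, lintegral_map hf (by fun_prop), smul_eq_mul]

theorem ErgodicEnvironment.isProbabilityMeasure_limitStateLaw (hE : ErgodicEnvironment P F μ)
    [∀ j, IsProbabilityMeasure (V j)] : IsProbabilityMeasure (limitStateLaw P F μ V) := by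
  have := hE.isProbabilityMeasure_sizeBiasedLaw
  refine ⟨?_⟩
  have h1 := lintegral_limitStateLaw (P := P) (F := F) (μ := μ) (V := V) (f := fun _ => 1)
    measurable_const
  simpa [hE.tsum_limitWeight] using h1

/-- The renewal limit is rewritten as a mixture component: `holdTail / cycleMean` factors into the
weight `meanHolding / cycleMean` of `j` and the density of the size-biased law. -/
theorem ErgodicEnvironment.limitWeight_mul_lintegral (hE : ErgodicEnvironment P F μ)
    [∀ j, IsProbabilityMeasure (V j)] (j : S) {f : ℝ × ℝ × ℝ → ℝ≥0∞} (hf : Measurable f) :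
    (∫⁻ v, (∫⁻ x, holdTail P F j x * f (x, 0, v)) ∂(V j)) / cycleMean P F j
      = limitWeight P F μ j * ∫⁻ q, f (q.1, 0, q.2) ∂((sizeBiasedLaw P F j).prod (V j)) := by
  have := hE.isProbabilityMeasure_sizeBiasedLaw
  rw [lintegral_prod_symm' (fun q : ℝ × ℝ => f (q.1, 0, q.2)) (by fun_prop)]
  have h1 : ∀ v, ∫⁻ x, f (x, 0, v) ∂(sizeBiasedLaw P F j)
      = (∫⁻ x, holdTail P F j x * f (x, 0, v)) / meanHolding P F j := fun v =>
    lintegral_sizeBiasedLaw j (g := fun x => f (x, 0, v)) (by fun_prop)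
  have hm : Measurable fun v => ∫⁻ x, holdTail P F j x * f (x, 0, v) := by
    refine Measurable.lintegral_prod_left' (f := fun z : ℝ × ℝ =>
      holdTail P F j z.1 * f (z.1, 0, z.2)) ?_
    exact ((measurable_holdTail j).comp measurable_fst).mul (by fun_prop)
  simp_rw [h1, div_eq_mul_inv]
  rw [lintegral_mul_const _ hm, hE.limitWeight_self, div_eq_mul_inv]
  set X := ∫⁻ v, (∫⁻ x, holdTail P F j x * f (x, 0, v)) ∂(V j)
  calc X * (cycleMean P F j)⁻¹
      = (meanHolding P F j * (meanHolding P F j)⁻¹) * (X * (cycleMean P F j)⁻¹) := by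
        rw [ENNReal.mul_inv_cancel (hE.meanHolding_ne_zero j) (hE.meanHolding_ne_top j), one_mul]
    _ = _ := by ring

end LimitState

/-! ### Weak convergence at the last jump. -/

section Weak

variable {S : Type*} [Countable S] [MetricSpace S] [DiscreteTopology S] [MeasurableSpace S]
  [BorelSpace S]
  {Ω : Type*} [MeasurableSpace Ω] {P : S → PMF S} {F : S → S → Measure ℝ} {μ p : PMF S}
  {Pr : Measure Ω} [IsProbabilityMeasure Pr] {J : ℕ → Ω → S} {T : ℕ → Ω → ℝ} {a b : S → ℝ}

/-- Convergence is known on each event that the state is `j`. Since `g` and `1 - g` are both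
admissible and add up to one, the contributions of infinitely many states may be summed. -/
theorem IsMarkovRenewal.tendsto_lintegral_lipschitz
    [∀ j, IsProbabilityMeasure (cycleMeas P F a b j)] (h : IsMarkovRenewal P F p Pr J T)
    (hE : ErgodicEnvironment P F μ) (hne : NonExplosive Pr T)
    (hC : ∀ j, Contractive (cycleMeas P F a b j))
    {g : ℝ × ℝ × ℝ × S → ℝ} (hg0 : ∀ q, 0 ≤ g q) (hg1 : ∀ q, g q ≤ 1) {L : ℝ≥0}
    (hL : LipschitzWith L g) :
    Tendsto (fun t : ℝ≥0 => ∫⁻ ω, ENNReal.ofReal (g (stateAt a b J T t ω)) ∂Pr) atTop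
      (𝓝 (∫⁻ q, ENNReal.ofReal (g q)
        ∂(limitStateLaw P F μ fun j => perpetuityLaw (cycleMeas P F a b j)))) := by
  classical
  have hVp : ∀ j, IsProbabilityMeasure (perpetuityLaw (cycleMeas P F a b j)) :=
    fun j => (hC j).isProbabilityMeasure
  have hΛ := hE.isProbabilityMeasure_limitStateLaw
    (V := fun j => perpetuityLaw (cycleMeas P F a b j))
  have hcoe : Tendsto (fun t : ℝ≥0 => (t : ℝ)) atTop atTop := NNReal.tendsto_coe_atTop.2 tendsto_id
  have hterm : ∀ (k : ℝ × ℝ × ℝ × S → ℝ), (∀ q, k q ≤ 1) → LipschitzWith L k → ∀ j,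
      Tendsto (fun t : ℝ≥0 => ∫⁻ ω, (if (stateAt a b J T t ω).2.2.2 = j then
          ENNReal.ofReal (k (stateAt a b J T t ω)) else 0) ∂Pr) atTop
        (𝓝 (limitWeight P F μ j * ∫⁻ q, ENNReal.ofReal (k (q.1, 0, q.2, j))
          ∂((sizeBiasedLaw P F j).prod (perpetuityLaw (cycleMeas P F a b j))))) := by
    intro k hk1 hkL j
    have hkm : Measurable k := hkL.continuous.measurable
    have hf : Measurable fun q : ℝ × ℝ × ℝ => ENNReal.ofReal (k (q.1, q.2.1, q.2.2, j)) := by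
      fun_prop
    have h1 := h.tendsto_lintegral_stateAt hE hne j (hC j) hf (C := L)
      (fun q => by simpa using hk1 _) (fun x φ φ' i i' => by
        rw [← ENNReal.ofReal_coe_nnreal, ← ENNReal.ofReal_mul L.coe_nonneg]
        refine (ENNReal.ofReal_le_ofReal ?_).trans ENNReal.ofReal_add_le
        have h2 := hkL.dist_le_mul (x, φ, i, j) (x, φ', i', j)
        have h3 : dist (x, φ, i, j) (x, φ', i', j) ≤ |φ - φ'| + |i - i'| := by
          simp only [Prod.dist_eq, dist_self, Real.dist_eq]
          refine max_le (by positivity) (max_le ?_ (max_le ?_ (by positivity)))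
          · linarith [abs_nonneg (i - i')]
          · linarith [abs_nonneg (φ - φ')]
        rw [Real.dist_eq] at h2
        have h4 := le_abs_self (k (x, φ, i, j) - k (x, φ', i', j))
        have h5 := mul_le_mul_of_nonneg_left h3 L.coe_nonneg
        linarith)
    rw [hE.limitWeight_mul_lintegral (V := fun j => perpetuityLaw (cycleMeas P F a b j)) j hf] at h1
    refine (h1.comp hcoe).congr fun t => lintegral_congr fun ω => ?_
    split_ifs with hj
    · rw [← hj]
    · rfl
  have hsum : ∀ (k : ℝ × ℝ × ℝ × S → ℝ), LipschitzWith L k → ∀ t : ℝ≥0,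
      ∫⁻ ω, ENNReal.ofReal (k (stateAt a b J T t ω)) ∂Pr
      = ∑' j, ∫⁻ ω, (if (stateAt a b J T t ω).2.2.2 = j then
          ENNReal.ofReal (k (stateAt a b J T t ω)) else 0) ∂Pr := by
    intro k hkL t
    have hkm : Measurable k := hkL.continuous.measurable
    have hs := h.aemeasurable_stateAt (a := a) (b := b) hE hne t.coe_nonneg
    rw [← lintegral_tsum fun j => ?_]
    · refine lintegral_congr fun ω => ?_
      rw [tsum_eq_single (stateAt a b J T t ω).2.2.2 fun j hj => if_neg hj.symm, if_pos rfl]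
    · have hjm : Measurable fun q : ℝ × ℝ × ℝ × S =>
          if q.2.2.2 = j then ENNReal.ofReal (k q) else 0 :=
        Measurable.ite (by
          have : Measurable fun q : ℝ × ℝ × ℝ × S => q.2.2.2 := by fun_prop
          exact this (MeasurableSet.singleton j)) (by fun_prop) measurable_const
      exact hjm.comp_aemeasurable hs
  have hgm : Measurable g := hL.continuous.measurable
  have hL' : LipschitzWith L fun q => 1 - g q := by
    refine LipschitzWith.of_dist_le_mul fun x y => ?_
    rw [dist_sub_left]
    exact hL.dist_le_mul x y
  have hone : ∀ q, ENNReal.ofReal (g q) + ENNReal.ofReal (1 - g q) = 1 := fun q => by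
    rw [← ENNReal.ofReal_add (hg0 q) (sub_nonneg.2 (hg1 q))]
    simp
  rw [lintegral_limitStateLaw (by fun_prop)]
  simp_rw [hsum g hL]
  refine tendsto_tsum_of_add_eq_one (hterm g hg1 hL)
    (hterm (fun q => 1 - g q) (fun q => sub_le_self _ (hg0 q)) hL')
    (Eventually.of_forall fun t => ?_) ?_
  · have hae : AEMeasurable (fun ω => ENNReal.ofReal (g (stateAt a b J T t ω))) Pr :=
      hgm.ennreal_ofReal.comp_aemeasurable (h.aemeasurable_stateAt hE hne t.coe_nonneg)
    rw [← hsum g hL, ← hsum _ hL', ← lintegral_add_left' hae]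
    simp_rw [hone]
    simp
  · rw [← lintegral_limitStateLaw (V := fun j => perpetuityLaw (cycleMeas P F a b j))
      (f := fun q => ENNReal.ofReal (g q)) (by fun_prop),
      ← lintegral_limitStateLaw (V := fun j => perpetuityLaw (cycleMeas P F a b j))
      (f := fun q => ENNReal.ofReal (1 - g q)) (by fun_prop),
      ← lintegral_add_left (by fun_prop)]
    simp_rw [hone]
    simp

theorem IsMarkovRenewal.tendsto_map_stateAt
    [∀ j, IsProbabilityMeasure (cycleMeas P F a b j)] (h : IsMarkovRenewal P F p Pr J T)
    (hE : ErgodicEnvironment P F μ) (hne : NonExplosive Pr T)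
    (hC : ∀ j, Contractive (cycleMeas P F a b j)) :
    Tendsto (β := ProbabilityMeasure (ℝ × ℝ × ℝ × S))
      (fun t : ℝ≥0 => ⟨Pr.map (stateAt a b J T t),
        Measure.isProbabilityMeasure_map (h.aemeasurable_stateAt hE hne t.coe_nonneg)⟩) atTop
      (𝓝 ⟨limitStateLaw P F μ fun j => perpetuityLaw (cycleMeas P F a b j),
        have := fun j => (hC j).isProbabilityMeasure
        hE.isProbabilityMeasure_limitStateLaw⟩) := by
  have hVp : ∀ j, IsProbabilityMeasure (perpetuityLaw (cycleMeas P F a b j)) :=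
    fun j => (hC j).isProbabilityMeasure
  have hΛ := hE.isProbabilityMeasure_limitStateLaw
    (V := fun j => perpetuityLaw (cycleMeas P F a b j))
  refine tendsto_iff_forall_lipschitz_integral_tendsto.2 ?_
  rintro f ⟨C, hfC⟩ ⟨L, hfL⟩
  obtain ⟨s, _⟩ := μ.support_nonempty
  set m := f (0, 0, 0, s)
  -- `C` bounds the oscillation of `f`; the added `1` keeps `A` positive, so that the rescaled `g`
  -- takes values in `[0, 1]` even when `f` is constant.
  set A := |C| + 1
  have hA : 0 < A := by positivity
  have hfm : Measurable f := hfL.continuous.measurable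
  have hbd : ∀ q, |f q - m| ≤ A := fun q =>
    ((hfC q _).trans (le_abs_self C)).trans (by simp [A])
  let g : ℝ × ℝ × ℝ × S → ℝ := fun q => (f q - m + A) / (2 * A)
  have hg0 : ∀ q, 0 ≤ g q := fun q =>
    div_nonneg (by linarith [(abs_le.1 (hbd q)).1]) (by positivity)
  have hg1 : ∀ q, g q ≤ 1 := fun q => by
    rw [div_le_one (by positivity)]; linarith [(abs_le.1 (hbd q)).2]
  have hgm : Measurable g := by fun_prop
  have hgL : LipschitzWith (L * ⟨(2 * A)⁻¹, by positivity⟩) g := by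
    refine LipschitzWith.of_dist_le_mul fun x y => ?_
    have h1 := hfL.dist_le_mul x y
    have h2 : g x - g y = (2 * A)⁻¹ * (f x - f y) := by simp only [g]; ring
    rw [Real.dist_eq, h2, abs_mul, abs_of_pos (by positivity)]
    rw [Real.dist_eq] at h1
    calc (2 * A)⁻¹ * |f x - f y| ≤ (2 * A)⁻¹ * (L * dist x y) := by gcongr
      _ = L * (2 * A)⁻¹ * dist x y := by ring
  have hfg : ∀ q, f q = 2 * A * g q + (m - A) := fun q => by
    simp only [g]; field_simp; ring
  have hint : ∀ ν : Measure (ℝ × ℝ × ℝ × S), IsProbabilityMeasure ν →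
      ∫ q, f q ∂ν = 2 * A * (∫⁻ q, ENNReal.ofReal (g q) ∂ν).toReal + (m - A) := by
    intro ν hν
    have hgi : Integrable g ν := by
      refine Integrable.of_bound hgm.aestronglyMeasurable 1 (Eventually.of_forall fun q => ?_)
      rw [Real.norm_eq_abs, abs_of_nonneg (hg0 q)]
      exact hg1 q
    rw [← integral_eq_lintegral_of_nonneg_ae (Eventually.of_forall hg0) hgm.aestronglyMeasurable]
    simp_rw [hfg]
    rw [integral_add (hgi.const_mul _) (integrable_const _), integral_const_mul]
    simp
  have hlim := h.tendsto_lintegral_lipschitz hE hne hC hg0 hg1 hgL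
  have hfin : ∫⁻ q, ENNReal.ofReal (g q)
      ∂(limitStateLaw P F μ fun j => perpetuityLaw (cycleMeas P F a b j)) ≠ ∞ :=
    ne_top_of_le_ne_top ENNReal.one_ne_top ((lintegral_mono fun q =>
      ENNReal.ofReal_le_one.2 (hg1 q)).trans (by simp))
  have h3 := (((ENNReal.tendsto_toReal hfin).comp hlim).const_mul (2 * A)).add_const (m - A)
  simp only [ProbabilityMeasure.coe_mk]
  rw [hint _ hΛ]
  refine h3.congr fun t => ?_
  have hs := h.aemeasurable_stateAt (a := a) (b := b) hE hne t.coe_nonneg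
  rw [hint _ (Measure.isProbabilityMeasure_map hs),
    lintegral_map' hgm.ennreal_ofReal.aemeasurable hs]
  rfl

end Weak

/-! ### The limit model -/

section Model

variable {S : Type*} [Countable S] [MeasurableSpace S] [DiscreteMeasurableSpace S]
  {P : S → PMF S} {F : S → S → Measure ℝ} {μ : PMF S} {a b : S → ℝ} {V : S → Measure ℝ}

/-- The discount, the perpetuity and the state at time `t` as a function of `stateAt`. -/
def advance (a b : S → ℝ) (q : ℝ × ℝ × ℝ × S) : ℝ × ℝ × S :=
  (Real.exp (-(a q.2.2.2) * q.1) * q.2.1,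
    b q.2.2.2 * expInt (a q.2.2.2) q.1 + Real.exp (-(a q.2.2.2) * q.1) * q.2.2.1, q.2.2.2)

/-- The state space is discrete, so near any point the state is frozen and `a`, `b` enter only as
constants. -/
theorem continuous_advance [TopologicalSpace S] [DiscreteTopology S] :
    Continuous (advance a b) := by
  refine continuous_iff_continuousAt.2 fun q₀ => ?_
  have h1 : ∀ᶠ q : ℝ × ℝ × ℝ × S in 𝓝 q₀, q.2.2.2 = q₀.2.2.2 :=
    (by fun_prop : Continuous fun q : ℝ × ℝ × ℝ × S => q.2.2.2).continuousAt.eventually_mem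
      ((isOpen_discrete {q₀.2.2.2}).mem_nhds rfl)
  have h2 := continuous_expInt (a q₀.2.2.2)
  refine (ContinuousAt.congr (f := fun q : ℝ × ℝ × ℝ × S =>
    (Real.exp (-(a q₀.2.2.2) * q.1) * q.2.1,
      b q₀.2.2.2 * expInt (a q₀.2.2.2) q.1 + Real.exp (-(a q₀.2.2.2) * q.1) * q.2.2.1, q.2.2.2))
    (Continuous.continuousAt (by fun_prop)) ?_)
  filter_upwards [h1] with q hq
  simp only [advance, hq]

theorem RegularPath.advance_stateAt {Ω : Type*} {J : ℕ → Ω → S} {T : ℕ → Ω → ℝ} {ω : Ω}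
    (h : RegularPath T ω) {t : ℝ} (ht : 0 ≤ t) :
    advance a b (stateAt a b J T t ω) = (discount a (fun s => semiMarkov J T s ω) 0 t,
      perpetuity a b (fun s => semiMarkov J T s ω) 0 t, semiMarkov J T t ω) := by
  have h1 := h.represents_zero (J := J) (a := a) (b := b) ht
  rw [h1.shift, discount, h1.rate, Aff.shift_mul, Aff.rate_mul, neg_add, Real.exp_add]
  simp only [advance, stateAt, sojournMap, Aff.rate_mk, Aff.shift_mk, neg_mul]

theorem measurable_componentMap (j : S) : Measurable fun q : ℝ × ℝ =>
    b j * (∫ s in (0 : ℝ)..q.1, Real.exp (-(a j) * (q.1 - s))) + Real.exp (-(a j) * q.1) * q.2 := by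
  have h : Measurable (expInt (a j)) := (continuous_expInt (a j)).measurable
  change Measurable fun q : ℝ × ℝ => b j * expInt (a j) q.1 + Real.exp (-(a j) * q.1) * q.2
  fun_prop

theorem ErgodicEnvironment.isProbabilityMeasure_componentLaw (hE : ErgodicEnvironment P F μ)
    [∀ j, IsProbabilityMeasure (V j)] (j : S) :
    IsProbabilityMeasure (componentLaw P F a b (V j) j) := by
  have := hE.isProbabilityMeasure_sizeBiasedLaw j
  exact Measure.isProbabilityMeasure_map (measurable_componentMap j).aemeasurable

/-- The law of the limit state, advanced to the present time. -/
theorem lintegral_map_advance (hm : Measurable (advance a b)) {g : ℝ × ℝ × S → ℝ≥0∞}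
    (hg : Measurable g) :
    ∫⁻ q, g q ∂((limitStateLaw P F μ V).map (advance a b))
      = ∑' j, limitWeight P F μ j * ∫⁻ z, g (0, z, j) ∂(componentLaw P F a b (V j) j) := by
  rw [lintegral_map hg hm, lintegral_limitStateLaw (f := fun q => g (advance a b q)) (hg.comp hm)]
  refine tsum_congr fun j => ?_
  rw [componentLaw, lintegral_map (by fun_prop) (measurable_componentMap j)]
  simp [advance, expInt]

theorem limitVector_eq {Ω' : Type*} {U : Ω' → S} {Z : S → Ω' → ℝ} (ω : Ω') :
    limitVector U Z ω = (0, Z (U ω) ω, U ω) := by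
  rw [limitVector, tsum_eq_single (U ω)]
  · simp
  · intro j hj
    exact indicator_of_notMem (by simpa using hj.symm) _

section

variable {Ω' : Type*} [MeasurableSpace Ω'] {Pr' : Measure Ω'} {U : Ω' → S} {Z : S → Ω' → ℝ}

theorem IsLimitModel.aemeasurable_limitVector (h : IsLimitModel P F μ a b V Pr' U Z) :
    AEMeasurable (limitVector U Z) Pr' := by
  have hU := h.law_U.aemeasurable
  have hZ := fun j => (h.law_Z j).aemeasurable
  have hm : Measurable fun q : S × Ω' => (hZ q.1).mk (Z q.1) q.2 :=
    measurable_from_prod_countable_right fun j => (hZ j).measurable_mk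
  refine ⟨fun ω => (0, (hZ (hU.mk U ω)).mk (Z (hU.mk U ω)) ω, hU.mk U ω), ?_, ?_⟩
  · exact measurable_const.prodMk
      ((hm.comp (hU.measurable_mk.prodMk measurable_id)).prodMk hU.measurable_mk)
  · filter_upwards [hU.ae_eq_mk, ae_all_iff.2 fun j => (hZ j).ae_eq_mk] with ω h1 h2
    rw [limitVector_eq, ← h1, ← h2]

/-- Only the component selected by `U` is seen, and `U` is independent of the family. The law is
therefore a mixture of the marginal laws, and the dependence among the `Z j` is irrelevant. -/
theorem IsLimitModel.lintegral_limitVector (h : IsLimitModel P F μ a b V Pr' U Z)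
    {g : ℝ × ℝ × S → ℝ≥0∞} (hg : Measurable g) :
    ∫⁻ ω, g (limitVector U Z ω) ∂Pr'
      = ∑' j, limitWeight P F μ j * ∫⁻ z, g (0, z, j) ∂(componentLaw P F a b (V j) j) := by
  classical
  have hU := h.law_U.aemeasurable
  have hZ := fun j => (h.law_Z j).aemeasurable
  have hgj : ∀ j, Measurable fun z : ℝ => g (0, z, j) := fun j => by fun_prop
  have hind : ∀ j, Measurable (({j} : Set S).indicator (1 : S → ℝ≥0∞)) := fun j =>
    measurable_one.indicator (MeasurableSet.singleton j)
  have h1 : ∀ ω, g (limitVector U Z ω)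
      = ∑' j, ({j} : Set S).indicator (1 : S → ℝ≥0∞) (U ω) * g (0, Z j ω, j) := fun ω => by
    rw [limitVector_eq, tsum_eq_single (U ω)]
    · simp
    · intro j hj
      rw [indicator_of_notMem (by simpa using hj.symm), zero_mul]
  simp_rw [h1]
  have hae : ∀ j, AEMeasurable (fun ω => ({j} : Set S).indicator (1 : S → ℝ≥0∞) (U ω)
      * g (0, Z j ω, j)) Pr' := fun j =>
    ((hind j).comp_aemeasurable hU).mul ((hgj j).comp_aemeasurable (hZ j))
  rw [lintegral_tsum hae]
  refine tsum_congr fun j => ?_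
  have hindep : IndepFun (fun ω => ({j} : Set S).indicator (1 : S → ℝ≥0∞) (U ω))
      (fun ω => g (0, Z j ω, j)) Pr' :=
    h.indep.comp (hind j) ((hgj j).comp (measurable_pi_apply j))
  have h2 := lintegral_mul_eq_lintegral_mul_lintegral_of_indepFun''
    ((hind j).comp_aemeasurable hU) ((hgj j).comp_aemeasurable (hZ j)) hindep
  refine h2.trans ?_
  congr 1
  · have h3 := lintegral_map' (hind j).aemeasurable hU
    rw [h.law_U.map_eq, lintegral_limitLaw] at h3
    refine h3.symm.trans ?_
    rw [tsum_eq_single j]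
    · simp
    · intro l hl
      rw [indicator_of_notMem (by simpa using hl), mul_zero]
  · rw [← (h.law_Z j).map_eq, lintegral_map' (hgj j).aemeasurable (hZ j)]
    rfl

end

/-- A product space suffices, with the components `Z j` taken mutually independent. -/
theorem ErgodicEnvironment.exists_isLimitModel (hE : ErgodicEnvironment P F μ)
    [∀ j, IsProbabilityMeasure (V j)] :
    ∃ (Pr' : Measure (S × (S → ℝ))), IsProbabilityMeasure Pr' ∧
      IsLimitModel P F μ a b V Pr' Prod.fst fun j ω => ω.2 j := by
  have := hE.isProbabilityMeasure_limitLaw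
  have := hE.isProbabilityMeasure_componentLaw (a := a) (b := b) (V := V)
  refine ⟨(limitLaw P F μ).prod
    (Measure.infinitePi fun j => componentLaw P F a b (V j) j), inferInstance, ?_, ?_, ?_⟩
  · exact ⟨by fun_prop, by rw [Measure.map_fst_prod]; simp⟩
  · intro j
    refine ⟨by fun_prop, ?_⟩
    have h1 : (fun ω : S × (S → ℝ) => ω.2 j) = (fun x : S → ℝ => x j) ∘ Prod.snd := rfl
    rw [h1, ← Measure.map_map (by fun_prop) (by fun_prop), Measure.map_snd_prod, measure_univ,
      one_smul]
    exact Measure.infinitePi_map_eval (fun j => componentLaw P F a b (V j) j) j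
  · exact indepFun_prod (X := fun s : S => s) (Y := fun x : S → ℝ => x) measurable_id measurable_id

end Model

/-! ### Continuous mapping to the present time. -/

section Main

variable {S : Type*} [Countable S] [TopologicalSpace S] [DiscreteTopology S] [MeasurableSpace S]
  [BorelSpace S]
  {Ω : Type*} [MeasurableSpace Ω] {P : S → PMF S} {F : S → S → Measure ℝ} {μ p : PMF S}
  {Pr : Measure Ω} [IsProbabilityMeasure Pr] {J : ℕ → Ω → S} {T : ℕ → Ω → ℝ} {a b : S → ℝ}

theorem IsMarkovRenewal.tendstoInDistribution
    [∀ j, IsProbabilityMeasure (cycleMeas P F a b j)] (h : IsMarkovRenewal P F p Pr J T)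
    (hE : ErgodicEnvironment P F μ) (hne : NonExplosive Pr T)
    (hC : ∀ j, Contractive (cycleMeas P F a b j))
    {Ω' : Type*} [MeasurableSpace Ω'] {Pr' : Measure Ω'} [IsProbabilityMeasure Pr']
    {U : Ω' → S} {Z : S → Ω' → ℝ}
    (hM : IsLimitModel P F μ a b (fun j => perpetuityLaw (cycleMeas P F a b j)) Pr' U Z) :
    TendstoInDistribution
      (fun (t : ℝ≥0) (ω : Ω) =>
        (discount a (fun s => semiMarkov J T s ω) 0 t,
          perpetuity a b (fun s => semiMarkov J T s ω) 0 t, semiMarkov J T t ω))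
      atTop (limitVector U Z) (fun _ => Pr) Pr' := by
  let _ := TopologicalSpace.metrizableSpaceMetric S
  have hg : Continuous (advance a b) := continuous_advance
  have hgm : Measurable (advance a b) := hg.measurable
  have hs := fun t : ℝ≥0 => h.aemeasurable_stateAt (a := a) (b := b) hE hne t.coe_nonneg
  have heq : ∀ t : ℝ≥0, (fun ω => (discount a (fun s => semiMarkov J T s ω) 0 t,
      perpetuity a b (fun s => semiMarkov J T s ω) 0 t, semiMarkov J T t ω))
      =ᵐ[Pr] advance a b ∘ stateAt a b J T t := fun t => by
    filter_upwards [h.ae_regularPath hE hne] with ω hω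
    exact (hω.advance_stateAt t.coe_nonneg).symm
  -- Both laws integrate test functions to the same mixture over the states, so the limit does not
  -- depend on the chosen model.
  have hlim : Pr'.map (limitVector U Z)
      = (limitStateLaw P F μ fun j => perpetuityLaw (cycleMeas P F a b j)).map (advance a b) := by
    refine Measure.ext_of_lintegral _ fun f hf => ?_
    rw [lintegral_map' hf.aemeasurable hM.aemeasurable_limitVector, hM.lintegral_limitVector hf,
      lintegral_map_advance hgm hf]
  refine ⟨fun t => (hgm.comp_aemeasurable (hs t)).congr (heq t).symm,
    hM.aemeasurable_limitVector, ?_⟩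
  have h1 := ProbabilityMeasure.tendsto_map_of_tendsto_of_continuous _ _
    (h.tendsto_map_stateAt hE hne hC) hg
  refine (Tendsto.congr (fun t => Subtype.ext ?_) h1).trans_eq ?_
  · change (Pr.map (stateAt a b J T t)).map (advance a b) = Pr.map _
    rw [AEMeasurable.map_map_of_aemeasurable hgm.aemeasurable (hs t)]
    exact (Measure.map_congr (heq t)).symm
  · exact congrArg 𝓝 (Subtype.ext hlim.symm)

end Main

end SemiMarkov

end

theorem theorem1 {S : Type u} [Countable S] [TopologicalSpace S] [DiscreteTopology S]
    [MeasurableSpace S] [BorelSpace S] {Ω : Type v} [MeasurableSpace Ω]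
    (Pr : Measure Ω) [IsProbabilityMeasure Pr]
    (P : S → PMF S) (F : S → S → Measure ℝ) (μ p : PMF S) (a b : S → ℝ)
    (J : ℕ → Ω → S) (T : ℕ → Ω → ℝ)
    (hE : ErgodicEnvironment P F μ)
    (hJT : IsMarkovRenewal P F p Pr J T)
    (hne : NonExplosive Pr T)
    (ha_int : Integrable a (limitLaw P F μ))
    (ha_pos : 0 < ∫ i, a i ∂(limitLaw P F μ))
    (hb : ∀ j, Integrable (fun ω => Real.posLog |(cyclePair a b J T j ω).2|) Pr) :
    ∃ V : S → Measure ℝ,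
      (∀ j, SolvesSRE (Pr.map (cyclePair a b J T j)) (V j) ∧
        ∀ ν, SolvesSRE (Pr.map (cyclePair a b J T j)) ν → ν = V j) ∧
      (∃ (Ω' : Type u) (_ : MeasurableSpace Ω') (Pr' : Measure Ω') (U : Ω' → S)
        (Z : S → Ω' → ℝ), IsProbabilityMeasure Pr' ∧ IsLimitModel P F μ a b V Pr' U Z) ∧
      ∀ (Ω' : Type w) [MeasurableSpace Ω'] (Pr' : Measure Ω') [IsProbabilityMeasure Pr']
        (U : Ω' → S) (Z : S → Ω' → ℝ), IsLimitModel P F μ a b V Pr' U Z →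
        TendstoInDistribution
          (fun (t : ℝ≥0) (ω : Ω) =>
            (discount a (fun s => semiMarkov J T s ω) 0 t,
              perpetuity a b (fun s => semiMarkov J T s ω) 0 t,
              semiMarkov J T t ω))
          atTop (limitVector U Z) (fun _ => Pr) Pr' := by
  have hκ := hE.isProbabilityMeasure_cycleMeas (a := a) (b := b)
  have hC := fun j => hJT.contractive hE hne ha_int ha_pos (hb j)
  have hVp := fun j => (hC j).isProbabilityMeasure
  refine ⟨fun j => perpetuityLaw (cycleMeas P F a b j), fun j => ?_, ?_, ?_⟩
  · rw [(hJT.map_cyclePair hE hne j).2]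
    exact ⟨(hC j).solvesSRE, fun ν hν => (hC j).eq_of_solvesSRE hν⟩
  · obtain ⟨Pr', h1, h2⟩ := hE.exists_isLimitModel (a := a) (b := b)
      (V := fun j => perpetuityLaw (cycleMeas P F a b j))
    exact ⟨S × (S → ℝ), inferInstance, Pr', _, _, h1, h2⟩
  · intro Ω' _ Pr' _ U Z hM
    exact hJT.tendstoInDistribution hE hne hC hM
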